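/- A tiling of the plane is a set of regions that cover the plane and meet one another only along their boundaries (not necessarily edge to edge). Its perimeter ratio is $\limsup_{R\to\infty} L(R)/(\pi R^2)$, where $L(R)$ is the length of the part of the union of the tile boundaries lying in the disc of radius $R$ about the origin (shared boundary counted once). Its average tile perimeter is the same upper limit with $L(R)$ replaced by the sum, over all tiles, of the length of the part of the tile's boundary in that disc (shared boundary counted once for each tile). The Cairo and the Prismatic pentagon are the unit-area convex pentagons circumscribed about a circle with two right angles and three angles $2\pi/3$; the right angles are non-adjacent in the Cairo and adjacent in the Prismatic pentagon. Theorem 3.5. (i) Every tiling of the plane by unit-area convex polygons with at most five sides has perimeter ratio at least $\sqrt{2+\sqrt3}$ and average tile perimeter at least $2\sqrt{2+\sqrt3}$. (ii) Every tiling of the plane by Cairo and Prismatic pentagons, in any mixture, is perimeter-minimizing among the tilings in (i), with perimeter ratio exactly $\sqrt{2+\sqrt3}$ and average tile perimeter exactly $2\sqrt{2+\sqrt3}$, which is the perimeter of each Cairo and each Prismatic pentagon. (iii) There are a tiling by Cairo pentagons only, a tiling by Prismatic pentagons only, and infinitely many pairwise non-congruent tilings each containing both Cairo and Prismatic pentagons.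 -/

import Mathlib

open MeasureTheory Filter
open scoped ENNReal

noncomputable section

namespace PentagonalTiling

/-- The Euclidean plane. -/
abbrev Plane : Type := EuclideanSpace ℝ (Fin 2)

/-- One-dimensional Hausdorff measure (length) of subsets of the plane. -/
def length (S : Set Plane) : ℝ≥0∞ := Measure.hausdorffMeasure (1 : ℝ) S

/-- The perimeter of a planar region: the length of its boundary. -/
def perimeter (P : Set Plane) : ℝ≥0∞ := length (frontier P)

/-- A (closed, filled) convex polygon of unit area with at most five sides:
the convex hull of at most five points, of area one. -/
def IsUnitConvexPolygonLeFive (P : Set Plane) : Prop :=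
  (∃ s : Finset Plane, s.card ≤ 5 ∧ P = convexHull ℝ (s : Set Plane)) ∧ volume P = 1

/-- A tiling of the plane: a set of regions which cover the plane and which meet one another
only along their boundaries.  Tiles need not meet edge to edge. -/
def IsTiling (𝒯 : Set (Set Plane)) : Prop :=
  ⋃₀ 𝒯 = Set.univ ∧
    ∀ S ∈ 𝒯, ∀ T ∈ 𝒯, S ≠ T → S ∩ T ⊆ frontier S ∩ frontier T

/-- A tiling of the plane by unit-area convex polygons with at most five sides. -/
def IsAdmissible (𝒯 : Set (Set Plane)) : Prop :=
  IsTiling 𝒯 ∧ ∀ T ∈ 𝒯, IsUnitConvexPolygonLeFive T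

/-- The perimeter ratio of a tiling: the upper limit, as `R → ∞`, of the perimeter of the tiling
inside the disc of radius `R` about the origin, divided by `π R ^ 2`.  A portion of boundary
shared by two tiles is counted once. -/
def perimeterRatio (𝒯 : Set (Set Plane)) : ℝ≥0∞ :=
  limsup (fun R : ℝ =>
    length ((⋃ T ∈ 𝒯, frontier T) ∩ Metric.closedBall 0 R) / ENNReal.ofReal (Real.pi * R ^ 2))
    atTop

/-- The same ratio with the perimeter counted tile by tile, so that a portion of boundary shared
by two tiles is counted for each of them (average perimeter per tile). -/
def tilePerimeterRatio (𝒯 : Set (Set Plane)) : ℝ≥0∞ :=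
  limsup (fun R : ℝ =>
    (∑' T : 𝒯, length (frontier (T : Set Plane) ∩ Metric.closedBall 0 R)) /
      ENNReal.ofReal (Real.pi * R ^ 2))
    atTop

/-- An admissible tiling which minimizes perimeter among all admissible tilings (with either way
of counting). -/
def IsPerimeterMinimizing (𝒯 : Set (Set Plane)) : Prop :=
  IsAdmissible 𝒯 ∧ ∀ 𝒮 : Set (Set Plane), IsAdmissible 𝒮 →
    perimeterRatio 𝒯 ≤ perimeterRatio 𝒮 ∧ tilePerimeterRatio 𝒯 ≤ tilePerimeterRatio 𝒮

/-- `v` lists, in cyclic order, the vertices of the convex pentagon `P`. -/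
def IsConvexPentagon (v : Fin 5 → Plane) (P : Set Plane) : Prop :=
  ConvexIndependent ℝ v ∧ P = convexHull ℝ (Set.range v) ∧
    ∀ i, segment ℝ (v i) (v (i + 1)) ⊆ frontier P

/-- `P` is a unit-area convex pentagon circumscribed about a circle (a circle inside `P` touches
all five sides), with interior angles `α 0, …, α 4` in cyclic order. -/
def IsCircumscribedPentagon (α : Fin 5 → ℝ) (P : Set Plane) : Prop :=
  volume P = 1 ∧ ∃ v : Fin 5 → Plane, IsConvexPentagon v P ∧
    (∀ i, EuclideanGeometry.angle (v (i - 1)) (v i) (v (i + 1)) = α i) ∧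
    ∃ (c : Plane) (r : ℝ), 0 < r ∧ Metric.closedBall c r ⊆ P ∧
      ∀ i, (Metric.sphere c r ∩ segment ℝ (v i) (v (i + 1))).Nonempty

/-- The Cairo pentagon, in any position: its two right angles are not adjacent. -/
def IsCairo (P : Set Plane) : Prop :=
  IsCircumscribedPentagon
    ![2 * Real.pi / 3, 2 * Real.pi / 3, Real.pi / 2, 2 * Real.pi / 3, Real.pi / 2] P

/-- The Prismatic pentagon, in any position: its two right angles are adjacent. -/
def IsPrismatic (P : Set Plane) : Prop :=
  IsCircumscribedPentagon
    ![Real.pi / 2, Real.pi / 2, 2 * Real.pi / 3, 2 * Real.pi / 3, 2 * Real.pi / 3] P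

/-- A tiling in which every tile is Cairo or Prismatic. -/
def IsCairoPrismaticTiling (𝒯 : Set (Set Plane)) : Prop :=
  IsTiling 𝒯 ∧ ∀ T ∈ 𝒯, IsCairo T ∨ IsPrismatic T

/-- Congruence of tilings under isometries of the plane. -/
def TilingCongruent (𝒮 𝒯 : Set (Set Plane)) : Prop :=
  ∃ φ : Plane ≃ᵢ Plane, 𝒯 = (fun T => φ '' T) '' 𝒮

end PentagonalTiling

end

noncomputable section

namespace PentagonalTiling

/-! The lower bound is a discharging argument. Among convex polygons with given angles `αᵢ` and area
`A`, one circumscribed about a circle has least perimeter, so that `L² ≥ 4 A ∑ cot (αᵢ / 2)`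
(`four_mul_area_mul_sum_cot_le`). The convex function `cot (α / 2)` is compared with its chord
through `α = π / 2` and `α = 2π / 3`. If the chord were a lower bound, then `n ≤ 5` and an angle sum
of `(n - 2)π` would give `L ≥ 2 * cc` with `cc² = 2 + √3` at once. Between the two angles the chord
lies above the graph, and the error is booked as a charge: chord plus `cc * charge α` is the maximum
of the tangent lines at the two angles. A quadratic surplus in the tangent bound completes a square,
so a unit-area tile has perimeter at least `2 * cc + ∑ charge αᵢ` (`cot_half_ge`, `sq_le_sum_cot`,
`exists_tile_data`).

At a point of the tiling the vertex angles sum to `2π`, or to `π` if the point is interior to a side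
of another tile. Three angles of sum `2π` average `2π / 3`; in all other cases the average is at
most `π / 2`. The corresponding branch of `charge` therefore makes the total charge at the point
nonnegative (`sum_charge_nonneg`). Only tiles crossing the boundary of the disc spoil the count, and
an averaging over disjoint shells gives arbitrarily large radii `R` with only `O(R)` of them
(`exists_few_crossing`). This bounds the average tile perimeter. The other ratio is half of it,
because apart from countably many vertices a boundary point is on the boundary of at most two tiles
(`tileLength_le`), and local finiteness forces at least two (`two_mul_unionLength_le`).

For equality, a unit-area circumscribed pentagon has perimeter `2 √(∑ cot (αᵢ / 2))`. The Cairo and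
Prismatic pentagons have the same angles up to order, so both give `2 * cc`; since diameters are
bounded, counting tiles by area gives the matching upper bound.

For existence, consider equiangular hexagons with sides `longSide`, `shortSide` and `l`. With `l =
shortSide` such a hexagon splits into two Prismatic pentagons, with `l = longSide` into four Cairo
pentagons (`dissects_prismPair`, `dissects_cairoQuad`). Columns of these hexagons have a boundary
zigzag that does not depend on `l`, so columns of both kinds can be put side by side in any order
(`isTiling_columnTiling`). Placing a block of `n` Prismatic columns among Cairo columns gives mixed
tilings; the size of a disc avoiding all Cairo tiles is a congruence invariant that grows linearly
with `n` (`exists_mixed_tilings`). -/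

/-- The planar cross product. -/
def cross (u w : Plane) : ℝ := u 0 * w 1 - u 1 * w 0

/-- Twice the signed area of the triangle `p q x`. -/
def orient (p q x : Plane) : ℝ := cross (q - p) (x - p)

lemma orient_def (p q x : Plane) :
    orient p q x = (q 0 - p 0) * (x 1 - p 1) - (q 1 - p 1) * (x 0 - p 0) := by
  simp [orient, cross]

lemma orient_rotate (p q x : Plane) : orient p q x = orient q x p := by
  simp only [orient_def]; ring

lemma orient_swap (p q x : Plane) : orient p q x = - orient q p x := by
  simp only [orient_def]; ring

lemma inner_eq (u w : Plane) : inner ℝ u w = u 0 * w 0 + u 1 * w 1 := by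
  simp [PiLp.inner_apply, Fin.sum_univ_two]; ring

lemma norm_sq_eq (u : Plane) : ‖u‖ ^ 2 = u 0 ^ 2 + u 1 ^ 2 := by
  rw [← real_inner_self_eq_norm_sq, inner_eq]; ring

lemma plane_ext {x y : Plane} (h0 : x 0 = y 0) (h1 : x 1 = y 1) : x = y := by
  ext i; fin_cases i <;> assumption

lemma measurableSet_and₃ {α : Type*} [MeasurableSpace α] {P Q R : α → Prop}
    (hP : MeasurableSet {x | P x}) (hQ : MeasurableSet {x | Q x}) (hR : MeasurableSet {x | R x}) :
    MeasurableSet {x | P x ∧ Q x ∧ R x} :=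
  hP.inter (hQ.inter hR)

lemma measurePreserving_coords :
    MeasurePreserving (fun x : Plane => ((x 0, x 1) : ℝ × ℝ)) :=
  (volume_preserving_finTwoArrow ℝ).comp (PiLp.volume_preserving_ofLp (Fin 2))

lemma continuous_cross_right (u p : Plane) : Continuous (fun x : Plane => cross u (x - p)) := by
  unfold cross; fun_prop

lemma continuous_orient (p q : Plane) : Continuous (fun x : Plane => orient p q x) := by
  unfold orient; exact continuous_cross_right _ _

/-! ### Area of circular sectors -/

/-- In polar coordinates the two half-plane conditions of a sector become sign conditions on `sin t`
and `sin (θ - t)`. Both arguments stay above `-π`, where a negative argument has negative sine. -/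
lemma mem_Icc_iff_sin {θ t : ℝ} (h0 : 0 < θ) (hπ : θ ≤ Real.pi) (ht : t ∈ Set.Ioo (-Real.pi) Real.pi) :
    (0 ≤ Real.sin t ∧ 0 ≤ Real.sin (θ - t)) ↔ t ∈ Set.Icc 0 θ := by
  obtain ⟨h1, h2⟩ := ht
  constructor
  · rintro ⟨ha, hb⟩
    have ht0 : 0 ≤ t := by
      by_contra h
      push Not at h
      exact absurd ha (not_le.2 (Real.sin_neg_of_neg_of_neg_pi_lt h h1))
    refine ⟨ht0, ?_⟩
    by_contra h
    push Not at h
    exact absurd hb (not_le.2 (Real.sin_neg_of_neg_of_neg_pi_lt (by linarith) (by linarith)))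
  · rintro ⟨ha, hb⟩
    exact ⟨Real.sin_nonneg_of_nonneg_of_le_pi ha (by linarith),
      Real.sin_nonneg_of_nonneg_of_le_pi (by linarith) (by linarith)⟩

lemma lintegral_Ioo_id {ε : ℝ} (hε : 0 < ε) :
    ∫⁻ r in Set.Ioo 0 ε, ENNReal.ofReal r = ENNReal.ofReal (ε ^ 2 / 2) := by
  rw [← ofReal_integral_eq_lintegral_ofReal]
  · rw [← integral_Ioc_eq_integral_Ioo, ← intervalIntegral.integral_of_le hε.le, integral_id]
    simp
  · exact (continuous_id.integrableOn_Icc (a := 0) (b := ε)).mono_set Set.Ioo_subset_Icc_self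
  · filter_upwards [ae_restrict_mem measurableSet_Ioo] with x hx using hx.1.le

/-- Polar coordinates turn the sector into a rectangle with density `r`. The value `θ = π` is
allowed, so that half discs are included. -/
lemma volume_sector_prod {θ ε : ℝ} (h0 : 0 < θ) (hπ : θ ≤ Real.pi) (hε : 0 < ε) :
    volume {x : ℝ × ℝ | 0 ≤ x.2 ∧ 0 ≤ Real.sin θ * x.1 - Real.cos θ * x.2 ∧
      x.1 ^ 2 + x.2 ^ 2 < ε ^ 2} = ENNReal.ofReal (θ / 2 * ε ^ 2) := by
  set S := {x : ℝ × ℝ | 0 ≤ x.2 ∧ 0 ≤ Real.sin θ * x.1 - Real.cos θ * x.2 ∧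
      x.1 ^ 2 + x.2 ^ 2 < ε ^ 2} with hS
  have hSm : MeasurableSet S := by
    exact measurableSet_and₃ (measurableSet_le (by fun_prop) (by fun_prop))
      (measurableSet_le (by fun_prop) (by fun_prop)) (measurableSet_lt (by fun_prop) (by fun_prop))
  rw [← lintegral_indicator_one hSm, ← lintegral_comp_polarCoord_symm]
  have hEq : ∀ x ∈ polarCoord.target, ENNReal.ofReal x.1 • S.indicator 1 (polarCoord.symm x)
      = (Set.Ioo 0 ε ×ˢ Set.Icc 0 θ).indicator (fun p : ℝ × ℝ => ENNReal.ofReal p.1) x := by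
    rintro ⟨r, t⟩ ⟨hr, ht⟩
    simp only [Set.mem_Ioi] at hr
    have key : polarCoord.symm (r, t) ∈ S ↔ (r, t) ∈ Set.Ioo 0 ε ×ˢ Set.Icc 0 θ := by
      simp only [hS, polarCoord_symm_apply, Set.mem_ofPred_eq, Set.mem_prod, ← mem_Icc_iff_sin h0 hπ ht,
        Set.mem_Ioo]
      have e1 : Real.sin θ * (r * Real.cos t) - Real.cos θ * (r * Real.sin t)
          = r * Real.sin (θ - t) := by rw [Real.sin_sub]; ring
      have e2 : (r * Real.cos t) ^ 2 + (r * Real.sin t) ^ 2 = r ^ 2 := by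
        have := Real.sin_sq_add_cos_sq t
        linear_combination r ^ 2 * this
      rw [e1, e2, mul_nonneg_iff_of_pos_left hr, mul_nonneg_iff_of_pos_left hr,
        pow_lt_pow_iff_left₀ hr.le hε.le two_ne_zero]
      tauto
    by_cases h : polarCoord.symm (r, t) ∈ S
    · rw [Set.indicator_of_mem h, Set.indicator_of_mem (key.1 h)]; simp
    · rw [Set.indicator_of_notMem h, Set.indicator_of_notMem (fun h' => h (key.2 h'))]; simp
  rw [setLIntegral_congr_fun polarCoord.open_target.measurableSet hEq,
    setLIntegral_indicator (measurableSet_Ioo.prod measurableSet_Icc)]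
  -- For `θ = π` the endpoint `t = π` is outside the target of polar coordinates; losing it does not
  -- change the measure.
  have hI : (Set.Ioo 0 ε ×ˢ Set.Icc 0 θ) ∩ polarCoord.target
      = Set.Ioo 0 ε ×ˢ (Set.Icc 0 θ ∩ Set.Ioo (-Real.pi) Real.pi) := by
    rw [polarCoord_target, Set.prod_inter_prod]
    congr 1
    ext x; simp; tauto
  have hv : volume (Set.Icc 0 θ ∩ Set.Ioo (-Real.pi) Real.pi) = ENNReal.ofReal θ := by
    apply le_antisymm
    · exact (measure_mono Set.inter_subset_left).trans (by simp)
    · calc ENNReal.ofReal θ = volume (Set.Ioo 0 θ) := by simp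
        _ ≤ _ := by
          refine measure_mono fun x hx => ?_
          exact ⟨⟨hx.1.le, hx.2.le⟩, by linarith [hx.1, Real.pi_pos], by linarith [hx.2]⟩
  rw [hI, Measure.volume_eq_prod, ← Measure.prod_restrict, lintegral_prod _ (by fun_prop)]
  simp only [lintegral_const, Measure.restrict_apply MeasurableSet.univ, Set.univ_inter, hv]
  rw [lintegral_mul_const _ (by fun_prop), lintegral_Ioo_id hε, ← ENNReal.ofReal_mul (by positivity)]
  congr 1; ring

/-- The orthonormal coordinates with respect to the unit vector `u`. -/
def frameLin (u : Plane) : Plane →ₗ[ℝ] Plane where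
  toFun x := !₂[inner ℝ u x, cross u x]
  map_add' x y := by
    apply plane_ext
    · simp [inner_add_right]
    · simp [cross]; ring
  map_smul' c x := by
    apply plane_ext
    · simp [inner_smul_right]
    · simp [cross]; ring

/-- Rotation of the plane taking the unit vector `u` to the first coordinate vector. -/
def frame (u : Plane) (hu : ‖u‖ = 1) : Plane ≃ₗᵢ[ℝ] Plane :=
  LinearIsometry.toLinearIsometryEquiv
    { frameLin u with
      norm_map' := fun x => by
        have h1 : u 0 ^ 2 + u 1 ^ 2 = 1 := by rw [← norm_sq_eq, hu]; norm_num
        have : ‖frameLin u x‖ ^ 2 = ‖x‖ ^ 2 := by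
          rw [norm_sq_eq, norm_sq_eq]
          simp only [frameLin, LinearMap.coe_mk, AddHom.coe_mk, inner_eq, cross]
          simp
          linear_combination (x 0 ^ 2 + x 1 ^ 2) * h1
        exact (pow_left_inj₀ (norm_nonneg _) (norm_nonneg _) two_ne_zero).1 this } rfl

lemma volume_frame_preimage (u : Plane) (hu : ‖u‖ = 1) (p : Plane) (S : Set (ℝ × ℝ))
    (hS : MeasurableSet S) :
    volume {x : Plane | (inner ℝ u (x - p), cross u (x - p)) ∈ S} = volume S := by
  have h1 : MeasurePreserving (fun x : Plane => x - p) := measurePreserving_sub_right volume p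
  have h2 := (frame u hu).measurePreserving.comp h1
  exact (measurePreserving_coords.comp h2).measure_preimage hS.nullMeasurableSet

lemma cos_angle_of_norm_one {u w : Plane} (hu : ‖u‖ = 1) (hw : ‖w‖ = 1) :
    Real.cos (InnerProductGeometry.angle u w) = inner ℝ u w := by
  rw [InnerProductGeometry.cos_angle, hu, hw]; simp

lemma sin_angle_of_norm_one {u w : Plane} (hu : ‖u‖ = 1) (hw : ‖w‖ = 1) (h : 0 ≤ cross u w) :
    Real.sin (InnerProductGeometry.angle u w) = cross u w := by
  have h1 : u 0 ^ 2 + u 1 ^ 2 = 1 := by rw [← norm_sq_eq, hu]; norm_num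
  have h2 : w 0 ^ 2 + w 1 ^ 2 = 1 := by rw [← norm_sq_eq, hw]; norm_num
  have h3 := Real.sin_sq_add_cos_sq (InnerProductGeometry.angle u w)
  rw [cos_angle_of_norm_one hu hw, inner_eq] at h3
  have h4 : Real.sin (InnerProductGeometry.angle u w) ^ 2 = cross u w ^ 2 := by
    simp only [cross]
    linear_combination h3 - (w 0 ^ 2 + w 1 ^ 2) * h1 - h2
  exact (pow_left_inj₀ (InnerProductGeometry.sin_angle_nonneg _ _) h two_ne_zero).1 h4

/-- In the frame with first axis `u`, the vector `w` is `(cos, sin)` of the angle, so the wedge is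
the standard sector. -/
lemma volume_wedge_unit {u w : Plane} (hu : ‖u‖ = 1) (hw : ‖w‖ = 1) (h : 0 ≤ cross u w)
    (hne : 0 < InnerProductGeometry.angle u w) (p : Plane) {ε : ℝ} (hε : 0 < ε) :
    volume ({x : Plane | 0 ≤ cross u (x - p) ∧ 0 ≤ cross (x - p) w} ∩ Metric.ball p ε)
      = ENNReal.ofReal (InnerProductGeometry.angle u w / 2 * ε ^ 2) := by
  rw [← volume_sector_prod hne (InnerProductGeometry.angle_le_pi _ _) hε,
    ← volume_frame_preimage u hu p]
  · congr 1
    ext x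
    have h1 : u 0 ^ 2 + u 1 ^ 2 = 1 := by rw [← norm_sq_eq, hu]; norm_num
    simp only [Set.mem_inter_iff, Set.mem_ofPred_eq, Metric.mem_ball, and_assoc]
    rw [sin_angle_of_norm_one hu hw h, cos_angle_of_norm_one hu hw]
    have e1 : cross u w * inner ℝ u (x - p) - inner ℝ u w * cross u (x - p) = cross (x - p) w := by
      simp only [inner_eq, cross]
      linear_combination ((x - p) 0 * w 1 - (x - p) 1 * w 0) * h1
    have e2 : inner ℝ u (x - p) ^ 2 + cross u (x - p) ^ 2 = dist x p ^ 2 := by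
      rw [dist_eq_norm, norm_sq_eq]
      simp only [inner_eq, cross]
      linear_combination ((x - p) 0 ^ 2 + (x - p) 1 ^ 2) * h1
    rw [e1, e2, pow_lt_pow_iff_left₀ dist_nonneg hε.le two_ne_zero]
  · exact measurableSet_and₃ (measurableSet_le (by fun_prop) (by fun_prop))
      (measurableSet_le (by fun_prop) (by fun_prop)) (measurableSet_lt (by fun_prop) (by fun_prop))

lemma cross_smul_left (c : ℝ) (u w : Plane) : cross (c • u) w = c * cross u w := by
  simp [cross]; ring

lemma cross_smul_right (c : ℝ) (u w : Plane) : cross u (c • w) = c * cross u w := by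
  simp [cross]; ring

lemma cross_neg_right (u w : Plane) : cross u (-w) = - cross u w := by
  simp [cross]; ring

lemma cross_swap (u w : Plane) : cross u w = - cross w u := by
  simp [cross]; ring

lemma cross_self (u : Plane) : cross u u = 0 := by
  simp [cross]; ring

lemma cross_add_left (u u' w : Plane) : cross (u + u') w = cross u w + cross u' w := by
  simp [cross]; ring

lemma cross_add_right (u w w' : Plane) : cross u (w + w') = cross u w + cross u w' := by
  simp [cross]; ring

lemma cross_sub_left (u u' w : Plane) : cross (u - u') w = cross u w - cross u' w := by
  simp [cross]; ring

lemma cross_sub_right (u w w' : Plane) : cross u (w - w') = cross u w - cross u w' := by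
  simp [cross]; ring

/-- Area of a circular sector bounded by the rays in directions `u` and `w`. -/
lemma volume_wedge {u w : Plane} (hu : u ≠ 0) (hw : w ≠ 0) (h : 0 ≤ cross u w)
    (hne : 0 < InnerProductGeometry.angle u w) (p : Plane) {ε : ℝ} (hε : 0 < ε) :
    volume ({x : Plane | 0 ≤ cross u (x - p) ∧ 0 ≤ cross (x - p) w} ∩ Metric.ball p ε)
      = ENNReal.ofReal (InnerProductGeometry.angle u w / 2 * ε ^ 2) := by
  have hu' : 0 < ‖u‖⁻¹ := by positivity
  have hw' : 0 < ‖w‖⁻¹ := by positivity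
  have := volume_wedge_unit (u := ‖u‖⁻¹ • u) (w := ‖w‖⁻¹ • w) (norm_smul_inv_norm hu)
    (norm_smul_inv_norm hw) (by rw [cross_smul_left, cross_smul_right]; positivity)
    (by rwa [InnerProductGeometry.angle_smul_left_of_pos _ _ hu',
      InnerProductGeometry.angle_smul_right_of_pos _ _ hw']) p hε
  rw [InnerProductGeometry.angle_smul_left_of_pos _ _ hu',
      InnerProductGeometry.angle_smul_right_of_pos _ _ hw'] at this
  simpa only [cross_smul_left, cross_smul_right, mul_nonneg_iff_of_pos_left hu',
    mul_nonneg_iff_of_pos_left hw'] using this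

/-- Area of a half disc. -/
lemma volume_half_disc {u : Plane} (hu : u ≠ 0) (p : Plane) {ε : ℝ} (hε : 0 < ε) :
    volume ({x : Plane | 0 ≤ cross u (x - p)} ∩ Metric.ball p ε)
      = ENNReal.ofReal (Real.pi / 2 * ε ^ 2) := by
  have ha : InnerProductGeometry.angle u (-u) = Real.pi :=
    InnerProductGeometry.angle_self_neg_of_nonzero hu
  have := volume_wedge hu (neg_ne_zero.2 hu) (by rw [cross_neg_right, cross_self]; simp)
    (by rw [ha]; exact Real.pi_pos) p hε
  rw [ha] at this
  rw [← this]
  congr 2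
  ext x
  have : cross (x - p) (-u) = cross u (x - p) := by
    rw [cross_neg_right, cross_swap]; simp
  simp [this]

/-! ### Area of triangles -/

lemma volume_std_triangle_prod :
    volume {x : ℝ × ℝ | 0 ≤ x.1 ∧ 0 ≤ x.2 ∧ x.1 + x.2 ≤ 1} = ENNReal.ofReal (1 / 2) := by
  set S := {x : ℝ × ℝ | 0 ≤ x.1 ∧ 0 ≤ x.2 ∧ x.1 + x.2 ≤ 1} with hS
  have hSm : MeasurableSet S := by
    exact measurableSet_and₃ (measurableSet_le (by fun_prop) (by fun_prop))
      (measurableSet_le (by fun_prop) (by fun_prop)) (measurableSet_le (by fun_prop) (by fun_prop))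
  rw [Measure.volume_eq_prod, Measure.prod_apply hSm]
  have : ∀ x : ℝ, volume (Prod.mk x ⁻¹' S)
      = (Set.Icc (0 : ℝ) 1).indicator (fun x => ENNReal.ofReal (1 - x)) x := by
    intro x
    by_cases hx : x ∈ Set.Icc (0 : ℝ) 1
    · rw [Set.indicator_of_mem hx]
      have : Prod.mk x ⁻¹' S = Set.Icc 0 (1 - x) := by
        ext y; simp only [hS, Set.mem_preimage, Set.mem_ofPred_eq, Set.mem_Icc]
        exact ⟨fun h => ⟨h.2.1, by linarith [h.2.2]⟩, fun h => ⟨hx.1, h.1, by linarith [h.2]⟩⟩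
      rw [this]; simp
    · rw [Set.indicator_of_notMem hx]
      have : Prod.mk x ⁻¹' S = ∅ := by
        ext y; simp only [hS, Set.mem_preimage, Set.mem_ofPred_eq, Set.mem_empty_iff_false, iff_false]
        exact fun h => hx ⟨h.1, by linarith [h.2.2, h.2.1]⟩
      rw [this]; simp
  simp_rw [this]
  rw [lintegral_indicator measurableSet_Icc, ← ofReal_integral_eq_lintegral_ofReal]
  · congr 1
    rw [integral_Icc_eq_integral_Ioc, ← intervalIntegral.integral_of_le zero_le_one]
    rw [intervalIntegral.integral_sub (by simp) (by simp)]
    simp; norm_num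
  · exact (by fun_prop : Continuous fun x : ℝ => 1 - x).integrableOn_Icc
  · filter_upwards [ae_restrict_mem measurableSet_Icc] with x hx
    simpa using hx.2

lemma volume_std_triangle :
    volume {x : Plane | 0 ≤ x 0 ∧ 0 ≤ x 1 ∧ x 0 + x 1 ≤ 1} = ENNReal.ofReal (1 / 2) := by
  rw [← volume_std_triangle_prod]
  refine measurePreserving_coords.measure_preimage
    (s := {x : ℝ × ℝ | 0 ≤ x.1 ∧ 0 ≤ x.2 ∧ x.1 + x.2 ≤ 1}) (MeasurableSet.nullMeasurableSet ?_)
  exact measurableSet_and₃ (measurableSet_le (by fun_prop) (by fun_prop))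
      (measurableSet_le (by fun_prop) (by fun_prop)) (measurableSet_le (by fun_prop) (by fun_prop))

/-- The linear map with columns `u` and `w`. -/
def colMap (u w : Plane) : Plane →ₗ[ℝ] Plane :=
  Matrix.toLin (EuclideanSpace.basisFun (Fin 2) ℝ).toBasis (EuclideanSpace.basisFun (Fin 2) ℝ).toBasis
    !![u 0, w 0; u 1, w 1]

lemma colMap_det (u w : Plane) : LinearMap.det (colMap u w) = cross u w := by
  rw [colMap, LinearMap.det_toLin, Matrix.det_fin_two_of, cross]; ring

lemma colMap_apply (u w x : Plane) : colMap u w x = x 0 • u + x 1 • w := by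
  apply plane_ext <;>
  · simp [colMap, Matrix.toLin_apply, Matrix.mulVec, dotProduct, Fin.sum_univ_two]
    ring

/-- The barycentric coordinates of `y` are the three orientations divided by `orient p q x`. -/
lemma mem_triangle_iff {p q x y : Plane} (h : 0 < orient p q x) :
    y ∈ convexHull ℝ {p, q, x} ↔ 0 ≤ orient p q y ∧ 0 ≤ orient q x y ∧ 0 ≤ orient x p y := by
  constructor
  · intro hy
    rw [convexHull_insert (by simp), convexHull_pair, convexJoin_singleton_left] at hy
    simp only [Set.mem_iUnion, segment, Set.mem_ofPred_eq] at hy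
    obtain ⟨z, ⟨a, b, ha, hb, hab, rfl⟩, a', b', ha', hb', hab', rfl⟩ := hy
    obtain rfl : a' = 1 - b' := by linarith
    obtain rfl : a = 1 - b := by linarith
    have e1 : orient p q ((1 - b') • p + b' • ((1 - b) • q + b • x)) = b' * b * orient p q x := by
      simp only [orient_def, PiLp.add_apply, PiLp.smul_apply, smul_eq_mul]; ring
    have e2 : orient q x ((1 - b') • p + b' • ((1 - b) • q + b • x)) = (1 - b') * orient p q x := by
      simp only [orient_def, PiLp.add_apply, PiLp.smul_apply, smul_eq_mul]; ring
    have e3 : orient x p ((1 - b') • p + b' • ((1 - b) • q + b • x)) = b' * (1 - b) * orient p q x := by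
      simp only [orient_def, PiLp.add_apply, PiLp.smul_apply, smul_eq_mul]; ring
    rw [e1, e2, e3]
    refine ⟨by positivity, by positivity, by positivity⟩
  · rintro ⟨h1, h2, h3⟩
    set D := orient p q x with hD
    have hsum : orient q x y + orient x p y + orient p q y = D := by
      simp only [hD, orient_def]; ring
    have hy : y = (orient q x y / D) • p + (orient x p y / D) • q + (orient p q y / D) • x := by
      have hD0 := h.ne'
      apply plane_ext <;>
      · simp only [PiLp.add_apply, PiLp.smul_apply, smul_eq_mul]
        field_simp
        simp only [hD, orient_def]; ring
    rw [hy]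
    refine (convex_convexHull ℝ _).sum_mem (t := Finset.univ)
      (w := ![orient q x y / D, orient x p y / D, orient p q y / D]) (z := ![p, q, x]) ?_ ?_ ?_ |>
      fun h => by simpa [Fin.sum_univ_three] using h
    · intro i _; fin_cases i <;> simp <;> positivity
    · simp [Fin.sum_univ_three]; field_simp; linarith
    · intro i _; apply subset_convexHull; fin_cases i <;> simp

/-- The triangle is an affine image of the standard one, and the determinant of the linear part is
the orientation. -/
lemma volume_triangle {p q x : Plane} (h : 0 < orient p q x) :
    volume (convexHull ℝ {p, q, x}) = ENNReal.ofReal (orient p q x / 2) := by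
  have himg : convexHull ℝ {p, q, x} = (fun y => p + y) ''
      (colMap (q - p) (x - p) '' {y : Plane | 0 ≤ y 0 ∧ 0 ≤ y 1 ∧ y 0 + y 1 ≤ 1}) := by
    set D := orient p q x with hD
    have hD0 := h.ne'
    ext y
    rw [mem_triangle_iff h]
    simp only [Set.mem_image, Set.mem_ofPred_eq, exists_exists_and_eq_and, colMap_apply]
    constructor
    · rintro ⟨h1, h2, h3⟩
      have hsum : orient q x y + orient x p y + orient p q y = D := by
        simp only [hD, orient_def]; ring
      refine ⟨!₂[orient x p y / D, orient p q y / D], ⟨?_, ?_, ?_⟩, ?_⟩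
      · simp; positivity
      · simp; positivity
      · simp; rw [← add_div, div_le_one h]; linarith
      · apply plane_ext <;>
        · simp only [PiLp.add_apply, PiLp.sub_apply, PiLp.smul_apply, smul_eq_mul]
          simp
          field_simp
          simp only [hD, orient_def]; ring
    · rintro ⟨z, ⟨h1, h2, h3⟩, rfl⟩
      have e1 : orient p q (p + (z 0 • (q - p) + z 1 • (x - p))) = z 1 * D := by
        simp only [hD, orient_def, PiLp.add_apply, PiLp.sub_apply, PiLp.smul_apply, smul_eq_mul]; ring
      have e2 : orient q x (p + (z 0 • (q - p) + z 1 • (x - p))) = (1 - z 0 - z 1) * D := by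
        simp only [hD, orient_def, PiLp.add_apply, PiLp.sub_apply, PiLp.smul_apply, smul_eq_mul]; ring
      have e3 : orient x p (p + (z 0 • (q - p) + z 1 • (x - p))) = z 0 * D := by
        simp only [hD, orient_def, PiLp.add_apply, PiLp.sub_apply, PiLp.smul_apply, smul_eq_mul]; ring
      rw [e1, e2, e3]
      exact ⟨by positivity, mul_nonneg (by linarith) h.le, by positivity⟩
  rw [himg, Set.image_add_left, measure_preimage_add, Measure.addHaar_image_linearMap,
    volume_std_triangle, colMap_det, ← orient, abs_of_pos h, ← ENNReal.ofReal_mul h.le]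
  congr 1; ring

lemma volume_line {u : Plane} (hu : u ≠ 0) (p : Plane) : volume {x : Plane | cross u (x - p) = 0} = 0 := by
  have hu' : 0 < ‖u‖⁻¹ := by positivity
  have h := volume_frame_preimage (‖u‖⁻¹ • u) (norm_smul_inv_norm hu) p (Set.univ ×ˢ {0})
    (MeasurableSet.univ.prod (measurableSet_singleton _))
  rw [Measure.volume_eq_prod, Measure.prod_prod] at h
  simpa [cross_smul_left, hu] using h

/-! ### Strictly convex polygons -/

/-- `v` lists periodically, in counterclockwise order, the vertices of a strictly convex
`n`-gon. -/
structure CcwPolygon (n : ℕ) (v : ℕ → Plane) : Prop where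
  three_le : 3 ≤ n
  periodic : ∀ i, v (i + n) = v i
  pos : ∀ i j k, i < j → j < k → k < i + n → 0 < orient (v i) (v j) (v k)

/-- Signed distance (times side length) of `x` from the line of the `i`th side. -/
def edge (v : ℕ → Plane) (i : ℕ) (x : Plane) : ℝ := orient (v i) (v (i + 1)) x

lemma continuous_edge (v : ℕ → Plane) (i : ℕ) : Continuous (edge v i) := continuous_orient _ _

lemma orient_left_self (p q : Plane) : orient p q p = 0 := by simp [orient_def]

lemma orient_right_self (p q : Plane) : orient p q q = 0 := by simp only [orient_def]; ring

lemma orient_same (p x : Plane) : orient p p x = 0 := by simp [orient_def]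

lemma orient_combo (p q x y : Plane) (s t : ℝ) (h : s + t = 1) :
    orient p q (s • x + t • y) = s * orient p q x + t * orient p q y := by
  obtain rfl : s = 1 - t := by linarith
  simp only [orient_def, PiLp.add_apply, PiLp.smul_apply, smul_eq_mul]; ring

lemma convex_orient_nonneg (p q : Plane) : Convex ℝ {x | 0 ≤ orient p q x} := by
  intro x hx y hy s t hs ht hst
  simp only [Set.mem_ofPred_eq] at *
  rw [orient_combo _ _ _ _ _ _ hst]
  positivity

lemma convex_orient_nonpos (p q : Plane) : Convex ℝ {x | orient p q x ≤ 0} := by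
  intro x hx y hy s t hs ht hst
  simp only [Set.mem_ofPred_eq] at *
  rw [orient_combo _ _ _ _ _ _ hst]
  nlinarith

lemma orient_pos_of_mem_interior {p q x : Plane} {S : Set Plane} (hpq : p ≠ q)
    (hS : ∀ y ∈ S, 0 ≤ orient p q y) (hx : x ∈ interior S) : 0 < orient p q x := by
  refine lt_of_le_of_ne (hS x (interior_subset hx)) fun h0 => ?_
  -- `w` is the outer normal of the half plane: a small move along it from a point of the line would
  -- leave `S`.
  let w : Plane := !₂[q 1 - p 1, -(q 0 - p 0)]
  have hc : Tendsto (fun t : ℝ => x + t • w) (nhdsWithin 0 (Set.Ioi 0)) (nhds x) := by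
    have : Continuous (fun t : ℝ => x + t • w) := by fun_prop
    have := this.tendsto 0
    simp only [zero_smul, add_zero] at this
    exact this.mono_left nhdsWithin_le_nhds
  have h1 := hc.eventually (mem_interior_iff_mem_nhds.1 hx)
  obtain ⟨t, ht, ht0⟩ := (h1.and self_mem_nhdsWithin).exists
  have h2 := hS _ ht
  have e : orient p q (x + t • w) = orient p q x - t * ((q 0 - p 0) ^ 2 + (q 1 - p 1) ^ 2) := by
    simp only [orient_def, PiLp.add_apply, PiLp.smul_apply, smul_eq_mul, w]
    simp; ring
  have h3 : 0 < (q 0 - p 0) ^ 2 + (q 1 - p 1) ^ 2 := by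
    have := norm_sq_eq (q - p)
    simp only [PiLp.sub_apply] at this
    rw [← this]
    have : q - p ≠ 0 := sub_ne_zero.2 hpq.symm
    positivity
  rw [e, ← h0] at h2
  have : 0 < t * ((q 0 - p 0) ^ 2 + (q 1 - p 1) ^ 2) := mul_pos ht0 h3
  linarith

lemma edge_eq_zero_of_mem_segment {v : ℕ → Plane} {i : ℕ} {x : Plane} (hx : x ∈ segment ℝ (v i) (v (i + 1))) :
    edge v i x = 0 := by
  obtain ⟨s, t, -, -, hst, rfl⟩ := hx
  rw [edge, orient_combo _ _ _ _ _ _ hst, orient_left_self, orient_right_self]; ring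

lemma segment_subset_hull (v : ℕ → Plane) (i : ℕ) : segment ℝ (v i) (v (i + 1)) ⊆ convexHull ℝ (Set.range v) :=
  (convex_convexHull ℝ _).segment_subset (subset_convexHull ℝ _ ⟨i, rfl⟩)
    (subset_convexHull ℝ _ ⟨i + 1, rfl⟩)

/-! ### Angles measured by area -/

/-- `T` has interior angle `θ` at `p`, measured by area in small discs. -/
def HasAngle (T : Set Plane) (p : Plane) (θ : ℝ) : Prop :=
  ∀ᶠ ε in nhdsWithin (0 : ℝ) (Set.Ioi 0),
    volume (T ∩ Metric.ball p ε) = ENNReal.ofReal (θ / 2 * ε ^ 2)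

/-- An angle depends only on the germ of the set at the point. Measuring it by area makes the angle
sum at a point of a tiling a matter of additivity of measure. -/
lemma HasAngle.of_eventually_eq {T S : Set Plane} {p : Plane} {θ : ℝ}
    (h : ∀ᶠ x in nhds p, x ∈ T ↔ x ∈ S)
    (hS : ∀ ε : ℝ, 0 < ε → volume (S ∩ Metric.ball p ε) = ENNReal.ofReal (θ / 2 * ε ^ 2)) :
    HasAngle T p θ := by
  obtain ⟨δ, hδ, hball⟩ := Metric.eventually_nhds_iff_ball.1 h
  filter_upwards [Ioo_mem_nhdsGT hδ] with ε hε
  rw [← hS ε hε.1]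
  congr 1
  ext x
  simp only [Set.mem_inter_iff]
  exact and_congr_left fun hx => hball x (Metric.ball_subset_ball hε.2.le hx)

lemma HasAngle.of_mem_interior {T : Set Plane} {p : Plane} (h : p ∈ interior T) :
    HasAngle T p (2 * Real.pi) := by
  refine HasAngle.of_eventually_eq (S := Set.univ) ?_ ?_
  · filter_upwards [mem_interior_iff_mem_nhds.1 h] with x hx
    simp [hx]
  · intro ε hε
    rw [Set.univ_inter, EuclideanSpace.volume_ball_fin_two, ← ENNReal.ofReal_pow hε.le,
      ← ENNReal.ofReal_mul (by positivity)]
    congr 1; ring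

lemma length_pair (p q : Plane) : length {p, q} = 0 := by
  unfold length
  have : Measure.hausdorffMeasure (1 : ℝ) ({p, q} : Set Plane) = 0 := by
    have := Measure.nullSingletonClass_hausdorff Plane (d := 1) one_pos
    exact Set.Finite.measure_zero (Set.toFinite _) _
  exact this

namespace CcwPolygon

variable {n : ℕ} {v : ℕ → Plane}

/-- Orientation is invariant under cyclic rotation of a triple, so a triple reaching past `n` can be
reduced modulo the period and rotated back into increasing order. -/
lemma of_lt (hn : 3 ≤ n) (hper : ∀ i, v (i + n) = v i)
    (h : ∀ i j k, i < j → j < k → k < n → 0 < orient (v i) (v j) (v k)) : CcwPolygon n v := by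
  refine ⟨hn, hper, ?_⟩
  intro i
  induction i using Nat.strong_induction_on with
  | _ i ih =>
    intro j k hij hjk hk
    by_cases hin : n ≤ i
    · have := ih (i - n) (by omega) (j - n) (k - n) (by omega) (by omega) (by omega)
      rw [← hper (i - n), ← hper (j - n), ← hper (k - n)] at this
      rwa [Nat.sub_add_cancel hin, Nat.sub_add_cancel (by omega), Nat.sub_add_cancel (by omega)]
        at this
    by_cases hjn : n ≤ j
    · have := h (j - n) (k - n) i (by omega) (by omega) (by omega)
      rw [← hper (j - n), ← hper (k - n)] at this
      rw [Nat.sub_add_cancel (by omega), Nat.sub_add_cancel (by omega)] at this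
      rwa [orient_rotate]
    by_cases hkn : n ≤ k
    · have := h (k - n) i j (by omega) (by omega) (by omega)
      rw [← hper (k - n), Nat.sub_add_cancel (by omega)] at this
      rwa [orient_rotate, orient_rotate]
    exact h i j k hij hjk (by omega)

variable (hP : CcwPolygon n v)
include hP

lemma shift (m : ℕ) : CcwPolygon n (fun i => v (i + m)) :=
  ⟨hP.three_le, fun i => by rw [show i + n + m = i + m + n by ring]; exact hP.periodic _,
    fun i j k h1 h2 h3 => hP.pos _ _ _ (by omega) (by omega) (by omega)⟩

lemma map_mod (i : ℕ) : v (i % n) = v i :=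
  Function.Periodic.map_mod_nat (f := v) (a := n) hP.periodic i

/-- Moves an index, together with everything following it, into the period starting at `i`, where
`pos` applies. -/
lemma exists_rep (i j : ℕ) : ∃ j', i ≤ j' ∧ j' < i + n ∧ ∀ t, v (j' + t) = v (j + t) := by
  have hn : 0 < n := by have := hP.three_le; omega
  -- Adding `i * n` leaves the residue unchanged and keeps the natural subtraction exact.
  refine ⟨i + (j + i * n - i) % n, by omega, by have := Nat.mod_lt (j + i * n - i) hn; omega, ?_⟩
  intro t
  rw [← hP.map_mod, ← hP.map_mod (j + t)]
  congr 1
  have h1 : i ≤ i * n := Nat.le_mul_of_pos_right i hn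
  have : i + (j + i * n - i) % n + t ≡ j + t [MOD n] := by
    refine Nat.ModEq.add_right t ?_
    calc i + (j + i * n - i) % n ≡ i + (j + i * n - i) [MOD n] :=
          Nat.ModEq.add_left _ (Nat.mod_modEq _ _)
      _ = j + i * n := by omega
      _ ≡ j [MOD n] := by simp [Nat.ModEq]
  exact this

lemma ne_of_lt {i j : ℕ} (hij : i < j) (hj : j < i + n) : v i ≠ v j := by
  intro h
  have hn := hP.three_le
  by_cases h1 : j = i + 1
  · have := hP.pos i j (i + 2) hij (by omega) (by omega)
    rw [h, orient_same] at this; exact lt_irrefl _ this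
  · have := hP.pos i (i + 1) j (by omega) (by omega) hj
    rw [h, orient_left_self] at this; exact lt_irrefl _ this

lemma injOn : Set.InjOn v (Set.Iio n) := by
  intro i hi j hj h
  simp only [Set.mem_Iio] at hi hj
  by_contra hne
  rcases Nat.lt_or_gt_of_ne hne with hlt | hlt
  · exact hP.ne_of_lt hlt (by omega) h
  · exact hP.ne_of_lt hlt (by omega) h.symm

lemma ne_succ (i : ℕ) : v i ≠ v (i + 1) :=
  hP.ne_of_lt (by omega) (by have := hP.three_le; omega)

lemma range_eq : Set.range v = v '' Set.Iio n := by
  have hn : 0 < n := by have := hP.three_le; omega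
  ext x; constructor
  · rintro ⟨i, rfl⟩
    exact ⟨i % n, Nat.mod_lt _ hn, hP.map_mod i⟩
  · rintro ⟨i, -, rfl⟩; exact ⟨i, rfl⟩

lemma finite_range : (Set.range v).Finite := by
  rw [hP.range_eq]; exact (Set.finite_Iio n).image _

lemma edge_vertex_nonneg (i j : ℕ) : 0 ≤ edge v i (v j) := by
  obtain ⟨j', h1, h2, h3⟩ := hP.exists_rep i j
  have h3 := h3 0
  simp only [add_zero] at h3
  rw [← h3, edge]
  rcases Nat.lt_or_ge (i + 1) j' with h | h
  · exact (hP.pos i (i + 1) j' (by omega) h h2).le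
  · obtain rfl | rfl : j' = i ∨ j' = i + 1 := by omega
    · rw [orient_left_self]
    · rw [orient_right_self]

lemma edge_nonneg (i : ℕ) {x : Plane} (hx : x ∈ convexHull ℝ (Set.range v)) : 0 ≤ edge v i x := by
  have : convexHull ℝ (Set.range v) ⊆ {x | 0 ≤ orient (v i) (v (i + 1)) x} :=
    convexHull_min (by rintro _ ⟨j, rfl⟩; exact hP.edge_vertex_nonneg i j)
      (convex_orient_nonneg _ _)
  exact this hx

/-- Only the two sides at a vertex vanish there. The alternatives compare endpoints instead of
indices, so that periodic copies of a side count as the same side. -/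
lemma vertex_cases (m j : ℕ) : (v j = v (m + 1) ∧ v (j + 1) = v (m + 2)) ∨
    (v j = v m ∧ v (j + 1) = v (m + 1)) ∨ 0 < edge v j (v (m + 1)) := by
  have hn := hP.three_le
  obtain ⟨m', h1, h2, h3⟩ := hP.exists_rep j (m + 1)
  have h30 := h3 0
  have h31 := h3 1
  -- Advancing by `n - 1` means stepping back by one; this serves the case in which the vertex is
  -- the end of side `j`.
  have h32 := h3 (n - 1)
  simp only [add_zero] at h30
  rcases Nat.lt_or_ge (j + 1) m' with h | h
  · right; right
    rw [← h30]; exact hP.pos j (j + 1) m' (by omega) h h2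
  · obtain rfl | rfl : m' = j ∨ m' = j + 1 := by omega
    · exact Or.inl ⟨h30, h31⟩
    · rw [show j + 1 + (n - 1) = j + n by omega, show m + 1 + (n - 1) = m + n by omega,
        hP.periodic, hP.periodic] at h32
      exact Or.inr (Or.inl ⟨h32, h30⟩)

lemma edge_cases (i j : ℕ) : (v j = v i ∧ v (j + 1) = v (i + 1)) ∨
    0 < edge v j (v i) ∨ 0 < edge v j (v (i + 1)) := by
  have hn := hP.three_le
  obtain ⟨i', h1, h2, h3⟩ := hP.exists_rep j i
  have h30 := h3 0
  have h31 := h3 1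
  simp only [add_zero] at h30
  rcases Nat.lt_or_ge (j + 1) i' with h | h
  · right; left
    rw [← h30]; exact hP.pos j (j + 1) i' (by omega) h h2
  · obtain rfl | rfl : i' = j ∨ i' = j + 1 := by omega
    · exact Or.inl ⟨h30, h31⟩
    · right; right
      rw [← h31]; exact hP.pos j (j + 1) (j + 1 + 1) (by omega) (by omega) (by omega)

/-- Take the first diagonal from `v 0` that does not have `x` strictly on its left. The preceding
diagonal has `x` on its left, so `x` lies in the fan triangle between them. -/
lemma exists_fan {x : Plane} (hx : ∀ i < n, 0 ≤ edge v i x) :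
    ∃ i ∈ Finset.Ico 1 (n - 1), x ∈ convexHull ℝ {v 0, v i, v (i + 1)} := by
  have hn := hP.three_le
  have hlast : orient (v 0) (v (n - 1)) x ≤ 0 := by
    have := hx (n - 1) (by omega)
    rw [edge, show n - 1 + 1 = 0 + n by omega, hP.periodic, orient_swap] at this
    linarith
  have hex : ∃ i, 2 ≤ i ∧ orient (v 0) (v i) x ≤ 0 := ⟨n - 1, by omega, hlast⟩
  classical
  obtain ⟨h2, hi⟩ := Nat.find_spec hex
  have hle : Nat.find hex ≤ n - 1 := Nat.find_min' hex ⟨by omega, hlast⟩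
  set i := Nat.find hex with hidef
  have hprev : 0 ≤ orient (v 0) (v (i - 1)) x := by
    by_cases h : i = 2
    · rw [h]; exact hx 0 (by omega)
    · have := Nat.find_min hex (m := i - 1) (by omega)
      push Not at this
      exact (this (by omega)).le
  refine ⟨i - 1, by simp; omega, ?_⟩
  have hi1 : i - 1 + 1 = i := by omega
  rw [hi1, mem_triangle_iff (hP.pos 0 (i - 1) i (by omega) (by omega) (by omega))]
  refine ⟨hprev, ?_, ?_⟩
  · have := hx (i - 1) (by omega)
    rwa [edge, hi1] at this
  · rw [orient_swap]; linarith

lemma mem_hull_iff {x : Plane} : x ∈ convexHull ℝ (Set.range v) ↔ ∀ i < n, 0 ≤ edge v i x := by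
  refine ⟨fun h i _ => hP.edge_nonneg i h, fun h => ?_⟩
  obtain ⟨i, -, hi⟩ := hP.exists_fan h
  refine convexHull_mono ?_ hi
  rintro y (rfl | rfl | rfl)
  exacts [⟨_, rfl⟩, ⟨_, rfl⟩, ⟨_, rfl⟩]

lemma edge_pos_of_mem_interior (i : ℕ) {x : Plane} (hx : x ∈ interior (convexHull ℝ (Set.range v))) :
    0 < edge v i x :=
  orient_pos_of_mem_interior (hP.ne_succ i) (fun _ hy => hP.edge_nonneg i hy) hx

lemma mem_interior_iff {x : Plane} :
    x ∈ interior (convexHull ℝ (Set.range v)) ↔ ∀ i < n, 0 < edge v i x := by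
  refine ⟨fun h i _ => hP.edge_pos_of_mem_interior i h, fun h => ?_⟩
  rw [mem_interior_iff_mem_nhds]
  have : ∀ᶠ y in nhds x, ∀ i ∈ Finset.range n, 0 < edge v i y := by
    rw [Filter.eventually_all_finset]
    intro i hi
    exact ((continuous_edge v i).tendsto x).eventually (lt_mem_nhds (h i (Finset.mem_range.1 hi)))
  filter_upwards [this] with y hy
  exact hP.mem_hull_iff.2 fun i hi => (hy i (Finset.mem_range.2 hi)).le

lemma isCompact_hull : IsCompact (convexHull ℝ (Set.range v)) := hP.finite_range.isCompact_convexHull ℝ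

lemma isClosed_hull : IsClosed (convexHull ℝ (Set.range v)) := hP.isCompact_hull.isClosed

/-- On the line of a side, the inequality of the preceding side bounds the position from below and
that of the following side bounds it from above. -/
lemma mem_segment_of_edge_eq_zero {i : ℕ} {x : Plane} (hx : x ∈ convexHull ℝ (Set.range v))
    (h0 : edge v i x = 0) : x ∈ segment ℝ (v i) (v (i + 1)) := by
  have hn := hP.three_le
  have h1 : 0 ≤ edge v (i + 1) x := hP.edge_nonneg _ hx
  have h2 : 0 ≤ edge v (i + (n - 1)) x := hP.edge_nonneg _ hx
  rw [edge, show i + (n - 1) + 1 = i + n by omega, hP.periodic] at h2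
  have h3 : 0 < orient (v i) (v (i + 1)) (v (i + 2)) := hP.pos _ _ _ (by omega) (by omega) (by omega)
  have h4 : 0 < orient (v i) (v (i + 1)) (v (i + (n - 1))) :=
    hP.pos _ _ _ (by omega) (by omega) (by omega)
  rw [edge] at h0 h1
  rw [show i + 1 + 1 = i + 2 by omega] at h1
  set p := v i
  set q := v (i + 1)
  set a := v (i + 2)
  set b := v (i + (n - 1))
  -- `x = p + t (q - p)` with `t = orient b p x / orient b p q`
  have h4' : 0 < orient b p q := by rw [orient_rotate]; exact h4
  set t := orient b p x / orient b p q with ht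
  have hxt : x = (1 - t) • p + t • q := by
    apply plane_ext <;>
    · simp only [PiLp.add_apply, PiLp.smul_apply, smul_eq_mul, ht]
      field_simp
      simp only [orient_def] at h0 ⊢
      first
      | linear_combination (b 0 - p 0) * h0
      | linear_combination (b 1 - p 1) * h0
  have ht0 : 0 ≤ t := by positivity
  have ht1 : t ≤ 1 := by
    by_contra hlt
    push Not at hlt
    have : orient q a x = (1 - t) * orient p q a := by
      rw [hxt]; simp only [orient_def, PiLp.add_apply, PiLp.smul_apply, smul_eq_mul]; ring
    rw [this] at h1
    nlinarith
  exact ⟨1 - t, t, by linarith, ht0, by ring, hxt.symm⟩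

lemma frontier_eq : frontier (convexHull ℝ (Set.range v))
    = ⋃ i ∈ Finset.range n, segment ℝ (v i) (v (i + 1)) := by
  rw [hP.isClosed_hull.frontier_eq]
  ext x
  simp only [Set.mem_sdiff, Set.mem_iUnion, Finset.mem_range, exists_prop, hP.mem_interior_iff]
  constructor
  · rintro ⟨h1, h2⟩
    push Not at h2
    obtain ⟨i, hi, h⟩ := h2
    exact ⟨i, hi, hP.mem_segment_of_edge_eq_zero h1 (le_antisymm h (hP.edge_nonneg i h1))⟩
  · rintro ⟨i, hi, h⟩
    exact ⟨segment_subset_hull v i h, fun h' =>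
      (h' i hi).ne' (edge_eq_zero_of_mem_segment h)⟩

lemma segment_inter_subset {i j : ℕ} (hi : i < n) (hj : j < n) (hij : i ≠ j) :
    segment ℝ (v i) (v (i + 1)) ∩ segment ℝ (v j) (v (j + 1)) ⊆ {v i, v (i + 1)} := by
  rintro x ⟨h1, h2⟩
  have h0 := edge_eq_zero_of_mem_segment h2
  obtain ⟨s, t, hs, ht, hst, rfl⟩ := h1
  rw [edge, orient_combo _ _ _ _ _ _ hst] at h0
  have a := hP.edge_vertex_nonneg j i
  have b := hP.edge_vertex_nonneg j (i + 1)
  rw [edge] at a b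
  rcases hP.edge_cases i j with h | h | h
  · exact absurd (hP.injOn (Set.mem_Iio.2 hj) (Set.mem_Iio.2 hi) h.1) hij.symm
  · rw [edge] at h
    have hs0 : s = 0 := by
      by_contra hne
      have : 0 < s * orient (v j) (v (j + 1)) (v i) := mul_pos (lt_of_le_of_ne hs (Ne.symm hne)) h
      nlinarith
    have : t = 1 := by linarith
    simp [hs0, this]
  · rw [edge] at h
    have ht0 : t = 0 := by
      by_contra hne
      have : 0 < t * orient (v j) (v (j + 1)) (v (i + 1)) :=
        mul_pos (lt_of_le_of_ne ht (Ne.symm hne)) h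
      nlinarith
    have : s = 1 := by linarith
    simp [ht0, this]

lemma perimeter_eq : perimeter (convexHull ℝ (Set.range v))
    = ENNReal.ofReal (∑ i ∈ Finset.range n, dist (v i) (v (i + 1))) := by
  rw [perimeter, hP.frontier_eq, length, measure_biUnion_finset₀]
  · rw [ENNReal.ofReal_sum_of_nonneg (fun _ _ => dist_nonneg)]
    refine Finset.sum_congr rfl fun i _ => ?_
    rw [hausdorffMeasure_segment, edist_dist]
  · intro i hi j hj hij
    refine measure_mono_null (hP.segment_inter_subset (by simpa using hi) (by simpa using hj) hij) ?_
    exact length_pair _ _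
  · intro i _
    have : IsCompact (segment ℝ (v i) (v (i + 1))) := by
      rw [← convexHull_pair]; exact (Set.toFinite _).isCompact_convexHull ℝ
    exact this.measurableSet.nullMeasurableSet

/-! ### Area -/

/-- A change of base point alters the shoelace sum by a telescoping sum around a closed polygon. -/
lemma sum_orient_eq (x y : Plane) : ∑ i ∈ Finset.range n, orient x (v i) (v (i + 1))
    = ∑ i ∈ Finset.range n, orient y (v i) (v (i + 1)) := by
  rw [← sub_eq_zero, ← Finset.sum_sub_distrib]
  have : ∀ i, orient x (v i) (v (i + 1)) - orient y (v i) (v (i + 1))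
      = cross (y - x) (v (i + 1)) - cross (y - x) (v i) := by
    intro i; simp only [orient_def, cross, PiLp.sub_apply]; ring
  simp_rw [this]
  rw [Finset.sum_range_sub (fun i => cross (y - x) (v i)), show n = 0 + n by omega, hP.periodic]
  ring

/-- The fan from `v 0` triangulates the polygon: for `i < j` the line through `v 0` and `v j`
separates triangle `i` from triangle `j`. -/
lemma volume_hull (x : Plane) : volume (convexHull ℝ (Set.range v))
    = ENNReal.ofReal ((∑ i ∈ Finset.range n, orient x (v i) (v (i + 1))) / 2) := by
  have hn := hP.three_le
  have hU : convexHull ℝ (Set.range v)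
      = ⋃ i ∈ Finset.Ico 1 (n - 1), convexHull ℝ {v 0, v i, v (i + 1)} := by
    ext x
    simp only [Set.mem_iUnion, exists_prop]
    refine ⟨fun h => hP.exists_fan (hP.mem_hull_iff.1 h), ?_⟩
    rintro ⟨i, -, hi⟩
    refine convexHull_mono ?_ hi
    rintro y (rfl | rfl | rfl)
    exacts [⟨_, rfl⟩, ⟨_, rfl⟩, ⟨_, rfl⟩]
  have hpos : ∀ i ∈ Finset.Ico 1 (n - 1), 0 < orient (v 0) (v i) (v (i + 1)) := by
    intro i hi
    simp only [Finset.mem_Ico] at hi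
    exact hP.pos 0 i (i + 1) (by omega) (by omega) (by omega)
  have hlt : ∀ i ∈ Finset.Ico 1 (n - 1), ∀ j ∈ Finset.Ico 1 (n - 1), i < j →
      volume (convexHull ℝ {v 0, v i, v (i + 1)} ∩ convexHull ℝ {v 0, v j, v (j + 1)}) = 0 := by
    intro i hi j hj hij
    have hj' := hj
    simp only [Finset.mem_Ico] at hi hj
    refine measure_mono_null ?_ (volume_line (sub_ne_zero.2 (hP.ne_of_lt (i := 0) (j := j)
      (by omega) (by omega)).symm) (v 0))
    rintro x ⟨h1, h2⟩
    have h3 := ((mem_triangle_iff (hpos j hj')).1 h2).1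
    have h4 : convexHull ℝ {v 0, v i, v (i + 1)} ⊆ {x | orient (v 0) (v j) x ≤ 0} := by
      refine convexHull_min ?_ (convex_orient_nonpos _ _)
      rintro y (rfl | rfl | rfl)
      · simp [orient_left_self]
      · have := hP.pos 0 i j (by omega) (by omega) (by omega)
        simp only [Set.mem_ofPred_eq]
        rw [orient_rotate, orient_swap, orient_rotate, orient_rotate]; linarith
      · rcases Nat.lt_or_ge (i + 1) j with h | h
        · have := hP.pos 0 (i + 1) j (by omega) (by omega) (by omega)
          simp only [Set.mem_ofPred_eq]
          rw [orient_rotate, orient_swap, orient_rotate, orient_rotate]; linarith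
        · rw [show i + 1 = j by omega]; simp [orient_right_self]
    exact le_antisymm (h4 h1) h3
  rw [hU, measure_biUnion_finset₀]
  · rw [hP.sum_orient_eq x (v 0), Finset.sum_div, ENNReal.ofReal_sum_of_nonneg]
    · have : ∑ i ∈ Finset.range n, ENNReal.ofReal (orient (v 0) (v i) (v (i + 1)) / 2)
          = ∑ i ∈ Finset.Ico 1 (n - 1), ENNReal.ofReal (orient (v 0) (v i) (v (i + 1)) / 2) := by
        -- The indices `0` and `n - 1`, missing from the fan, contribute degenerate triangles.
        symm
        refine Finset.sum_subset (fun i hi => by simp at *; omega) ?_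
        intro i hi hi'
        simp only [Finset.mem_range, Finset.mem_Ico, not_and, not_lt] at hi hi'
        obtain rfl | rfl : i = 0 ∨ i = n - 1 := by omega
        · rw [orient_same]; simp
        · rw [show n - 1 + 1 = 0 + n by omega, hP.periodic, orient_left_self]; simp
      rw [this]
      exact Finset.sum_congr rfl fun i hi => volume_triangle (hpos i hi)
    · intro i hi
      have := hP.edge_vertex_nonneg i 0
      rw [edge, orient_rotate, orient_rotate] at this
      positivity
  · intro i hi j hj hij
    rcases Nat.lt_or_gt_of_ne hij with h | h
    · exact hlt i hi j hj h
    · show volume (_ ∩ _) = 0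
      rw [Set.inter_comm]; exact hlt j hj i hi h
  · intro i _
    exact ((Set.toFinite _).isCompact_convexHull ℝ).measurableSet.nullMeasurableSet

/-! ### Local structure -/

/-- By continuity, sides strictly positive at `p` impose no condition near `p`. -/
lemma eventually_mem_hull {p : Plane} {Q : ℕ → Prop} (h : ∀ j < n, 0 < edge v j p ∨ Q j) :
    ∀ᶠ x in nhds p, (∀ j < n, Q j → 0 ≤ edge v j x) → x ∈ convexHull ℝ (Set.range v) := by
  have : ∀ᶠ y in nhds p, ∀ i ∈ Finset.range n, 0 < edge v i p → 0 < edge v i y := by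
    rw [Filter.eventually_all_finset]
    intro i _
    by_cases hi : 0 < edge v i p
    · filter_upwards [((continuous_edge v i).tendsto p).eventually (lt_mem_nhds hi)] with y hy _
      exact hy
    · exact Eventually.of_forall fun y h => absurd h hi
  filter_upwards [this] with y hy hQ
  refine hP.mem_hull_iff.2 fun j hj => ?_
  rcases h j hj with h | h
  · exact (hy j (Finset.mem_range.2 hj) h).le
  · exact hQ j hj h

lemma cross_vertex_pos (i : ℕ) : 0 < cross (v (i + 2) - v (i + 1)) (v i - v (i + 1)) := by
  have := hP.pos i (i + 1) (i + 2) (by omega) (by omega) (by have := hP.three_le; omega)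
  rw [orient_rotate] at this
  exact this

lemma angle_pos (i : ℕ) : 0 < EuclideanGeometry.angle (v i) (v (i + 1)) (v (i + 2)) := by
  refine lt_of_le_of_ne (EuclideanGeometry.angle_nonneg _ _ _) fun h => ?_
  have h1 := hP.cross_vertex_pos i
  obtain ⟨-, r, -, hr⟩ := InnerProductGeometry.angle_eq_zero_iff.1 h.symm
  simp only [vsub_eq_sub] at hr
  rw [hr, cross_smul_left, cross_self] at h1
  simp at h1

lemma angle_lt_pi (i : ℕ) : EuclideanGeometry.angle (v i) (v (i + 1)) (v (i + 2)) < Real.pi := by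
  refine lt_of_le_of_ne (EuclideanGeometry.angle_le_pi _ _ _) fun h => ?_
  have h1 := hP.cross_vertex_pos i
  obtain ⟨-, r, -, hr⟩ := InnerProductGeometry.angle_eq_pi_iff.1 h
  simp only [vsub_eq_sub] at hr
  rw [hr, cross_smul_left, cross_self] at h1
  simp at h1

/-- Near a vertex only its two sides are active, so the polygon coincides there with the wedge they
span. -/
lemma hasAngle_vertex (i : ℕ) : HasAngle (convexHull ℝ (Set.range v)) (v (i + 1))
    (EuclideanGeometry.angle (v i) (v (i + 1)) (v (i + 2))) := by
  have hang : EuclideanGeometry.angle (v i) (v (i + 1)) (v (i + 2))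
      = InnerProductGeometry.angle (v (i + 2) - v (i + 1)) (v i - v (i + 1)) := by
    rw [EuclideanGeometry.angle, InnerProductGeometry.angle_comm]; rfl
  have e2 : ∀ x, cross (x - v (i + 1)) (v i - v (i + 1)) = edge v i x := by
    intro x; simp only [edge, orient_def, cross, PiLp.sub_apply]; ring
  refine HasAngle.of_eventually_eq (S := {x | 0 ≤ cross (v (i + 2) - v (i + 1)) (x - v (i + 1)) ∧
      0 ≤ cross (x - v (i + 1)) (v i - v (i + 1))}) ?_ ?_
  · have := hP.eventually_mem_hull (p := v (i + 1)) (Q := fun j => (v j = v (i + 1) ∧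
      v (j + 1) = v (i + 2)) ∨ (v j = v i ∧ v (j + 1) = v (i + 1))) (fun j _ => by
        rcases hP.vertex_cases i j with h | h | h
        · exact Or.inr (Or.inl h)
        · exact Or.inr (Or.inr h)
        · exact Or.inl h)
    filter_upwards [this] with x hx
    simp only [e2]
    constructor
    · intro h
      exact ⟨hP.edge_nonneg (i + 1) h, hP.edge_nonneg i h⟩
    · rintro ⟨h1, h2⟩
      refine hx fun j _ hj => ?_
      rcases hj with ⟨ha, hb⟩ | ⟨ha, hb⟩
      · rw [edge, ha, hb]; exact h1
      · rw [edge, ha, hb]; exact h2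
  · intro ε hε
    rw [hang]
    refine volume_wedge ?_ ?_ (hP.cross_vertex_pos i).le ?_ _ hε
    · exact sub_ne_zero.2 (hP.ne_succ (i + 1)).symm
    · exact sub_ne_zero.2 (hP.ne_succ i)
    · rw [← hang]; exact hP.angle_pos i

lemma hasAngle_side {x : Plane} (hx : x ∈ frontier (convexHull ℝ (Set.range v)))
    (hv : x ∉ Set.range v) : HasAngle (convexHull ℝ (Set.range v)) x Real.pi := by
  rw [hP.frontier_eq] at hx
  simp only [Set.mem_iUnion, Finset.mem_range, exists_prop] at hx
  obtain ⟨i, -, hi⟩ := hx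
  have hxi := edge_eq_zero_of_mem_segment hi
  obtain ⟨s, t, hs, ht, hst, rfl⟩ := hi
  have hs' : 0 < s := lt_of_le_of_ne hs fun h => hv ⟨i + 1, by
    rw [← h, show t = 1 by linarith]; simp⟩
  have ht' : 0 < t := lt_of_le_of_ne ht fun h => hv ⟨i, by
    rw [← h, show s = 1 by linarith]; simp⟩
  set x := s • v i + t • v (i + 1) with hxdef
  have e : ∀ y, cross (v (i + 1) - v i) (y - x) = edge v i y := by
    intro y
    have : edge v i y = cross (v (i + 1) - v i) (y - x) + edge v i x := by
      simp only [edge, orient_def, cross, PiLp.sub_apply]; ring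
    rw [this, hxi, add_zero]
  refine HasAngle.of_eventually_eq (S := {y | 0 ≤ cross (v (i + 1) - v i) (y - x)}) ?_ ?_
  · have := hP.eventually_mem_hull (p := x) (Q := fun j => (v j = v i ∧ v (j + 1) = v (i + 1)))
      (fun j _ => by
        have a := hP.edge_vertex_nonneg j i
        have b := hP.edge_vertex_nonneg j (i + 1)
        rcases hP.edge_cases i j with h | h | h
        · exact Or.inr h
        · left
          rw [edge] at *
          rw [hxdef, orient_combo _ _ _ _ _ _ hst]; positivity
        · left
          rw [edge] at *
          rw [hxdef, orient_combo _ _ _ _ _ _ hst]; positivity)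
    filter_upwards [this] with y hy
    simp only [e]
    refine ⟨fun h => hP.edge_nonneg i h, fun h => hy fun j _ hj => ?_⟩
    rw [edge, hj.1, hj.2]; exact h
  · intro ε hε
    exact volume_half_disc (sub_ne_zero.2 (hP.ne_succ i).symm) x hε

/-- The diagonal joining the two neighbours of a vertex separates it from all the other vertices. -/
lemma notMem_convexHull_others (m : ℕ) (s : Set Plane)
    (hs : s ⊆ Set.range v \ {v (m + 1)}) : v (m + 1) ∉ convexHull ℝ s := by
  have hn := hP.three_le
  intro hmem
  have hsub : convexHull ℝ s ⊆ {x | 0 ≤ orient (v m) (v (m + 2)) x} := by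
    refine convexHull_min (fun y hy => ?_) (convex_orient_nonneg _ _)
    obtain ⟨⟨j, rfl⟩, hj⟩ := hs hy
    obtain ⟨j', h1, h2, h3⟩ := hP.exists_rep m j
    have h3 := h3 0
    simp only [add_zero] at h3
    rw [← h3] at hj ⊢
    simp only [Set.mem_ofPred_eq]
    rcases Nat.lt_or_ge (m + 2) j' with h | h
    · exact (hP.pos m (m + 2) j' (by omega) h h2).le
    · obtain rfl | rfl | rfl : j' = m ∨ j' = m + 1 ∨ j' = m + 2 := by omega
      · rw [orient_left_self]
      · simp at hj
      · rw [orient_right_self]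
  have h1 := hsub hmem
  have h2 := hP.pos m (m + 1) (m + 2) (by omega) (by omega) (by omega)
  simp only [Set.mem_ofPred_eq] at h1
  rw [orient_rotate, orient_swap, orient_rotate, orient_rotate] at h1
  linarith

end CcwPolygon

/-! ### The isoperimetric inequality for polygons with given angles -/

/-- Clockwise quarter turn: the outer normal of a side with direction `t`. -/
def normal (t : Plane) : Plane := !₂[t 1, -t 0]

lemma normal_zero (t : Plane) : normal t 0 = t 1 := rfl

lemma normal_one (t : Plane) : normal t 1 = -t 0 := rfl

/-- Tangent of half the turning angle between the unit vectors `s` and `t`. -/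
def halfTan (s t : Plane) : ℝ := cross s t / (1 + inner ℝ s t)

lemma unit_sq {t : Plane} (ht : ‖t‖ = 1) : t 0 ^ 2 + t 1 ^ 2 = 1 := by
  rw [← norm_sq_eq, ht]; norm_num

lemma one_add_inner_pos {s t : Plane} (hs : ‖s‖ = 1) (ht : ‖t‖ = 1) (h : 0 < cross s t) :
    0 < 1 + inner ℝ s t := by
  have h1 := unit_sq hs
  have h2 := unit_sq ht
  have h3 : inner ℝ s t ^ 2 + cross s t ^ 2 = 1 := by
    rw [inner_eq, cross]; linear_combination (t 0 ^ 2 + t 1 ^ 2) * h1 + h2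
  nlinarith [sq_nonneg (inner ℝ s t), pow_pos h 2]

lemma halfTan_pos {s t : Plane} (hs : ‖s‖ = 1) (ht : ‖t‖ = 1) (h : 0 < cross s t) :
    0 < halfTan s t := div_pos h (one_add_inner_pos hs ht h)

/-- The tangents to the unit circle at two contact points meet at equal distance from both; that
distance is the tangent of half the turning angle. -/
lemma tangent_point_eq {s t : Plane} (hs : ‖s‖ = 1) (ht : ‖t‖ = 1) (h : 0 < cross s t) :
    normal s + halfTan s t • s = normal t - halfTan s t • t := by
  have h0 := (one_add_inner_pos hs ht h).ne'
  have h1 := unit_sq hs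
  have h2 := unit_sq ht
  apply plane_ext
  · simp only [PiLp.add_apply, PiLp.sub_apply, PiLp.smul_apply, smul_eq_mul, normal_zero, halfTan]
    field_simp
    simp only [inner_eq, cross]
    linear_combination t 1 * h1 - s 1 * h2
  · simp only [PiLp.add_apply, PiLp.sub_apply, PiLp.smul_apply, smul_eq_mul, normal_one, halfTan]
    field_simp
    simp only [inner_eq, cross]
    linear_combination - t 0 * h1 + s 0 * h2

lemma cross_normal_self {t : Plane} (ht : ‖t‖ = 1) : cross (normal t) t = 1 := by
  rw [cross, normal_zero, normal_one]; linarith [unit_sq ht]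

lemma cross_normal_right (s t : Plane) : cross s (normal t) = - inner ℝ s t := by
  rw [cross, normal_zero, normal_one, inner_eq]; ring

lemma cross_eq_frame {t : Plane} (ht : ‖t‖ = 1) (u w : Plane) :
    cross u w = inner ℝ t u * cross t w - cross t u * inner ℝ t w := by
  simp only [cross, inner_eq]
  linear_combination (-u 0 * w 1 + u 1 * w 0) * unit_sq ht

lemma sum_range_shift {n : ℕ} {f : ℕ → ℝ} (hf : f n = f 0) :
    ∑ i ∈ Finset.range n, f (i + 1) = ∑ i ∈ Finset.range n, f i := by
  have h1 := Finset.sum_range_succ f n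
  have h2 := Finset.sum_range_succ' f n
  linarith

/-- A closed polygonal line whose sides are parallel to those of a convex polygon, and which
returns to height zero whenever the vertical direction changes, encloses nonpositive area. -/
lemma sum_cross_nonpos {n : ℕ} {d τ : ℕ → Plane} {μ : ℕ → ℝ} {t : Plane} (ht : ‖t‖ = 1)
    (hd : ∀ i, d (i + n) = d i) (hτ : ∀ i, τ (i + n) = τ i)
    (hstep : ∀ i, d (i + 1) - d i = μ i • τ (i + 1))
    (hturn : ∀ i, 0 ≤ cross (τ i) (τ (i + 1)))
    (hY : ∀ i, cross t (d i) = 0 ∨ 0 < cross t (τ i) * cross t (τ (i + 1))) :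
    ∑ i ∈ Finset.range n, cross (d i) (d (i + 1)) ≤ 0 := by
  set X : ℕ → ℝ := fun i => inner ℝ t (d i) with hX
  set Y : ℕ → ℝ := fun i => cross t (d i) with hYd
  -- In coordinates along and across `t`, `c` is the inverse slope of a side direction. For a
  -- horizontal side it takes the junk value `0`, which is harmless because both end heights then
  -- vanish.
  set c : ℕ → ℝ := fun i => inner ℝ t (τ i) / cross t (τ i) with hc
  -- Two telescoping terms plus a correction `(c i - c (i + 1)) * Y i ^ 2`. Where the height is
  -- nonzero the vertical direction persists, and left turning makes `c` nonincreasing.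
  have key : ∀ i, cross (d i) (d (i + 1)) = (X (i + 1) * Y (i + 1) - X i * Y i)
      - (c (i + 1) * Y (i + 1) ^ 2 - c i * Y i ^ 2) - (c i - c (i + 1)) * Y i ^ 2 := by
    intro i
    have e1 : X (i + 1) - X i = μ i * inner ℝ t (τ (i + 1)) := by
      simp only [hX]; rw [← inner_sub_right, hstep, inner_smul_right]
    have e2 : Y (i + 1) - Y i = μ i * cross t (τ (i + 1)) := by
      simp only [hYd]; rw [← cross_sub_right, hstep, cross_smul_right]
    have e3 : (X (i + 1) - X i) * (Y (i + 1) + Y i) = c (i + 1) * (Y (i + 1) ^ 2 - Y i ^ 2) := by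
      by_cases h0 : cross t (τ (i + 1)) = 0
      · have a : Y i = 0 := by
          rcases hY i with h | h
          · exact h
          · rw [h0] at h; simp at h
        have b : Y (i + 1) = 0 := by rw [h0] at e2; linarith
        rw [a, b]; ring
      · have : c (i + 1) * (Y (i + 1) - Y i) = X (i + 1) - X i := by
          rw [e1, e2]; simp only [hc]; field_simp
        rw [← this]; ring
    rw [cross_eq_frame ht]
    change X i * Y (i + 1) - Y i * X (i + 1) = _
    linear_combination -e3
  have hterm : ∀ i, 0 ≤ (c i - c (i + 1)) * Y i ^ 2 := by
    intro i
    rcases hY i with h | h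
    · have : Y i = 0 := h
      rw [this]; simp
    · refine mul_nonneg ?_ (sq_nonneg _)
      have h1 : cross t (τ i) ≠ 0 := by rintro h0; rw [h0] at h; simp at h
      have h2 : cross t (τ (i + 1)) ≠ 0 := by rintro h0; rw [h0] at h; simp at h
      have : c i - c (i + 1) = cross (τ i) (τ (i + 1)) / (cross t (τ i) * cross t (τ (i + 1))) := by
        rw [cross_eq_frame ht (τ i)]; simp only [hc]; field_simp
      rw [this]; exact div_nonneg (hturn i) h.le
  have hXn : X n = X 0 := by simp only [hX]; rw [← hd 0, zero_add]
  have hYn : Y n = Y 0 := by simp only [hYd]; rw [← hd 0, zero_add]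
  have hcn : c n = c 0 := by simp only [hc]; rw [← hτ 0, zero_add]
  simp_rw [key]
  rw [Finset.sum_sub_distrib, Finset.sum_sub_distrib,
    Finset.sum_range_sub (fun i => X i * Y i), Finset.sum_range_sub (fun i => c i * Y i ^ 2),
    hXn, hYn, hcn]
  have := Finset.sum_nonneg (s := Finset.range n) (fun i _ => hterm i)
  linarith

/-! ### The polygon with the same side directions circumscribed about the unit circle -/

/-- Unit direction of the `i`th side. -/
def dir (v : ℕ → Plane) (i : ℕ) : Plane := (dist (v i) (v (i + 1)))⁻¹ • (v (i + 1) - v i)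

/-- The vertex, between sides `i` and `i + 1`, of the polygon with the same side directions
circumscribed about the unit circle. -/
def tangentPoint (v : ℕ → Plane) (i : ℕ) : Plane :=
  normal (dir v i) + halfTan (dir v i) (dir v (i + 1)) • dir v i

namespace CcwPolygon

variable {n : ℕ} {v : ℕ → Plane} (hP : CcwPolygon n v)
include hP

lemma dist_pos (i : ℕ) : 0 < dist (v i) (v (i + 1)) := _root_.dist_pos.2 (hP.ne_succ i)

lemma norm_dir (i : ℕ) : ‖dir v i‖ = 1 := by
  rw [dir, dist_comm, dist_eq_norm]
  exact norm_smul_inv_norm (sub_ne_zero.2 (hP.ne_succ i).symm)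

lemma dist_smul_dir (i : ℕ) : dist (v i) (v (i + 1)) • dir v i = v (i + 1) - v i := by
  rw [dir, smul_smul, mul_inv_cancel₀ (hP.dist_pos i).ne', one_smul]

lemma dir_periodic (i : ℕ) : dir v (i + n) = dir v i := by
  rw [dir, dir, show i + n + 1 = i + 1 + n by ring, hP.periodic, hP.periodic]

lemma tangentPoint_periodic (i : ℕ) : tangentPoint v (i + n) = tangentPoint v i := by
  rw [tangentPoint, tangentPoint, show i + n + 1 = i + 1 + n by ring, hP.dir_periodic,
    hP.dir_periodic]

lemma cross_dir_succ_pos (i : ℕ) : 0 < cross (dir v i) (dir v (i + 1)) := by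
  rw [dir, dir, cross_smul_left, cross_smul_right]
  have h := hP.pos i (i + 1) (i + 2) (by omega) (by omega) (by have := hP.three_le; omega)
  have h1 := hP.dist_pos i
  have h2 := hP.dist_pos (i + 1)
  have : cross (v (i + 1) - v i) (v (i + 1 + 1) - v (i + 1)) = orient (v i) (v (i + 1)) (v (i + 2)) := by
    simp only [cross, orient_def, PiLp.sub_apply]; ring_nf
  rw [this]; positivity

lemma tangentPoint_eq (i : ℕ) : tangentPoint v i
    = normal (dir v (i + 1)) - halfTan (dir v i) (dir v (i + 1)) • dir v (i + 1) :=
  tangent_point_eq (hP.norm_dir i) (hP.norm_dir (i + 1)) (hP.cross_dir_succ_pos i)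

lemma tangentPoint_sub (i : ℕ) : tangentPoint v (i + 1) - tangentPoint v i
    = (halfTan (dir v i) (dir v (i + 1)) + halfTan (dir v (i + 1)) (dir v (i + 2)))
      • dir v (i + 1) := by
  rw [hP.tangentPoint_eq i, tangentPoint, add_smul]; abel

lemma cross_tangentPoint_left (i : ℕ) : cross (tangentPoint v i) (dir v i) = 1 := by
  rw [tangentPoint, cross_add_left, cross_smul_left, cross_self, cross_normal_self (hP.norm_dir i)]
  ring

lemma cross_tangentPoint_right (i : ℕ) : cross (tangentPoint v i) (dir v (i + 1)) = 1 := by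
  rw [hP.tangentPoint_eq, cross_sub_left, cross_smul_left, cross_self,
    cross_normal_self (hP.norm_dir _)]
  ring

/-- The turning angle is `π` minus the interior angle, so the tangent of half of it is the cotangent
of half the interior angle. -/
lemma cot_half_angle (i : ℕ) :
    Real.cot (EuclideanGeometry.angle (v i) (v (i + 1)) (v (i + 2)) / 2)
      = halfTan (dir v i) (dir v (i + 1)) := by
  set α := EuclideanGeometry.angle (v i) (v (i + 1)) (v (i + 2)) with hα
  have h0 := hP.angle_pos i
  have h1 := hP.angle_lt_pi i
  rw [← hα] at h0 h1
  have e1 : v i - v (i + 1) = dist (v i) (v (i + 1)) • (-dir v i) := by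
    rw [smul_neg, hP.dist_smul_dir]; abel
  have e2 : v (i + 2) - v (i + 1) = dist (v (i + 1)) (v (i + 2)) • dir v (i + 1) :=
    (hP.dist_smul_dir (i + 1)).symm
  have hα' : α = InnerProductGeometry.angle (dir v (i + 1)) (-dir v i) := by
    rw [hα, EuclideanGeometry.angle, vsub_eq_sub, vsub_eq_sub, e1, e2,
      InnerProductGeometry.angle_smul_left_of_pos _ _ (hP.dist_pos i),
      InnerProductGeometry.angle_smul_right_of_pos _ _ (hP.dist_pos (i + 1)),
      InnerProductGeometry.angle_comm]
  have hn1 : ‖-dir v i‖ = 1 := by rw [norm_neg]; exact hP.norm_dir i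
  have hc : Real.cos α = - inner ℝ (dir v i) (dir v (i + 1)) := by
    rw [hα', cos_angle_of_norm_one (hP.norm_dir _) hn1, inner_neg_right, real_inner_comm]
  have hcr : cross (dir v (i + 1)) (-dir v i) = cross (dir v i) (dir v (i + 1)) := by
    rw [cross_neg_right, cross_swap]; ring
  have hs : Real.sin α = cross (dir v i) (dir v (i + 1)) := by
    rw [hα', sin_angle_of_norm_one (hP.norm_dir _) hn1 (by
      rw [hcr]; exact (hP.cross_dir_succ_pos i).le), hcr]
  have hs2 : 0 < Real.sin (α / 2) := Real.sin_pos_of_pos_of_lt_pi (by linarith) (by linarith)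
  have d1 : Real.sin α = 2 * Real.sin (α / 2) * Real.cos (α / 2) := by
    rw [← Real.sin_two_mul]; congr 1; ring
  have d2 : Real.cos α = 1 - 2 * Real.sin (α / 2) ^ 2 := by
    have : Real.cos α = Real.cos (2 * (α / 2)) := by congr 1; ring
    rw [this, Real.cos_two_mul]
    linarith [Real.sin_sq_add_cos_sq (α / 2)]
  rw [halfTan, ← hs, show inner ℝ (dir v i) (dir v (i + 1)) = - Real.cos α by rw [hc]; ring,
    d1, d2, Real.cot_eq_cos_div_sin]
  field_simp
  ring

/-- Sum of the cotangents of the half angles. -/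
lemma sum_halfTan : ∑ i ∈ Finset.range n, (halfTan (dir v i) (dir v (i + 1))
      + halfTan (dir v (i + 1)) (dir v (i + 2)))
    = 2 * ∑ i ∈ Finset.range n,
        Real.cot (EuclideanGeometry.angle (v i) (v (i + 1)) (v (i + 2)) / 2) := by
  simp_rw [hP.cot_half_angle]
  rw [Finset.sum_add_distrib, sum_range_shift (f := fun i => halfTan (dir v i) (dir v (i + 1)))]
  · ring
  · rw [show n + 1 = 1 + n by ring, hP.dir_periodic]
    have := hP.dir_periodic 0
    rw [zero_add] at this
    rw [this]

/-- Twice the area of the circumscribed polygon: its inradius is one, so this equals its perimeter,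
the sum of all tangent lengths. -/
lemma sum_cross_tangentPoint : ∑ i ∈ Finset.range n, cross (tangentPoint v i) (tangentPoint v (i + 1))
    = 2 * ∑ i ∈ Finset.range n,
        Real.cot (EuclideanGeometry.angle (v i) (v (i + 1)) (v (i + 2)) / 2) := by
  rw [← hP.sum_halfTan]
  refine Finset.sum_congr rfl fun i _ => ?_
  rw [show tangentPoint v (i + 1) = tangentPoint v i + (tangentPoint v (i + 1) - tangentPoint v i) by
    abel, cross_add_right, cross_self, hP.tangentPoint_sub, cross_smul_right,
    hP.cross_tangentPoint_right]
  ring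

lemma periodic_zero : v n = v 0 := by have := hP.periodic 0; rwa [zero_add] at this

lemma sum_dist_shift : ∑ i ∈ Finset.range n, dist (v (i + 1)) (v (i + 2))
    = ∑ i ∈ Finset.range n, dist (v i) (v (i + 1)) := by
  refine sum_range_shift (f := fun i => dist (v i) (v (i + 1))) ?_
  rw [show n + 1 = 1 + n by ring, hP.periodic, hP.periodic_zero]

/-- This is a mixed area. The circumscribed polygon has support number one in every side direction,
so only the perimeter of the given polygon survives, up to a telescoping sum. -/
lemma sum_mixed (o : Plane) : ∑ i ∈ Finset.range n, (cross (v (i + 1) - o) (tangentPoint v (i + 1))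
      + cross (tangentPoint v i) (v (i + 2) - o))
    = 2 * ∑ i ∈ Finset.range n, dist (v i) (v (i + 1)) := by
  have key : ∀ i, cross (v (i + 1) - o) (tangentPoint v (i + 1))
      + cross (tangentPoint v i) (v (i + 2) - o) = 2 * dist (v (i + 1)) (v (i + 2))
      - (cross (tangentPoint v (i + 1)) (v (i + 1 + 1) - o) - cross (tangentPoint v i) (v (i + 1) - o)) := by
    intro i
    have e : v (i + 2) - o = v (i + 1) - o + dist (v (i + 1)) (v (i + 2)) • dir v (i + 1) := by
      have := hP.dist_smul_dir (i + 1)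
      rw [show i + 1 + 1 = i + 2 by ring] at this
      rw [this]; abel
    rw [show i + 1 + 1 = i + 2 by ring, e, cross_add_right, cross_add_right, cross_smul_right,
      cross_smul_right, hP.cross_tangentPoint_right, hP.cross_tangentPoint_left,
      cross_swap (v (i + 1) - o) (tangentPoint v (i + 1))]
    ring
  simp_rw [key]
  rw [Finset.sum_sub_distrib, Finset.sum_range_sub
    (fun i => cross (tangentPoint v i) (v (i + 1) - o)), ← Finset.mul_sum, hP.sum_dist_shift]
  have h1 := hP.tangentPoint_periodic 0
  rw [zero_add] at h1
  rw [h1, show n + 1 = 0 + 1 + n by ring, hP.periodic]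
  ring

lemma sum_cross_vertices (o : Plane) : ∑ i ∈ Finset.range n, cross (v (i + 1) - o) (v (i + 2) - o)
    = ∑ i ∈ Finset.range n, orient o (v i) (v (i + 1)) := by
  refine sum_range_shift (f := fun i => orient o (v i) (v (i + 1))) ?_
  rw [show n + 1 = 1 + n by ring, hP.periodic, hP.periodic_zero]

/-- A vertex at least as high as its two neighbours is highest. -/
lemma le_of_local_max {i : ℕ} {Y : Plane →ₗ[ℝ] ℝ} (h1 : Y (v i) ≤ Y (v (i + 1)))
    (h2 : Y (v (i + 2)) ≤ Y (v (i + 1))) (j : ℕ) : Y (v j) ≤ Y (v (i + 1)) := by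
  have hD := hP.cross_vertex_pos i
  set p := v (i + 1)
  set u := v (i + 2) - p with hu
  set w := v i - p with hw
  have hx1 : 0 ≤ edge v (i + 1) (v j) := hP.edge_vertex_nonneg _ _
  have hx2 : 0 ≤ edge v i (v j) := hP.edge_vertex_nonneg _ _
  have e1 : edge v (i + 1) (v j) = cross u (v j - p) := rfl
  have e2 : edge v i (v j) = cross (v j - p) w := by
    simp only [edge, orient_def, cross, PiLp.sub_apply, hw]; ring
  rw [e1] at hx1
  rw [e2] at hx2
  -- The polygon lies in the cone at the vertex spanned by its two sides, and the functional is
  -- nonpositive on both generators.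
  have hx : cross u w • (v j - p) = cross (v j - p) w • u + cross u (v j - p) • w := by
    apply plane_ext <;>
    · simp only [PiLp.add_apply, PiLp.smul_apply, smul_eq_mul, cross]; ring
  have := congrArg Y hx
  simp only [map_smul, map_add, smul_eq_mul] at this
  have hYu : Y u ≤ 0 := by rw [hu, map_sub]; linarith
  have hYw : Y w ≤ 0 := by rw [hw, map_sub]; linarith
  have h3 : cross u w * Y (v j - p) ≤ 0 := by rw [this]; nlinarith
  have h4 : Y (v j - p) ≤ 0 := by
    by_contra h; push Not at h
    have := mul_pos hD h
    linarith
  rw [map_sub] at h4; linarith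

end CcwPolygon

/-- The cross product with a fixed vector as a linear form. -/
def crossLin (t : Plane) : Plane →ₗ[ℝ] ℝ where
  toFun x := cross t x
  map_add' x y := cross_add_right t x y
  map_smul' c x := cross_smul_right c t x

lemma crossLin_apply (t x : Plane) : crossLin t x = cross t x := rfl

namespace CcwPolygon

variable {n : ℕ} {v : ℕ → Plane} (hP : CcwPolygon n v)
include hP

lemma cross_dir_mul (t : Plane) (i : ℕ) :
    dist (v i) (v (i + 1)) * cross t (dir v i) = cross t (v (i + 1)) - cross t (v i) := by
  rw [← cross_smul_right, hP.dist_smul_dir, cross_sub_right]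

lemma cross_dir_nonneg_iff (t : Plane) (i : ℕ) :
    0 ≤ cross t (dir v i) ↔ cross t (v i) ≤ cross t (v (i + 1)) := by
  rw [← sub_nonneg (a := cross t (v (i + 1))), ← hP.cross_dir_mul,
    mul_nonneg_iff_of_pos_left (hP.dist_pos i)]

lemma cross_dir_nonpos_iff (t : Plane) (i : ℕ) :
    cross t (dir v i) ≤ 0 ↔ cross t (v (i + 1)) ≤ cross t (v i) := by
  have h := hP.cross_dir_mul t i
  have h1 := hP.dist_pos i
  constructor
  · intro h'; nlinarith
  · intro h'; by_contra hc; push Not at hc; nlinarith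

/-- There is `r > 0` for which the polygon and the `r`-fold circumscribed polygon have a
nonpositive mixed difference. -/
lemma exists_area_add_le : ∃ r : ℝ, 0 < r ∧
    (∑ i ∈ Finset.range n, orient 0 (v i) (v (i + 1))) / 2
      + r ^ 2 * ∑ i ∈ Finset.range n,
          Real.cot (EuclideanGeometry.angle (v i) (v (i + 1)) (v (i + 2)) / 2)
      ≤ r * ∑ i ∈ Finset.range n, dist (v i) (v (i + 1)) := by
  have hn := hP.three_le
  set t := dir v 0 with ht
  have htn : ‖t‖ = 1 := hP.norm_dir 0
  set H : ℕ → ℝ := fun j => cross t (v j) with hH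
  have hH01 : H 1 = H 0 := by
    have := hP.cross_dir_mul t 0
    rw [← ht, cross_self] at this
    simp only [hH]; linarith
  have hHpos : ∀ j, 2 ≤ j → j < n → H 0 < H j := by
    intro j h2 hjn
    have h := hP.pos 0 1 j (by omega) (by omega) (by omega)
    have e : orient (v 0) (v 1) (v j) = dist (v 0) (v 1) * (H j - H 0) := by
      simp only [hH]
      rw [← cross_sub_right, ← cross_smul_left, ht, hP.dist_smul_dir 0]; rfl
    rw [e] at h
    have := (mul_pos_iff_of_pos_left (hP.dist_pos 0)).1 h
    linarith
  -- the first highest vertex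
  have hexmax : ∃ m, 2 ≤ m ∧ m < n ∧ ∀ j < n, H j ≤ H m := by
    obtain ⟨m, hm, hmax⟩ := Finset.exists_max_image (Finset.range n) H ⟨0, by simp; omega⟩
    simp only [Finset.mem_range] at hm hmax
    refine ⟨m, ?_, hm, hmax⟩
    by_contra h
    have h2 := hmax 2 (by omega)
    have h3 := hHpos 2 le_rfl (by omega)
    obtain rfl | rfl : m = 0 ∨ m = 1 := by omega
    · linarith
    · linarith
  classical
  obtain ⟨hm2, hmn, hmax⟩ := Nat.find_spec hexmax
  have hmin := fun k (hk : k < Nat.find hexmax) => Nat.find_min hexmax hk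
  obtain ⟨M, hM⟩ : ∃ M, Nat.find hexmax = M + 1 := ⟨Nat.find hexmax - 1, by omega⟩
  rw [hM] at hm2 hmn hmax hmin
  have hHM : H M < H (M + 1) := by
    by_contra hle
    push Not at hle
    have h1 := hmax M (by omega)
    by_cases hM1 : M = 1
    · subst hM1
      have := hHpos 2 le_rfl (by omega)
      rw [show (1 : ℕ) + 1 = 2 by rfl, hH01] at hle
      linarith
    · exact hmin M (by omega) ⟨by omega, by omega, fun j hj => (hmax j hj).trans hle⟩
  have hmaxAll : ∀ j, H j ≤ H (M + 1) := by
    intro j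
    have := hmax (j % n) (Nat.mod_lt _ (by omega))
    simp only [hH] at this ⊢
    rwa [hP.map_mod] at this
  have hasc : 0 < cross t (dir v M) := by
    by_contra h; push Not at h
    rw [hP.cross_dir_nonpos_iff] at h
    simp only [hH] at hHM; linarith
  -- In the circumscribed polygon, vertex `M` lies strictly above the base line at height `-1`, so
  -- the scale `r` below has a positive denominator.
  have hκ : -1 < cross t (tangentPoint v M) := by
    rw [tangentPoint, cross_add_right, cross_smul_right, cross_normal_right]
    have h1 := mul_pos (halfTan_pos (hP.norm_dir M) (hP.norm_dir (M + 1)) (hP.cross_dir_succ_pos M))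
      hasc
    have h2 := real_inner_le_norm t (dir v M)
    rw [htn, hP.norm_dir] at h2
    linarith
  set κ := cross t (tangentPoint v M) with hκd
  -- The scale at which the circumscribed polygon, placed with its base on the base line of the
  -- given one, has its vertex `M` at the same height as the highest vertex `M + 1`.
  set r := (H (M + 1) - H 0) / (κ + 1) with hr
  have hr0 : 0 < r := div_pos (by linarith [hHpos (M + 1) hm2 hmn]) (by linarith)
  have hrκ : r * (κ + 1) = H (M + 1) - H 0 := by rw [hr]; field_simp [show κ + 1 ≠ 0 by linarith]
  refine ⟨r, hr0, ?_⟩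
  set o := v 0 - r • normal t with ho
  have hYo : cross t o = H 0 + r := by
    rw [ho, cross_sub_right, cross_smul_right, cross_normal_right, real_inner_self_eq_norm_sq, htn]
    simp only [hH]; ring
  -- Differences of corresponding vertices of the two polygons. Corresponding sides are parallel, so
  -- `d` is a closed polygonal line to which `sum_cross_nonpos` applies.
  set d : ℕ → Plane := fun i => v (i + 1) - o - r • tangentPoint v i with hd
  have hdY : ∀ i, cross t (d i) = H (i + 1) - (H 0 + r) - r * cross t (tangentPoint v i) := by
    intro i
    simp only [hd]
    rw [cross_sub_right, cross_sub_right, cross_smul_right, hYo]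
  have hstep : ∀ i, d (i + 1) - d i = (dist (v (i + 1)) (v (i + 1 + 1))
      - r * (halfTan (dir v i) (dir v (i + 1)) + halfTan (dir v (i + 1)) (dir v (i + 2))))
      • dir v (i + 1) := by
    intro i
    rw [sub_smul, mul_smul, ← hP.tangentPoint_sub, hP.dist_smul_dir]
    simp only [hd, smul_sub]
    abel
  -- The vertical direction changes only at the bottom and at the top. The bottom heights agree by
  -- the choice of `o`, the top heights by the choice of `r`.
  have hYzero : ∀ i < n, cross t (d i) = 0 ∨ 0 < cross t (dir v i) * cross t (dir v (i + 1)) := by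
    intro i hi
    rcases Nat.eq_zero_or_pos i with rfl | hi0
    · left
      rw [hdY, zero_add, hH01, tangentPoint, cross_add_right, cross_smul_right, ← ht, cross_self,
        cross_normal_right, real_inner_self_eq_norm_sq, htn]
      ring
    by_cases hin : i + 1 = n
    · left
      have e0 : dir v (i + 1) = t := by
        rw [hin, ht, ← hP.dir_periodic 0, zero_add]
      have e1 : H (i + 1) = H 0 := by simp only [hH]; rw [hin, hP.periodic_zero]
      rw [hdY, hP.tangentPoint_eq, e0, e1, cross_sub_right, cross_smul_right, cross_self,
        cross_normal_right, real_inner_self_eq_norm_sq, htn]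
      ring
    by_contra hcon
    push Not at hcon
    obtain ⟨hne, hprod⟩ := hcon
    have hcase : (0 ≤ cross t (dir v i) ∧ cross t (dir v (i + 1)) ≤ 0) ∨
        (cross t (dir v i) ≤ 0 ∧ 0 ≤ cross t (dir v (i + 1))) := by
      rcases le_total 0 (cross t (dir v i)) with h | h <;>
      rcases le_total 0 (cross t (dir v (i + 1))) with h' | h'
      · rcases mul_eq_zero.1 (le_antisymm hprod (mul_nonneg h h')) with h0 | h0
        · exact Or.inr ⟨h0.le, h'⟩
        · exact Or.inl ⟨h, h0.le⟩
      · exact Or.inl ⟨h, h'⟩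
      · exact Or.inr ⟨h, h'⟩
      · rcases mul_eq_zero.1 (le_antisymm hprod (mul_nonneg_of_nonpos_of_nonpos h h')) with h0 | h0
        · exact Or.inl ⟨h0.ge, h'⟩
        · exact Or.inr ⟨h, h0.ge⟩
    rw [hP.cross_dir_nonneg_iff, hP.cross_dir_nonneg_iff, hP.cross_dir_nonpos_iff,
      hP.cross_dir_nonpos_iff] at hcase
    rcases hcase with ⟨h1, h2⟩ | ⟨h1, h2⟩
    · -- a highest vertex
      have hloc := hP.le_of_local_max (Y := crossLin t) h1 h2
      have htop : H (i + 1) = H (M + 1) := le_antisymm (hmaxAll _) (hloc (M + 1))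
      have hge : M + 1 ≤ i + 1 := by
        by_contra hlt
        push Not at hlt
        exact hmin (i + 1) hlt ⟨by omega, by omega, fun j hj => by rw [htop]; exact hmax j hj⟩
      have hdM : cross t (d M) = 0 := by
        rw [hdY, ← hκd]; linarith
      rcases Nat.lt_or_ge (M + 1) i with hlt | hle
      · -- the two neighbours of vertex `M + 1` lie on different sides of a horizontal line
        have a := hP.pos (M + 1) (M + 2) (i + 1) (by omega) (by omega) (by omega)
        have b := hP.pos (M + 1) (i + 1) (M + n) (by omega) (by omega) (by omega)
        rw [hP.periodic] at b
        rw [orient, cross_eq_frame htn, cross_sub_right, cross_sub_right] at a b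
        have c1 := hmaxAll (M + 2)
        simp only [hH] at htop c1 hHM
        rw [htop] at a b
        nlinarith
      · obtain rfl | rfl : i = M ∨ i = M + 1 := by omega
        · exact hne hdM
        -- The top side is horizontal, so the zero height difference at its first end carries over
        -- to its second end.
        · have := congrArg (cross t) (hstep M)
          rw [cross_sub_right, cross_smul_right, hdM, sub_zero] at this
          have h0 : cross t (dir v (M + 1)) = 0 := by
            have h3 := hP.cross_dir_mul t (M + 1)
            simp only [hH] at htop
            rw [htop, sub_self] at h3
            exact (mul_eq_zero.1 h3).resolve_left (hP.dist_pos _).ne'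
          rw [h0, mul_zero] at this
          exact hne this
    · have hloc := hP.le_of_local_max (Y := - crossLin t) (i := i)
        (by simp only [LinearMap.neg_apply, crossLin_apply]; linarith)
        (by simp only [LinearMap.neg_apply, crossLin_apply]; exact neg_le_neg h2) 0
      simp only [LinearMap.neg_apply, crossLin_apply] at hloc
      have := hHpos (i + 1) (by omega) (by omega)
      simp only [hH] at this
      linarith
  have hdper : ∀ i, d (i + n) = d i := by
    intro i; simp only [hd]
    rw [show i + n + 1 = i + 1 + n by ring, hP.periodic, hP.tangentPoint_periodic]
  have hmodd : ∀ i, d (i % n) = d i := fun i =>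
    Function.Periodic.map_mod_nat (f := d) (a := n) hdper i
  have hmodt : ∀ i, dir v (i % n) = dir v i := fun i =>
    Function.Periodic.map_mod_nat (f := dir v) (a := n) hP.dir_periodic i
  have hYall : ∀ i, cross t (d i) = 0 ∨ 0 < cross t (dir v i) * cross t (dir v (i + 1)) := by
    intro i
    have h := hYzero (i % n) (Nat.mod_lt _ (by omega))
    rwa [hmodd, hmodt, ← hmodt (i % n + 1), Nat.mod_add_mod, hmodt] at h
  have hfin := sum_cross_nonpos htn hdper hP.dir_periodic hstep
    (fun i => (hP.cross_dir_succ_pos i).le) hYall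
  -- Bilinear expansion: after summation the terms are twice the area, minus twice `r` times the
  -- perimeter, plus twice `r ^ 2` times the cotangent sum.
  have hexp : ∀ i, cross (d i) (d (i + 1)) = cross (v (i + 1) - o) (v (i + 2) - o)
      - r * (cross (v (i + 1) - o) (tangentPoint v (i + 1))
        + cross (tangentPoint v i) (v (i + 2) - o))
      + r ^ 2 * cross (tangentPoint v i) (tangentPoint v (i + 1)) := by
    intro i
    simp only [hd]
    rw [show i + 1 + 1 = i + 2 by ring]
    generalize v (i + 1) - o = a
    generalize v (i + 2) - o = b
    rw [cross_sub_left, cross_sub_right, cross_sub_right, cross_smul_left, cross_smul_left,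
      cross_smul_right, cross_smul_right]
    ring
  simp_rw [hexp] at hfin
  rw [Finset.sum_add_distrib, Finset.sum_sub_distrib, ← Finset.mul_sum, ← Finset.mul_sum,
    hP.sum_mixed, hP.sum_cross_tangentPoint, hP.sum_cross_vertices, hP.sum_orient_eq o 0] at hfin
  linarith

/-- Among polygons with given angles and area, those circumscribed about a circle have least
perimeter. -/
theorem four_mul_area_mul_sum_cot_le :
    4 * ((∑ i ∈ Finset.range n, orient 0 (v i) (v (i + 1))) / 2) *
      ∑ i ∈ Finset.range n, Real.cot (EuclideanGeometry.angle (v i) (v (i + 1)) (v (i + 2)) / 2)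
      ≤ (∑ i ∈ Finset.range n, dist (v i) (v (i + 1))) ^ 2 := by
  obtain ⟨r, hr, h⟩ := hP.exists_area_add_le
  set A := (∑ i ∈ Finset.range n, orient 0 (v i) (v (i + 1))) / 2
  set K := ∑ i ∈ Finset.range n, Real.cot (EuclideanGeometry.angle (v i) (v (i + 1)) (v (i + 2)) / 2)
  set L := ∑ i ∈ Finset.range n, dist (v i) (v (i + 1))
  have hL : 0 ≤ L := Finset.sum_nonneg fun _ _ => dist_nonneg
  have hA : 0 ≤ A := by
    have : ∀ i ∈ Finset.range n, 0 ≤ orient (v 0) (v i) (v (i + 1)) := by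
      intro i _
      have := hP.edge_vertex_nonneg i 0
      rwa [edge, orient_rotate, orient_rotate] at this
    have := Finset.sum_nonneg this
    rw [hP.sum_orient_eq (v 0) 0] at this
    exact div_nonneg this zero_le_two
  have hK : 0 ≤ K := Finset.sum_nonneg fun i _ => by
    rw [hP.cot_half_angle]
    exact (halfTan_pos (hP.norm_dir i) (hP.norm_dir (i + 1)) (hP.cross_dir_succ_pos i)).le
  have h1 : (A + r ^ 2 * K) ^ 2 ≤ (r * L) ^ 2 := pow_le_pow_left₀ (by positivity) h 2
  -- The arithmetic-geometric mean inequality: `4 * A * (r ^ 2 * K) ≤ (A + r ^ 2 * K) ^ 2`.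
  have h2 : r ^ 2 * (4 * A * K) ≤ r ^ 2 * L ^ 2 := by nlinarith [sq_nonneg (A - r ^ 2 * K)]
  exact le_of_mul_le_mul_left h2 (by positivity)

end CcwPolygon

/-! ### Ordering the vertices of a convex polygon -/

/-- In a subset of least cardinality with the same hull, no point can be dropped. -/
lemma exists_convexIndependent_subset (s : Finset Plane) : ∃ t ⊆ s,
    convexHull ℝ (t : Set Plane) = convexHull ℝ (s : Set Plane) ∧
      ∀ x ∈ t, x ∉ convexHull ℝ ((t.erase x : Finset Plane) : Set Plane) := by
  classical
  obtain ⟨t, ht, hmin⟩ := Finset.exists_min_image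
    (s.powerset.filter fun t : Finset Plane => convexHull ℝ (t : Set Plane) = convexHull ℝ (s : Set Plane))
    Finset.card ⟨s, by simp⟩
  simp only [Finset.mem_filter, Finset.mem_powerset, and_imp] at ht hmin
  refine ⟨t, ht.1, ht.2, fun x hx hmem => ?_⟩
  have h1 : convexHull ℝ ((t.erase x : Finset Plane) : Set Plane) = convexHull ℝ (t : Set Plane) := by
    refine Set.Subset.antisymm (convexHull_mono (by simp)) (convexHull_min ?_ (convex_convexHull ℝ _))
    intro y hy
    by_cases h : y = x
    · rw [h]; exact hmem
    · exact subset_convexHull ℝ _ (by simp at hy ⊢; exact ⟨hy, h⟩)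
  have h2 := hmin (t.erase x) ((Finset.erase_subset _ _).trans ht.1) (h1.trans ht.2)
  have h3 := Finset.card_erase_lt_of_mem hx
  omega

lemma volume_convexHull_pair (p q : Plane) : volume (convexHull ℝ ({p, q} : Set Plane)) = 0 := by
  obtain ⟨u, hu, huq⟩ : ∃ u : Plane, u ≠ 0 ∧ cross u (q - p) = 0 := by
    by_cases h : q - p = 0
    · refine ⟨!₂[1, 0], fun h0 => ?_, by rw [h]; simp [cross]⟩
      have := congrFun (congrArg WithLp.ofLp h0) 0
      simp at this
    · exact ⟨q - p, h, cross_self _⟩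
  refine measure_mono_null ?_ (volume_line hu p)
  rw [convexHull_pair]
  rintro _ ⟨a, b, -, -, hab, rfl⟩
  have : a • p + b • q - p = b • (q - p) := by
    obtain rfl : a = 1 - b := by linarith
    rw [sub_smul, one_smul, smul_sub]; abel
  simp only [Set.mem_ofPred_eq]
  rw [this, cross_smul_right, huq, mul_zero]

lemma three_le_card_of_volume_ne_zero {t : Finset Plane}
    (h : volume (convexHull ℝ (t : Set Plane)) ≠ 0) : 3 ≤ t.card := by
  classical
  by_contra hlt
  apply h
  obtain ⟨p, q, hpq⟩ : ∃ p q : Plane, (t : Set Plane) ⊆ {p, q} := by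
    have : t.card = 0 ∨ t.card = 1 ∨ t.card = 2 := by omega
    rcases this with h | h | h
    · rw [Finset.card_eq_zero] at h; exact ⟨0, 0, by simp [h]⟩
    · obtain ⟨a, rfl⟩ := Finset.card_eq_one.1 h; exact ⟨a, a, by simp⟩
    · obtain ⟨a, b, -, rfl⟩ := Finset.card_eq_two.1 h; exact ⟨a, b, by simp⟩
  exact measure_mono_null (convexHull_mono hpq) (volume_convexHull_pair p q)

lemma mem_convexHull_erase {t : Finset Plane} {x : Plane} {S : Set Plane}
    (hS : x ∈ convexHull ℝ S) (h : ∀ y ∈ S, y ∈ t ∧ y ≠ x) :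
    x ∈ convexHull ℝ ((t.erase x : Finset Plane) : Set Plane) :=
  convexHull_mono (fun y hy => by simpa [and_comm] using h y hy) hS

/-- A convex polygon with nonempty interior has its vertices in counterclockwise order. -/
theorem exists_ccwPolygon (s : Finset Plane) (hvol : volume (convexHull ℝ (s : Set Plane)) ≠ 0) :
    ∃ n v, n ≤ s.card ∧ CcwPolygon n v ∧ convexHull ℝ (Set.range v) = convexHull ℝ (s : Set Plane) := by
  classical
  obtain ⟨t, hts, hhull, hind⟩ := exists_convexIndependent_subset s
  have h3 : 3 ≤ t.card := three_le_card_of_volume_ne_zero (by rwa [hhull])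
  -- A point of largest norm is extreme: all others lie strictly on one side of the line through `p`
  -- perpendicular to the vector `p`, at depth measured by `D`.
  obtain ⟨p, hp, hmax⟩ := Finset.exists_max_image t (fun x => ‖x‖) (Finset.card_pos.1 (by omega))
  set D : Plane → ℝ := fun x => inner ℝ p (p - x) with hD
  have hDpos : ∀ x ∈ t.erase p, 0 < D x := by
    intro x hx
    rw [Finset.mem_erase] at hx
    have h1 := hmax x hx.2
    have h2 : ‖p - x‖ ^ 2 = ‖p‖ ^ 2 - 2 * inner ℝ p x + ‖x‖ ^ 2 := norm_sub_sq_real p x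
    have h4 : 0 < ‖p - x‖ ^ 2 := by
      have : p - x ≠ 0 := sub_ne_zero.2 hx.1.symm
      positivity
    have h5 : ‖x‖ ^ 2 ≤ ‖p‖ ^ 2 := pow_le_pow_left₀ (norm_nonneg _) h1 2
    simp only [hD]
    rw [inner_sub_right, real_inner_self_eq_norm_sq]
    linarith
  obtain ⟨x₁, hx₁⟩ : ∃ x, x ∈ t.erase p := by
    apply Finset.card_pos.1
    rw [Finset.card_erase_of_mem hp]; omega
  have hp0 : 0 < ‖p‖ ^ 2 := by
    have : p ≠ 0 := by
      rintro rfl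
      have := hDpos x₁ hx₁
      simp [hD] at this
    positivity
  -- Since `D` is positive, `f` is the slope of the ray from `p` to `x`, and sorting by `f` is
  -- sorting by angle around `p`.
  set f : Plane → ℝ := fun x => cross p (p - x) / D x with hf
  have hcr : ∀ x ∈ t.erase p, ∀ y ∈ t.erase p,
      ‖p‖ ^ 2 * orient p x y = D x * D y * (f y - f x) := by
    intro x hx y hy
    have h1 := (hDpos x hx).ne'
    have h2 := (hDpos y hy).ne'
    have : D x * D y * (f y - f x) = D x * cross p (p - y) - D y * cross p (p - x) := by
      simp only [hf]; field_simp
    rw [this, norm_sq_eq]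
    simp only [hD, inner_eq, orient_def, cross, PiLp.sub_apply]
    ring
  -- Two points on one ray from `p` are impossible: the nearer one would lie in the segment from `p`
  -- to the farther one.
  have hseg : ∀ x ∈ t.erase p, ∀ y ∈ t.erase p, x ≠ y → orient p x y = 0 → D x ≤ D y → False := by
    intro x hx y hy hne h0 hle
    have hy0 := hDpos y hy
    have hx0 := hDpos x hx
    have hxy : D y • (x - p) = D x • (y - p) := by
      have e0 : ‖p‖ ^ 2 ≠ 0 := hp0.ne'
      rw [norm_sq_eq] at e0
      apply plane_ext
      · have : (p 0 ^ 2 + p 1 ^ 2) * (D y * (x 0 - p 0) - D x * (y 0 - p 0)) = 0 := by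
          simp only [hD, inner_eq, PiLp.sub_apply, orient_def] at h0 ⊢
          linear_combination (p 0 ^ 2 + p 1 ^ 2) * (-p 1) * h0
        simpa [sub_eq_zero] using (mul_eq_zero.1 this).resolve_left e0
      · have : (p 0 ^ 2 + p 1 ^ 2) * (D y * (x 1 - p 1) - D x * (y 1 - p 1)) = 0 := by
          simp only [hD, inner_eq, PiLp.sub_apply, orient_def] at h0 ⊢
          linear_combination (p 0 ^ 2 + p 1 ^ 2) * (p 0) * h0
        simpa [sub_eq_zero] using (mul_eq_zero.1 this).resolve_left e0
    have hxs : x ∈ convexHull ℝ ({p, y} : Set Plane) := by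
      rw [convexHull_pair]
      refine ⟨1 - D x / D y, D x / D y, ?_, by positivity, by ring, ?_⟩
      · rw [sub_nonneg, div_le_one hy0]; exact hle
      · have : x - p = (D x / D y) • (y - p) := by
          rw [div_eq_inv_mul, mul_smul, ← hxy, smul_smul, inv_mul_cancel₀ hy0.ne', one_smul]
        calc (1 - D x / D y) • p + (D x / D y) • y = p + (D x / D y) • (y - p) := by
              rw [smul_sub, sub_smul, one_smul]; abel
          _ = x := by rw [← this]; abel
    rw [Finset.mem_erase] at hx hy
    refine hind x hx.2 (mem_convexHull_erase hxs ?_)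
    rintro z (rfl | rfl)
    · exact ⟨hp, hx.1.symm⟩
    · exact ⟨hy.2, hne.symm⟩
  have hinj : Set.InjOn f (t.erase p : Finset Plane) := by
    intro x hx y hy hxy
    by_contra hne
    have h0 : orient p x y = 0 := by
      have := hcr x hx y hy
      rw [hxy, sub_self, mul_zero] at this
      exact (mul_eq_zero.1 this).resolve_left hp0.ne'
    rcases le_total (D x) (D y) with h | h
    · exact hseg x hx y hy hne h0 h
    · refine hseg y hy x hx (Ne.symm hne) ?_ h
      simp only [orient_def] at h0 ⊢; linarith
  set n := t.card with hn
  have hFcard : ((t.erase p).image f).card = n - 1 := by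
    rw [Finset.card_image_of_injOn hinj, Finset.card_erase_of_mem hp]
  set e := ((t.erase p).image f).orderEmbOfFin hFcard with he
  have hg : ∀ i, ∃ x ∈ t.erase p, f x = e i := fun i => by
    simpa only [Finset.mem_image] using Finset.orderEmbOfFin_mem _ hFcard i
  choose g hgmem hgf using hg
  have hgsurj : ∀ x ∈ t.erase p, ∃ i, g i = x := by
    intro x hx
    have : f x ∈ Set.range e := by
      rw [he, Finset.range_orderEmbOfFin]
      exact Finset.mem_coe.2 (Finset.mem_image_of_mem f hx)
    obtain ⟨i, hi⟩ := this
    exact ⟨i, hinj (hgmem i) hx ((hgf i).trans hi)⟩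
  have horient : ∀ i j, i < j → 0 < orient p (g i) (g j) := by
    intro i j hij
    have h1 := hcr _ (hgmem i) _ (hgmem j)
    have h2 : f (g i) < f (g j) := by rw [hgf, hgf]; exact e.strictMono hij
    have h4 : 0 < ‖p‖ ^ 2 * orient p (g i) (g j) := by
      rw [h1]
      exact mul_pos (mul_pos (hDpos _ (hgmem i)) (hDpos _ (hgmem j))) (by linarith)
    exact (mul_pos_iff_of_pos_left hp0).1 h4
  have horient3 : ∀ i j k, i < j → j < k → 0 < orient (g i) (g j) (g k) := by
    intro i j k hij hjk
    by_contra hle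
    push Not at hle
    have h1 := horient i j hij
    have h2 := horient j k hjk
    have h4 := horient i k (hij.trans hjk)
    -- Without a left turn at `g j`, this point would lie in the triangle of `p`, `g i`, `g k`,
    -- against independence.
    have hmem : g j ∈ convexHull ℝ ({p, g i, g k} : Set Plane) := by
      rw [mem_triangle_iff h4]
      refine ⟨h1.le, ?_, ?_⟩
      · rw [orient_rotate, orient_swap, orient_rotate, orient_rotate]; linarith
      · rw [orient_rotate]; exact h2.le
    have hj := Finset.mem_erase.1 (hgmem j)
    refine hind (g j) hj.2 (mem_convexHull_erase hmem ?_)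
    rintro z (rfl | rfl | rfl)
    · exact ⟨hp, hj.1.symm⟩
    · refine ⟨(Finset.mem_erase.1 (hgmem i)).2, fun h => ?_⟩
      rw [h, orient_right_self] at h1; exact lt_irrefl _ h1
    · refine ⟨(Finset.mem_erase.1 (hgmem k)).2, fun h => ?_⟩
      rw [h, orient_right_self] at h2; exact lt_irrefl _ h2
  set w : ℕ → Plane := fun j => if h : 0 < j ∧ j - 1 < n - 1 then g ⟨j - 1, h.2⟩ else p with hw
  have hw0 : w 0 = p := by simp [hw]
  have hwpos : ∀ j (h0 : 0 < j) (hj : j < n), w j = g ⟨j - 1, by omega⟩ := by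
    intro j h0 hj
    simp only [hw]
    rw [dif_pos ⟨h0, by omega⟩]
  refine ⟨n, fun j => w (j % n), Finset.card_le_card hts, ?_, ?_⟩
  · refine CcwPolygon.of_lt h3 (fun i => by simp) ?_
    intro i j k hij hjk hk
    simp only [Nat.mod_eq_of_lt hk, Nat.mod_eq_of_lt (hjk.trans hk),
      Nat.mod_eq_of_lt (hij.trans (hjk.trans hk))]
    rw [hwpos j (by omega) (by omega), hwpos k (by omega) hk]
    rcases Nat.eq_zero_or_pos i with rfl | hi
    · rw [hw0]; exact horient _ _ (by simp only [Fin.mk_lt_mk]; omega)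
    · rw [hwpos i hi (by omega)]
      exact horient3 _ _ _ (by simp only [Fin.mk_lt_mk]; omega) (by simp only [Fin.mk_lt_mk]; omega)
  · rw [← hhull]
    congr 1
    ext x
    simp only [Set.mem_range, Finset.mem_coe]
    constructor
    · rintro ⟨j, rfl⟩
      have hj : j % n < n := Nat.mod_lt _ (by omega)
      rcases Nat.eq_zero_or_pos (j % n) with h | h
      · rw [h, hw0]; exact hp
      · rw [hwpos _ h hj]; exact (Finset.mem_erase.1 (hgmem _)).2
    · intro hx
      by_cases hxp : x = p
      · exact ⟨0, by rw [Nat.zero_mod, hw0, hxp]⟩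
      · obtain ⟨i, hi⟩ := hgsurj x (Finset.mem_erase.2 ⟨hxp, hx⟩)
        have hin : i.1 + 1 < n := by omega
        refine ⟨i.1 + 1, ?_⟩
        rw [Nat.mod_eq_of_lt hin, hwpos _ (by omega) hin, ← hi]
        congr 1

/-! ### Sum of the angles -/

/-- Triangulate from `v 0` and use the triangle inequality for angles where a diagonal splits one.
The upper bound suffices, since the angle sum enters the cotangent estimate with a negative
coefficient. -/
lemma CcwPolygon.sum_angle_le {n : ℕ} {v : ℕ → Plane} (hP : CcwPolygon n v) (h5 : n ≤ 5) :
    ∑ i ∈ Finset.range n, EuclideanGeometry.angle (v i) (v (i + 1)) (v (i + 2))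
      ≤ (n - 2) * Real.pi := by
  have h3 := hP.three_le
  have hper := hP.periodic
  have tri : ∀ i j k, v i ≠ v j → EuclideanGeometry.angle (v i) (v j) (v k)
      + EuclideanGeometry.angle (v j) (v k) (v i) + EuclideanGeometry.angle (v k) (v i) (v j) = Real.pi :=
    fun i j k h => EuclideanGeometry.angle_add_angle_add_angle_eq_pi (v k) h.symm
  have sub := fun i j k l => EuclideanGeometry.angle_le_angle_add_angle (v i) (v j) (v k) (v l)
  have comm := fun i j k => EuclideanGeometry.angle_comm (v i) (v j) (v k)
  obtain rfl | rfl | rfl : n = 3 ∨ n = 4 ∨ n = 5 := by omega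
  · simp only [Finset.sum_range_succ, Finset.sum_range_zero]
    have := tri 0 1 2 (hP.ne_of_lt (by omega) (by omega))
    norm_num [show v 3 = v 0 from hper 0, show v 4 = v 1 from hper 1]
    linarith
  · simp only [Finset.sum_range_succ, Finset.sum_range_zero]
    have t1 := tri 0 1 2 (hP.ne_of_lt (by omega) (by omega))
    have t2 := tri 0 2 3 (hP.ne_of_lt (by omega) (by omega))
    norm_num [show v 4 = v 0 from hper 0, show v 5 = v 1 from hper 1]
    linarith [sub 0 3 2 1, sub 2 1 0 3, comm 2 0 1, comm 3 0 2, comm 3 0 1]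
  · simp only [Finset.sum_range_succ, Finset.sum_range_zero]
    have t1 := tri 0 1 2 (hP.ne_of_lt (by omega) (by omega))
    have t2 := tri 0 2 3 (hP.ne_of_lt (by omega) (by omega))
    have t3 := tri 0 3 4 (hP.ne_of_lt (by omega) (by omega))
    norm_num [show v 5 = v 0 from hper 0, show v 6 = v 1 from hper 1]
    linarith [sub 0 4 3 1, sub 0 3 2 1, sub 2 1 0 3, sub 3 2 0 4]

/-! ### Numerical inequality for the angles -/

lemma hasDerivAt_cot {y : ℝ} (h : Real.sin y ≠ 0) :
    HasDerivAt Real.cot (-(1 + Real.cot y ^ 2)) y := by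
  have : Real.cot = fun x => Real.cos x / Real.sin x := funext fun x => Real.cot_eq_cos_div_sin x
  rw [Real.cot_eq_cos_div_sin, this]
  refine ((Real.hasDerivAt_cos y).div (Real.hasDerivAt_sin y) h).congr_deriv ?_
  field_simp
  ring

lemma sin_ne_zero_of_mem_Ioo {y : ℝ} (hy : y ∈ Set.Ioo 0 (Real.pi / 2)) : Real.sin y ≠ 0 :=
  (Real.sin_pos_of_pos_of_lt_pi hy.1 (by linarith [hy.2, Real.pi_pos])).ne'

lemma cot_pos_of_mem_Ioo {y : ℝ} (hy : y ∈ Set.Ioo 0 (Real.pi / 2)) : 0 < Real.cot y := by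
  rw [Real.cot_eq_cos_div_sin]
  exact div_pos (Real.cos_pos_of_mem_Ioo ⟨by linarith [hy.1, Real.pi_pos], hy.2⟩)
    (Real.sin_pos_of_pos_of_lt_pi hy.1 (by linarith [hy.2, Real.pi_pos]))

lemma antitoneOn_cot_add_id : AntitoneOn (fun y => Real.cot y + y) (Set.Ioo 0 (Real.pi / 2)) := by
  have hd : ∀ y ∈ Set.Ioo 0 (Real.pi / 2), HasDerivAt (fun y => Real.cot y + y)
      (-(1 + Real.cot y ^ 2) + 1) y := fun y hy =>
    (hasDerivAt_cot (sin_ne_zero_of_mem_Ioo hy)).add (hasDerivAt_id y)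
  refine antitoneOn_of_deriv_nonpos (convex_Ioo _ _)
    (fun y hy => (hd y hy).continuousAt.continuousWithinAt) ?_ ?_
  · rw [interior_Ioo]
    exact fun y hy => (hd y hy).differentiableAt.differentiableWithinAt
  · rw [interior_Ioo]
    intro y hy
    rw [(hd y hy).deriv]
    nlinarith [sq_nonneg (Real.cot y)]

/-- The difference of the two sides has derivative `c ^ 2 - cot y ^ 2 - c * (y - y₀)`. This has the
sign of `y - y₀` because `cot y + y` is decreasing and `cot` is positive. The quadratic term pays
for the squared charge later. -/
lemma cot_ge_tangent {y₀ y : ℝ} (h₀ : y₀ ∈ Set.Ioo 0 (Real.pi / 2)) (hy : y ∈ Set.Ioo 0 (Real.pi / 2)) :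
    Real.cot y₀ - (1 + Real.cot y₀ ^ 2) * (y - y₀) + Real.cot y₀ / 2 * (y - y₀) ^ 2
      ≤ Real.cot y := by
  set c := Real.cot y₀ with hc
  have hc0 : 0 < c := cot_pos_of_mem_Ioo h₀
  set G : ℝ → ℝ := fun y => Real.cot y - (c - (1 + c ^ 2) * (y - y₀) + c / 2 * (y - y₀) ^ 2) with hG
  set G' : ℝ → ℝ := fun y => -(1 + Real.cot y ^ 2) + (1 + c ^ 2) - c * (y - y₀) with hG'
  have hd : ∀ y ∈ Set.Ioo 0 (Real.pi / 2), HasDerivAt G (G' y) y := by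
    intro y hy
    have h1 := hasDerivAt_cot (sin_ne_zero_of_mem_Ioo hy)
    have h2 : HasDerivAt (fun y => y - y₀) 1 y := (hasDerivAt_id y).sub_const y₀
    have h3 := ((h2.const_mul (1 + c ^ 2)).const_sub c).add ((h2.pow 2).const_mul (c / 2))
    refine (h1.sub h3).congr_deriv ?_
    simp only [hG']; simp; ring
  have hG0 : G y₀ = 0 := by simp only [hG]; rw [← hc]; ring
  suffices 0 ≤ G y by simp only [hG] at this; linarith
  rcases le_total y₀ y with hle | hle
  · have hsub : Set.Icc y₀ y ⊆ Set.Ioo 0 (Real.pi / 2) := fun z hz =>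
      ⟨h₀.1.trans_le hz.1, hz.2.trans_lt hy.2⟩
    have hmono : MonotoneOn G (Set.Icc y₀ y) := by
      refine monotoneOn_of_deriv_nonneg (convex_Icc _ _)
        (fun z hz => (hd z (hsub hz)).continuousAt.continuousWithinAt) ?_ ?_
      · exact fun z hz => (hd z (hsub (interior_subset hz))).differentiableAt.differentiableWithinAt
      · intro z hz
        have hz' := interior_subset hz
        rw [(hd z (hsub hz')).deriv]
        have h1 := antitoneOn_cot_add_id h₀ (hsub hz') hz'.1
        simp only [← hc] at h1
        have h2 := cot_pos_of_mem_Ioo (hsub hz')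
        simp only [hG']
        have hz1 := hz'.1
        nlinarith
    rw [← hG0]
    exact hmono ⟨le_rfl, hle⟩ ⟨hle, le_rfl⟩ hle
  · have hsub : Set.Icc y y₀ ⊆ Set.Ioo 0 (Real.pi / 2) := fun z hz =>
      ⟨hy.1.trans_le hz.1, hz.2.trans_lt h₀.2⟩
    have hmono : AntitoneOn G (Set.Icc y y₀) := by
      refine antitoneOn_of_deriv_nonpos (convex_Icc _ _)
        (fun z hz => (hd z (hsub hz)).continuousAt.continuousWithinAt) ?_ ?_
      · exact fun z hz => (hd z (hsub (interior_subset hz))).differentiableAt.differentiableWithinAt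
      · intro z hz
        have hz' := interior_subset hz
        rw [(hd z (hsub hz')).deriv]
        have h1 := antitoneOn_cot_add_id (hsub hz') h₀ hz'.2
        simp only [← hc] at h1
        have h2 := cot_pos_of_mem_Ioo (hsub hz')
        simp only [hG']
        have hz1 := hz'.2
        nlinarith
    rw [← hG0]
    exact hmono ⟨le_rfl, hle⟩ ⟨hle, le_rfl⟩ hle

/-- Half the perimeter of the Cairo and Prismatic pentagons. -/
def cc : ℝ := Real.sqrt (2 + Real.sqrt 3)

lemma cc_sq : cc ^ 2 = 2 + Real.sqrt 3 := Real.sq_sqrt (by positivity)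

lemma one_le_cc : 1 ≤ cc := by
  rw [cc, Real.one_le_sqrt]; linarith [Real.sqrt_nonneg 3]

/-- Slope of the charge near the angle `2π/3`. -/
def slopeThree : ℝ := ((6 - 2 * Real.sqrt 3) / Real.pi - 2 / 3) / cc

/-- Slope of the charge near the angle `π/2`. -/
def slopeFour : ℝ := ((6 - 2 * Real.sqrt 3) / Real.pi - 1) / cc

/-- Charge of an angle of a tile; the charges at a vertex of a tiling have nonnegative sum. -/
def charge (x : ℝ) : ℝ := max (slopeThree * (x - 2 * Real.pi / 3)) (slopeFour * (x - Real.pi / 2))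

lemma sqrt_three_bounds : 1.732 < Real.sqrt 3 ∧ Real.sqrt 3 < 1.733 :=
  ⟨Real.lt_sqrt_of_sq_lt (by norm_num), by rw [Real.sqrt_lt' (by norm_num)]; norm_num⟩

lemma slope_aux : 0.8 ≤ (6 - 2 * Real.sqrt 3) / Real.pi ∧ (6 - 2 * Real.sqrt 3) / Real.pi ≤ 0.86 := by
  obtain ⟨h1, h2⟩ := sqrt_three_bounds
  have h3 := Real.pi_gt_d2
  have h4 := Real.pi_lt_d2
  constructor
  · rw [le_div_iff₀ Real.pi_pos]; nlinarith
  · rw [div_le_iff₀ Real.pi_pos]; nlinarith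

lemma slopeThree_nonneg : 0 ≤ slopeThree :=
  div_nonneg (by linarith [slope_aux.1]) (by linarith [one_le_cc])

lemma slopeFour_nonpos : slopeFour ≤ 0 :=
  div_nonpos_of_nonpos_of_nonneg (by linarith [slope_aux.2]) (by linarith [one_le_cc])

lemma cc_mul_slopeThree : cc * slopeThree = (6 - 2 * Real.sqrt 3) / Real.pi - 2 / 3 := by
  have := one_le_cc
  rw [slopeThree]; field_simp

lemma cc_mul_slopeFour : cc * slopeFour = (6 - 2 * Real.sqrt 3) / Real.pi - 1 := by
  have := one_le_cc
  rw [slopeFour]; field_simp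

lemma slopeThree_sq_le : slopeThree ^ 2 ≤ 0.04 := by
  have h1 := cc_mul_slopeThree
  have h2 := slope_aux
  have h3 := slopeThree_nonneg
  have h4 := one_le_cc
  have : slopeThree ≤ 0.2 := by nlinarith
  nlinarith

lemma slopeFour_sq_le : slopeFour ^ 2 ≤ 0.04 := by
  have h1 := cc_mul_slopeFour
  have h2 := slope_aux
  have h3 := slopeFour_nonpos
  have h4 := one_le_cc
  have : -0.2 ≤ slopeFour := by nlinarith
  nlinarith

lemma cot_pi_div_three : Real.cot (Real.pi / 3) = Real.sqrt 3 / 3 := by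
  rw [Real.cot_eq_cos_div_sin, Real.cos_pi_div_three, Real.sin_pi_div_three]
  have : Real.sqrt 3 ^ 2 = 3 := Real.sq_sqrt (by norm_num)
  have h0 : 0 < Real.sqrt 3 := by positivity
  field_simp
  linarith

lemma cot_pi_div_four : Real.cot (Real.pi / 4) = 1 := by
  rw [Real.cot_eq_cos_div_sin, Real.cos_pi_div_four, Real.sin_pi_div_four]
  exact div_self (by positivity)

/-- The affine part is the chord of `cot (α / 2)` through `π / 2` and `2 * π / 3`. The tangent
slopes there are `-1` and `-2 / 3`, so chord plus `cc * charge` is the larger of the two tangent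
lines. The quadratic gain of `cot_ge_tangent` exceeds `5 / 4` of the squared charge on either
branch. -/
lemma cot_half_ge {α : ℝ} (h0 : 0 < α) (hπ : α < Real.pi) :
    4 - Real.sqrt 3 - (6 - 2 * Real.sqrt 3) / Real.pi * α + cc * charge α + 5 / 4 * charge α ^ 2
      ≤ Real.cot (α / 2) := by
  have hpi := Real.pi_pos
  have hs3 : Real.sqrt 3 ^ 2 = 3 := Real.sq_sqrt (by norm_num)
  have hmem : α / 2 ∈ Set.Ioo 0 (Real.pi / 2) := ⟨by linarith, by linarith⟩
  have hb := sqrt_three_bounds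
  set β := (6 - 2 * Real.sqrt 3) / Real.pi with hβ
  have hβπ : β * Real.pi = 6 - 2 * Real.sqrt 3 := by rw [hβ]; field_simp
  rcases max_choice (slopeThree * (α - 2 * Real.pi / 3)) (slopeFour * (α - Real.pi / 2)) with h | h
  · have h1 := cot_ge_tangent (y₀ := Real.pi / 3) (y := α / 2) ⟨by linarith, by linarith⟩ hmem
    rw [cot_pi_div_three] at h1
    rw [charge, h]
    have e : cc * (slopeThree * (α - 2 * Real.pi / 3)) = (β - 2 / 3) * (α - 2 * Real.pi / 3) := by
      rw [← mul_assoc, cc_mul_slopeThree]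
    rw [e, mul_pow]
    have h2 := mul_le_mul_of_nonneg_right slopeThree_sq_le (sq_nonneg (α - 2 * Real.pi / 3))
    set x := α - 2 * Real.pi / 3 with hx
    have hα : α = x + 2 * Real.pi / 3 := by rw [hx]; ring
    have e2 : α / 2 - Real.pi / 3 = x / 2 := by rw [hx]; ring
    rw [e2] at h1
    have e3 : β * α = β * x + (6 - 2 * Real.sqrt 3) * 2 / 3 := by rw [hα, ← hβπ]; ring
    nlinarith [sq_nonneg x]
  · have h1 := cot_ge_tangent (y₀ := Real.pi / 4) (y := α / 2) ⟨by linarith, by linarith⟩ hmem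
    rw [cot_pi_div_four] at h1
    rw [charge, h]
    have e : cc * (slopeFour * (α - Real.pi / 2)) = (β - 1) * (α - Real.pi / 2) := by
      rw [← mul_assoc, cc_mul_slopeFour]
    rw [e, mul_pow]
    have h2 := mul_le_mul_of_nonneg_right slopeFour_sq_le (sq_nonneg (α - Real.pi / 2))
    set x := α - Real.pi / 2 with hx
    have hα : α = x + Real.pi / 2 := by rw [hx]; ring
    have e2 : α / 2 - Real.pi / 4 = x / 2 := by rw [hx]; ring
    rw [e2] at h1
    have e3 : β * α = β * x + (6 - 2 * Real.sqrt 3) / 2 := by rw [hα, ← hβπ]; ring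
    nlinarith [sq_nonneg x]

/-- The chords sum to at least `12 - 4√3 - (2 - √3) n`, which is smallest at `n = 5` with value `cc
^ 2`. Cauchy-Schwarz for at most five charges turns `5 / 4` of the sum of squares into the missing
quarter of the squared sum. -/
lemma sq_le_sum_cot {n : ℕ} (h5 : n ≤ 5) {α : ℕ → ℝ} (h0 : ∀ i, 0 < α i) (hπ : ∀ i, α i < Real.pi)
    (hsum : ∑ i ∈ Finset.range n, α i ≤ (n - 2) * Real.pi) :
    (cc + (∑ i ∈ Finset.range n, charge (α i)) / 2) ^ 2
      ≤ ∑ i ∈ Finset.range n, Real.cot (α i / 2) := by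
  have h1 := Finset.sum_le_sum (s := Finset.range n) fun i _ => cot_half_ge (h0 i) (hπ i)
  refine le_trans ?_ h1
  simp only [Finset.sum_add_distrib, Finset.sum_sub_distrib, ← Finset.mul_sum, Finset.sum_const,
    Finset.card_range, nsmul_eq_mul]
  have h2 := Finset.sum_nonneg (s := Finset.range n) fun i _ => sq_nonneg (charge (α i))
  have h3 := sq_sum_le_card_mul_sum_sq (s := Finset.range n) (f := fun i => charge (α i))
  rw [Finset.card_range] at h3
  have hn5 : (n : ℝ) ≤ 5 := by exact_mod_cast h5
  set Q := ∑ i ∈ Finset.range n, charge (α i) ^ 2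
  set Φ := ∑ i ∈ Finset.range n, charge (α i)
  set S := ∑ i ∈ Finset.range n, α i
  have hb := sqrt_three_bounds
  have h4 : Φ ^ 2 ≤ 5 * Q := h3.trans (mul_le_mul_of_nonneg_right hn5 h2)
  have h6 : (6 - 2 * Real.sqrt 3) / Real.pi * S ≤ (6 - 2 * Real.sqrt 3) * (n - 2) := by
    calc _ ≤ (6 - 2 * Real.sqrt 3) / Real.pi * ((n - 2) * Real.pi) :=
          mul_le_mul_of_nonneg_left hsum (by linarith [slope_aux.1])
      _ = _ := by field_simp
  have h7 := cc_sq
  nlinarith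

/-! ### Local data of a tile -/

/-- Gathers all that the discharging argument needs from one tile: its angle at each of its points,
and a perimeter bound with the charges of its vertices as the only correction. -/
theorem exists_tile_data {T : Set Plane} (hT : IsUnitConvexPolygonLeFive T) :
    ∃ (V : Finset Plane) (θ : Plane → ℝ), V.card ≤ 5 ∧ (V : Set Plane) ⊆ frontier T ∧
      (∀ p ∈ T, HasAngle T p (θ p)) ∧ (∀ p ∈ V, 0 < θ p ∧ θ p < Real.pi) ∧
      (∀ p ∈ frontier T, p ∉ V → θ p = Real.pi) ∧ (∀ p ∈ interior T, θ p = 2 * Real.pi) ∧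
      ENNReal.ofReal (2 * cc + ∑ p ∈ V, charge (θ p)) ≤ perimeter T := by
  classical
  obtain ⟨⟨s, hs5, rfl⟩, hvol⟩ := hT
  obtain ⟨n, v, hns, hP, hhull⟩ := exists_ccwPolygon s (by rw [hvol]; exact one_ne_zero)
  rw [← hhull] at hvol ⊢
  have hn5 : n ≤ 5 := hns.trans hs5
  have hn3 := hP.three_le
  set ang : ℕ → ℝ := fun i => EuclideanGeometry.angle (v i) (v (i + 1)) (v (i + 2)) with hang
  have hPs := hP.shift 1
  have hrange : ∀ p, p ∈ Set.range v ↔ ∃ i < n, v (i + 1) = p := by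
    intro p
    have : Set.range v = Set.range (fun i => v (i + 1)) := by
      apply Set.Subset.antisymm
      · rintro _ ⟨i, rfl⟩
        exact ⟨i + (n - 1), by
          change v (i + (n - 1) + 1) = v i
          rw [show i + (n - 1) + 1 = i + n by omega, hP.periodic]⟩
      · rintro _ ⟨i, rfl⟩; exact ⟨i + 1, rfl⟩
    rw [this, hPs.range_eq]; rfl
  -- The last alternative gives `π` on the relative interiors of the sides; its values outside the
  -- tile are irrelevant.
  set θ : Plane → ℝ := fun p => if h : ∃ i < n, v (i + 1) = p then ang h.choose
    else if p ∈ interior (convexHull ℝ (Set.range v)) then 2 * Real.pi else Real.pi with hθ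
  have hθv : ∀ i < n, θ (v (i + 1)) = ang i := by
    intro i hi
    have h : ∃ j < n, v (j + 1) = v (i + 1) := ⟨i, hi, rfl⟩
    simp only [hθ]
    rw [dif_pos h]
    congr 1
    exact hPs.injOn h.choose_spec.1 hi h.choose_spec.2
  have hvf : Set.range v ⊆ frontier (convexHull ℝ (Set.range v)) := by
    intro p hp
    obtain ⟨i, rfl⟩ := hp
    rw [hP.frontier_eq]
    simp only [Set.mem_iUnion, Finset.mem_range, exists_prop]
    refine ⟨i % n, Nat.mod_lt _ (by omega), ?_⟩
    rw [hP.map_mod]; exact left_mem_segment ℝ _ _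
  have hθi : ∀ p ∈ interior (convexHull ℝ (Set.range v)), θ p = 2 * Real.pi := by
    intro p hp
    have h : ¬ ∃ i < n, v (i + 1) = p := fun h =>
      (hvf ((hrange p).2 h)).2 hp
    simp only [hθ]
    rw [dif_neg h, if_pos hp]
  have hθf : ∀ p ∈ frontier (convexHull ℝ (Set.range v)), p ∉ Set.range v → θ p = Real.pi := by
    intro p hp hpv
    rw [hrange] at hpv
    simp only [hθ]
    rw [dif_neg hpv, if_neg hp.2]
  have hVmem : ∀ p, p ∈ (Finset.range n).image (fun i => v (i + 1)) ↔ p ∈ Set.range v := by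
    intro p; rw [hrange]; simp
  refine ⟨(Finset.range n).image (fun i => v (i + 1)), θ, ?_, ?_, ?_, ?_, ?_, hθi, ?_⟩
  · exact Finset.card_image_le.trans (by simpa using hn5)
  · intro p hp; exact hvf ((hVmem p).1 hp)
  · intro p hp
    by_cases hpv : p ∈ Set.range v
    · obtain ⟨i, hi, rfl⟩ := (hrange p).1 hpv
      rw [hθv i hi]; exact hP.hasAngle_vertex i
    · by_cases hpi : p ∈ interior (convexHull ℝ (Set.range v))
      · rw [hθi p hpi]; exact HasAngle.of_mem_interior hpi
      · have hpf : p ∈ frontier (convexHull ℝ (Set.range v)) := ⟨subset_closure hp, hpi⟩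
        rw [hθf p hpf hpv]; exact hP.hasAngle_side hpf hpv
  · intro p hp
    obtain ⟨i, hi, rfl⟩ := (hrange p).1 ((hVmem p).1 hp)
    rw [hθv i hi]; exact ⟨hP.angle_pos i, hP.angle_lt_pi i⟩
  · intro p hp hpV
    exact hθf p hp fun h => hpV ((hVmem p).2 h)
  · rw [hP.perimeter_eq]
    apply ENNReal.ofReal_le_ofReal
    rw [Finset.sum_image (fun i hi j hj h => hPs.injOn (by simpa using hi) (by simpa using hj) h)]
    rw [Finset.sum_congr rfl fun i hi => by rw [hθv i (Finset.mem_range.1 hi)]]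
    have h1 := hP.four_mul_area_mul_sum_cot_le
    have h2 : (∑ i ∈ Finset.range n, orient 0 (v i) (v (i + 1))) / 2 = 1 := by
      have := hP.volume_hull 0
      rw [hvol] at this
      exact (ENNReal.ofReal_eq_one.1 this.symm)
    rw [h2] at h1
    have h3 := sq_le_sum_cot hn5 (α := ang) hP.angle_pos hP.angle_lt_pi (hP.sum_angle_le hn5)
    have hL : 0 ≤ ∑ i ∈ Finset.range n, dist (v i) (v (i + 1)) :=
      Finset.sum_nonneg fun _ _ => dist_nonneg
    -- Comparing squares needs no sign for `2 * cc` plus the charges, since the perimeter is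
    -- nonnegative.
    refine le_of_sq_le_sq ?_ hL
    simp only [hang] at h3 ⊢
    nlinarith

/-! ### Single tiles -/

lemma IsUnitConvexPolygonLeFive.isCompact {T : Set Plane} (hT : IsUnitConvexPolygonLeFive T) :
    IsCompact T := by
  obtain ⟨⟨s, -, rfl⟩, -⟩ := hT
  exact s.finite_toSet.isCompact_convexHull ℝ

lemma IsUnitConvexPolygonLeFive.convex {T : Set Plane} (hT : IsUnitConvexPolygonLeFive T) :
    Convex ℝ T := by
  obtain ⟨⟨s, -, rfl⟩, -⟩ := hT
  exact convex_convexHull ℝ _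

lemma IsUnitConvexPolygonLeFive.volume_frontier {T : Set Plane} (hT : IsUnitConvexPolygonLeFive T) :
    volume (frontier T) = 0 := hT.convex.addHaar_frontier volume

lemma IsUnitConvexPolygonLeFive.interior_nonempty {T : Set Plane} (hT : IsUnitConvexPolygonLeFive T) :
    (interior T).Nonempty := by
  by_contra h
  rw [Set.not_nonempty_iff_eq_empty] at h
  have h1 : T ⊆ frontier T := by
    rw [hT.isCompact.isClosed.frontier_eq, h, Set.sdiff_empty]
  have := measure_mono_null h1 hT.volume_frontier
  rw [hT.2] at this
  exact one_ne_zero this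

lemma _root_.IsPreconnected.inter_frontier_nonempty {s T : Set Plane} (hs : IsPreconnected s)
    (h1 : (s ∩ T).Nonempty) (h2 : (s ∩ Tᶜ).Nonempty) : (s ∩ frontier T).Nonempty := by
  by_contra h
  rw [Set.not_nonempty_iff_eq_empty] at h
  have hf : ∀ x ∈ s, x ∉ frontier T := fun x hx hx' => by
    have : x ∈ s ∩ frontier T := ⟨hx, hx'⟩
    rw [h] at this; exact this
  obtain ⟨x, -, hx1, hx2⟩ := hs (interior T) (closure T)ᶜ isOpen_interior isClosed_closure.isOpen_compl
    (fun x hx => by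
      by_cases hc : x ∈ closure T
      · exact Or.inl (by_contra fun hi => hf x hx ⟨hc, hi⟩)
      · exact Or.inr hc)
    (by
      obtain ⟨x, hx, hxT⟩ := h1
      exact ⟨x, hx, by_contra fun hi => hf x hx ⟨subset_closure hxT, hi⟩⟩)
    (by
      obtain ⟨x, hx, hxT⟩ := h2
      exact ⟨x, hx, fun hc => hf x hx ⟨hc, fun hi => hxT (interior_subset hi)⟩⟩)
  exact hx2 (interior_subset_closure hx1)

lemma volume_closedBall' (x : Plane) {r : ℝ} (hr : 0 ≤ r) :
    volume (Metric.closedBall x r) = ENNReal.ofReal (Real.pi * r ^ 2) := by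
  rw [EuclideanSpace.volume_closedBall_fin_two, ← ENNReal.ofReal_pow hr,
    ← ENNReal.ofReal_mul (by positivity), mul_comm]

lemma volume_ball' (x : Plane) {r : ℝ} (hr : 0 ≤ r) :
    volume (Metric.ball x r) = ENNReal.ofReal (Real.pi * r ^ 2) := by
  rw [EuclideanSpace.volume_ball_fin_two, ← ENNReal.ofReal_pow hr,
    ← ENNReal.ofReal_mul (by positivity), mul_comm]

/-- The boundary of a tile has definite length near every point of the tile. -/
lemma le_length_frontier_inter_ball {T : Set Plane} (hT : IsUnitConvexPolygonLeFive T) {z : Plane}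
    (hz : z ∈ T) : ENNReal.ofReal (2 / 5) ≤ length (frontier T ∩ Metric.closedBall z 1) := by
  have hpi := Real.pi_gt_d2
  have hpi' := Real.pi_lt_d2
  -- A disc of radius `3 / 5` has area greater than one, so it leaves the tile, and a boundary point
  -- `y` lies within `3 / 5` of `z`.
  obtain ⟨w, hw, hwT⟩ : ∃ w ∈ Metric.closedBall z (3 / 5), w ∉ T := by
    by_contra h
    push Not at h
    have := measure_mono (μ := volume) (show Metric.closedBall z (3 / 5) ⊆ T from h)
    rw [hT.2, volume_closedBall' z (by norm_num), ENNReal.ofReal_le_one] at this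
    nlinarith
  obtain ⟨y, hys, hyf⟩ := (convex_segment z w).isPreconnected.inter_frontier_nonempty (T := T)
    ⟨z, left_mem_segment ℝ _ _, hz⟩ ⟨w, right_mem_segment ℝ _ _, hwT⟩
  have hyz : dist y z ≤ 3 / 5 :=
    (convex_closedBall z (3 / 5 : ℝ)).segment_subset (Metric.mem_closedBall_self (by norm_num)) hw hys
  have hyT : y ∈ T := hT.isCompact.isClosed.frontier_subset hyf
  have hrank : 1 < Module.rank ℝ Plane := by
    rw [← Module.finrank_eq_rank, finrank_euclideanSpace_fin]
    exact Nat.one_lt_cast.2 one_lt_two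
  -- Every circle about `y` of radius below `2 / 5` meets the boundary: the tile is too large to fit
  -- in the disc, and a circle inside the tile would make `y` interior. The distance to `y` is
  -- 1-Lipschitz, so the boundary is at least as long as the interval of radii.
  have key : Set.Ioo (0 : ℝ) (2 / 5) ⊆ (fun x => dist x y) '' (frontier T ∩ Metric.closedBall z 1) := by
    rintro t ⟨ht0, ht⟩
    obtain ⟨x, hxs, hxf⟩ := (isConnected_sphere hrank y ht0.le).isPreconnected.inter_frontier_nonempty
      (T := T) (by
        obtain ⟨w', hw'T, hw'⟩ : ∃ w' ∈ T, t ≤ dist w' y := by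
          by_contra h
          push Not at h
          have := measure_mono (μ := volume) (show T ⊆ Metric.ball y t from h)
          rw [hT.2, volume_ball' y ht0.le, ENNReal.one_le_ofReal] at this
          nlinarith
        have hc : ContinuousOn (fun x => dist x y) (segment ℝ y w') := by fun_prop
        obtain ⟨x, hx, hxt⟩ := (convex_segment y w').isPreconnected.intermediate_value
          (left_mem_segment ℝ _ _) (right_mem_segment ℝ _ _) hc
          (show t ∈ Set.Icc _ _ from ⟨by simpa using ht0.le, hw'⟩)
        exact ⟨x, hxt, hT.convex.segment_subset hyT hw'T hx⟩)
      (by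
        by_contra h
        have hsub : Metric.sphere y t ⊆ T := fun x hx => by
          by_contra hxT
          exact h ⟨x, hx, hxT⟩
        have h2 : Metric.closedBall y t ⊆ T := by
          rw [← convexHull_sphere_eq_closedBall y ht0.le]
          exact convexHull_min hsub hT.convex
        exact hyf.2 (mem_interior_iff_mem_nhds.2 (mem_of_superset (Metric.closedBall_mem_nhds y ht0) h2)))
    refine ⟨x, ⟨hxf, ?_⟩, hxs⟩
    rw [Metric.mem_sphere] at hxs
    rw [Metric.mem_closedBall]
    linarith [dist_triangle x y z]
  have hLip : LipschitzWith 1 (fun x : Plane => dist x y) := LipschitzWith.dist_left y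
  have h1 := hLip.hausdorffMeasure_image_le (d := 1) zero_le_one (frontier T ∩ Metric.closedBall z 1)
  have h2 := measure_mono (μ := Measure.hausdorffMeasure (1 : ℝ)) key
  rw [hausdorffMeasure_real, Real.volume_Ioo] at h2
  rw [hausdorffMeasure_real] at h1
  simp only [ENNReal.coe_one, ENNReal.one_rpow, one_mul] at h1
  rw [sub_zero] at h2
  exact h2.trans h1

/-! ### Tilings -/

/-- Total length of the tile boundaries in the disc of radius `R`, counted tile by tile. -/
def tileLength (𝒯 : Set (Set Plane)) (R : ℝ) : ℝ≥0∞ :=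
  ∑' T : 𝒯, length (frontier (T : Set Plane) ∩ Metric.closedBall 0 R)

lemma tileLength_mono (𝒯 : Set (Set Plane)) : Monotone (tileLength 𝒯) := fun _ _ h =>
  ENNReal.tsum_le_tsum fun _ => measure_mono (Set.inter_subset_inter_right _
    (Metric.closedBall_subset_closedBall h))

namespace IsAdmissible

variable {𝒯 : Set (Set Plane)} (h𝒯 : IsAdmissible 𝒯)
include h𝒯

lemma tile (T : 𝒯) : IsUnitConvexPolygonLeFive (T : Set Plane) := h𝒯.2 T T.2

lemma exists_mem (x : Plane) : ∃ T : 𝒯, x ∈ (T : Set Plane) := by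
  have : x ∈ ⋃₀ 𝒯 := by rw [h𝒯.1.1]; trivial
  obtain ⟨T, hT, hx⟩ := this
  exact ⟨⟨T, hT⟩, hx⟩

lemma inter_subset {S T : 𝒯} (h : S ≠ T) :
    (S : Set Plane) ∩ T ⊆ frontier (S : Set Plane) ∩ frontier (T : Set Plane) :=
  h𝒯.1.2 S S.2 T T.2 fun h' => h (Subtype.ext h')

lemma volume_inter {S T : 𝒯} (h : S ≠ T) : volume ((S : Set Plane) ∩ T) = 0 :=
  measure_mono_null ((h𝒯.inter_subset h).trans Set.inter_subset_left) (h𝒯.tile S).volume_frontier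

lemma measurableSet (T : 𝒯) : MeasurableSet (T : Set Plane) := (h𝒯.tile T).isCompact.measurableSet

lemma countable : Countable 𝒯 := by
  have : (Set.univ : Set 𝒯).Countable := by
    refine Set.PairwiseDisjoint.countable_of_isOpen (s := fun T : 𝒯 => interior (T : Set Plane)) ?_
      (fun _ _ => isOpen_interior) (fun T _ => (h𝒯.tile T).interior_nonempty)
    intro S _ T _ hST
    rw [Function.onFun, Set.disjoint_left]
    intro x hx hx'
    exact (h𝒯.inter_subset hST ⟨interior_subset hx, interior_subset hx'⟩).1.2 hx
  exact Set.countable_univ_iff.1 this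

lemma sum_volume_inter (F : Finset 𝒯) (B : Set Plane) (hB : MeasurableSet B) :
    ∑ T ∈ F, volume ((T : Set Plane) ∩ B) = volume ((⋃ T ∈ F, (T : Set Plane)) ∩ B) := by
  rw [Set.iUnion₂_inter, measure_biUnion_finset₀]
  · intro S _ T _ hST
    refine measure_mono_null ?_ (h𝒯.volume_inter hST)
    exact Set.inter_subset_inter Set.inter_subset_left Set.inter_subset_left
  · exact fun T _ => ((h𝒯.measurableSet T).inter hB).nullMeasurableSet

/-- Local finiteness is not part of the definition of a tiling. It follows from finite length, as
each tile meeting the disc contributes at least `2 / 5` in a slightly larger disc. -/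
lemma finite_meeting {R : ℝ} (h : tileLength 𝒯 (R + 1) ≠ ∞) :
    {T : 𝒯 | ((T : Set Plane) ∩ Metric.closedBall 0 R).Nonempty}.Finite := by
  refine (ENNReal.finite_const_le_of_tsum_ne_top h (ε := ENNReal.ofReal (2 / 5)) (by simp)).subset ?_
  rintro T ⟨z, hzT, hz⟩
  refine (le_length_frontier_inter_ball (h𝒯.tile T) hzT).trans (measure_mono ?_)
  refine Set.inter_subset_inter_right _ fun x hx => ?_
  rw [Metric.mem_closedBall] at *
  linarith [dist_triangle x z 0]

/-- Only finitely many tiles come near `p`, and those that are closed and avoid `p` avoid a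
neighbourhood of it. -/
lemma eventually_subset_biUnion (hfin : ∀ R, tileLength 𝒯 R ≠ ∞) (p : Plane) (F : Finset 𝒯)
    (hF : ∀ T : 𝒯, p ∈ (T : Set Plane) → T ∈ F) :
    ∀ᶠ x in nhds p, x ∈ ⋃ T ∈ F, (T : Set Plane) := by
  have hG := h𝒯.finite_meeting (hfin (‖p‖ + 1 + 1))
  have h1 : ∀ᶠ x in nhds p, ∀ T ∈ hG.toFinset, p ∉ (T : Set Plane) → x ∉ (T : Set Plane) := by
    rw [Filter.eventually_all_finset]
    intro T _
    by_cases hp : p ∈ (T : Set Plane)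
    · exact Eventually.of_forall fun x h => absurd hp h
    · filter_upwards [(h𝒯.tile T).isCompact.isClosed.isOpen_compl.mem_nhds hp] with x hx _ using hx
  filter_upwards [h1, Metric.closedBall_mem_nhds p one_pos] with x hx hxp
  obtain ⟨T, hT⟩ := h𝒯.exists_mem x
  have hTG : T ∈ hG.toFinset := by
    rw [Set.Finite.mem_toFinset]
    refine ⟨x, hT, ?_⟩
    rw [Metric.mem_closedBall] at *
    have := dist_triangle x p 0
    rw [dist_zero_right p] at this
    linarith
  have hpT : p ∈ (T : Set Plane) := by
    by_contra hp
    exact hx T hTG hp hT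
  simp only [Set.mem_iUnion, exists_prop]
  exact ⟨T, hF T hpT, hT⟩

/-- The angles of the tiles at a point sum to at most `2π`. -/
lemma sum_angle_le {θ : 𝒯 → ℝ} {p : Plane} (F : Finset 𝒯)
    (hθ : ∀ T ∈ F, 0 ≤ θ T ∧ HasAngle T p (θ T)) : ∑ T ∈ F, θ T ≤ 2 * Real.pi := by
  have h1 : ∀ᶠ ε in nhdsWithin (0 : ℝ) (Set.Ioi 0), ∀ T ∈ F,
      volume ((T : Set Plane) ∩ Metric.ball p ε) = ENNReal.ofReal (θ T / 2 * ε ^ 2) := by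
    rw [Filter.eventually_all_finset]
    exact fun T hT => (hθ T hT).2
  obtain ⟨ε, hε, hε0⟩ := (h1.and self_mem_nhdsWithin).exists
  have hε0 : 0 < ε := hε0
  have h2 := h𝒯.sum_volume_inter F (Metric.ball p ε) measurableSet_ball
  rw [Finset.sum_congr rfl hε, ← ENNReal.ofReal_sum_of_nonneg
    (fun T hT => mul_nonneg (div_nonneg (hθ T hT).1 zero_le_two) (sq_nonneg _))] at h2
  have h3 : volume ((⋃ T ∈ F, (T : Set Plane)) ∩ Metric.ball p ε) ≤ ENNReal.ofReal (Real.pi * ε ^ 2) := by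
    rw [← volume_ball' p hε0.le]; exact measure_mono Set.inter_subset_right
  rw [← h2, ENNReal.ofReal_le_ofReal_iff (by positivity), ← Finset.sum_mul, ← Finset.sum_div] at h3
  have := le_of_mul_le_mul_right h3 (by positivity)
  linarith

/-- The angles of all tiles at a point sum to `2π`. -/
lemma sum_angle_eq (hfin : ∀ R, tileLength 𝒯 R ≠ ∞) {θ : 𝒯 → ℝ} {p : Plane} (F : Finset 𝒯)
    (hF : ∀ T : 𝒯, p ∈ (T : Set Plane) → T ∈ F)
    (hθ : ∀ T ∈ F, 0 ≤ θ T ∧ HasAngle T p (θ T)) : ∑ T ∈ F, θ T = 2 * Real.pi := by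
  refine le_antisymm (h𝒯.sum_angle_le F hθ) ?_
  have h1 : ∀ᶠ ε in nhdsWithin (0 : ℝ) (Set.Ioi 0), ∀ T ∈ F,
      volume ((T : Set Plane) ∩ Metric.ball p ε) = ENNReal.ofReal (θ T / 2 * ε ^ 2) := by
    rw [Filter.eventually_all_finset]
    exact fun T hT => (hθ T hT).2
  obtain ⟨δ, hδ, hball⟩ := Metric.eventually_nhds_iff_ball.1 (h𝒯.eventually_subset_biUnion hfin p F hF)
  obtain ⟨ε, hε, hε0, hεδ⟩ := (h1.and (Ioo_mem_nhdsGT hδ)).exists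
  have h2 := h𝒯.sum_volume_inter F (Metric.ball p ε) measurableSet_ball
  rw [Finset.sum_congr rfl hε, ← ENNReal.ofReal_sum_of_nonneg
    (fun T hT => mul_nonneg (div_nonneg (hθ T hT).1 zero_le_two) (sq_nonneg _))] at h2
  have h3 : ENNReal.ofReal (Real.pi * ε ^ 2) ≤ volume ((⋃ T ∈ F, (T : Set Plane)) ∩ Metric.ball p ε) := by
    rw [← volume_ball' p hε0.le]
    exact measure_mono fun x hx => ⟨hball x (Metric.ball_subset_ball hεδ.le hx), hx⟩
  rw [← h2, ENNReal.ofReal_le_ofReal_iff', ← Finset.sum_mul, ← Finset.sum_div] at h3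
  rcases h3 with h3 | h3
  · have := le_of_mul_le_mul_right h3 (by positivity)
    linarith
  · have : 0 < Real.pi * ε ^ 2 := by have := Real.pi_pos; positivity
    linarith

end IsAdmissible

/-! ### Charges at a vertex -/

lemma slopeThree_le_charge (x : ℝ) : slopeThree * (x - 2 * Real.pi / 3) ≤ charge x := le_max_left _ _

lemma slopeFour_le_charge (x : ℝ) : slopeFour * (x - Real.pi / 2) ≤ charge x := le_max_right _ _

/-- A crude bound for vertices where some tile is missing from the count: `charge x` is at least
`slopeFour * x`, as `slopeFour` is nonpositive. -/
lemma sum_charge_ge {ι : Type*} (A : Finset ι) {θ : ι → ℝ} (h : ∑ i ∈ A, θ i ≤ 2 * Real.pi) :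
    slopeFour * (2 * Real.pi) ≤ ∑ i ∈ A, charge (θ i) := by
  have h4 := slopeFour_nonpos
  have hpi := Real.pi_pos
  calc slopeFour * (2 * Real.pi) ≤ slopeFour * ∑ i ∈ A, θ i := mul_le_mul_of_nonpos_left h h4
    _ = ∑ i ∈ A, slopeFour * θ i := Finset.mul_sum _ _ _
    _ ≤ ∑ i ∈ A, charge (θ i) := Finset.sum_le_sum fun i _ => by
      refine le_trans ?_ (slopeFour_le_charge (θ i))
      nlinarith

/-- Angles below `π` with sum `2π` are at least three in number. Exactly three average `2π / 3`,
where the first branch of `charge` vanishes. Four or more, or at least two with sum `π`, average at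
most `π / 2`, where the second branch is nonnegative. -/
lemma sum_charge_nonneg {ι : Type*} (A : Finset ι) {θ : ι → ℝ} (hlt : ∀ i ∈ A, θ i < Real.pi)
    (hne : A.Nonempty) (h : ∑ i ∈ A, θ i = 2 * Real.pi ∨ ∑ i ∈ A, θ i = Real.pi) :
    0 ≤ ∑ i ∈ A, charge (θ i) := by
  have hpi := Real.pi_pos
  have h4 := slopeFour_nonpos
  have hcard : ∑ i ∈ A, θ i < A.card * Real.pi := by
    have := Finset.sum_lt_sum_of_nonempty hne hlt
    simpa using this
  have hfour : slopeFour * (∑ i ∈ A, θ i - A.card * (Real.pi / 2)) ≤ ∑ i ∈ A, charge (θ i) := by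
    calc _ = ∑ i ∈ A, slopeFour * (θ i - Real.pi / 2) := by
          rw [← Finset.mul_sum, Finset.sum_sub_distrib]; simp
      _ ≤ _ := Finset.sum_le_sum fun i _ => slopeFour_le_charge _
  rcases h with h | h
  · rw [h] at hcard hfour
    have h2 : (2 : ℝ) < A.card := lt_of_mul_lt_mul_right hcard hpi.le
    have h3 : 3 ≤ A.card := by exact_mod_cast h2
    rcases Nat.eq_or_lt_of_le h3 with h3 | h3
    · have : slopeThree * (∑ i ∈ A, θ i - A.card * (2 * Real.pi / 3)) ≤ ∑ i ∈ A, charge (θ i) := by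
        calc _ = ∑ i ∈ A, slopeThree * (θ i - 2 * Real.pi / 3) := by
              rw [← Finset.mul_sum, Finset.sum_sub_distrib]; simp
          _ ≤ _ := Finset.sum_le_sum fun i _ => slopeThree_le_charge _
      rw [h, ← h3] at this
      push_cast at this
      have e : slopeThree * (2 * Real.pi - 3 * (2 * Real.pi / 3)) = 0 := by ring
      linarith
    · refine le_trans ?_ hfour
      have h5 : (4 : ℝ) ≤ A.card := by exact_mod_cast h3
      exact mul_nonneg_of_nonpos_of_nonpos h4 (by nlinarith)
  · rw [h] at hcard hfour
    have h1 : (1 : ℝ) < A.card := lt_of_mul_lt_mul_right (by linarith) hpi.le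
    have h2 : 2 ≤ A.card := by exact_mod_cast h1
    refine le_trans ?_ hfour
    have h5 : (2 : ℝ) ≤ A.card := by exact_mod_cast h2
    exact mul_nonneg_of_nonpos_of_nonpos h4 (by nlinarith)

/-- If the tiles at a point outside `A` are not vertex tiles, the charges of `A` are nonnegative. -/
lemma sum_charge_nonneg_of_sum_eq {ι : Type*} [DecidableEq ι] {F A : Finset ι} (hAF : A ⊆ F)
    {θ : ι → ℝ} (hA : ∀ i ∈ A, 0 < θ i ∧ θ i < Real.pi) (hne : A.Nonempty)
    (hrest : ∀ i ∈ F, i ∉ A → θ i = Real.pi ∨ θ i = 2 * Real.pi)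
    (hsum : ∑ i ∈ F, θ i = 2 * Real.pi) : 0 ≤ ∑ i ∈ A, charge (θ i) := by
  have hpi := Real.pi_pos
  have hposA : 0 < ∑ i ∈ A, θ i := Finset.sum_pos (fun i hi => (hA i hi).1) hne
  have hsplit : ∑ i ∈ F \ A, θ i + ∑ i ∈ A, θ i = 2 * Real.pi := by
    rw [← hsum]; exact Finset.sum_sdiff hAF
  refine sum_charge_nonneg A (fun i hi => (hA i hi).2) hne ?_
  have hge : ∀ i ∈ F \ A, Real.pi ≤ θ i := by
    intro i hi
    rw [Finset.mem_sdiff] at hi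
    rcases hrest i hi.1 hi.2 with h | h <;> linarith
  have hcard : ((F \ A).card : ℝ) * Real.pi ≤ ∑ i ∈ F \ A, θ i := by
    have := Finset.card_nsmul_le_sum (F \ A) θ Real.pi hge
    simpa using this
  -- The angles in `A` take a positive share of `2π`, leaving room for at most one flat angle and
  -- for no full one.
  have hc2 : ((F \ A).card : ℝ) < 2 := lt_of_mul_lt_mul_right (by linarith) hpi.le
  have hc : (F \ A).card < 2 := by exact_mod_cast hc2
  have : (F \ A).card = 0 ∨ (F \ A).card = 1 := by omega
  rcases this with h | h
  · left
    rw [Finset.card_eq_zero] at h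
    rw [h, Finset.sum_empty] at hsplit
    linarith
  · right
    obtain ⟨a, ha⟩ := Finset.card_eq_one.1 h
    rw [ha, Finset.sum_singleton] at hsplit
    have haF : a ∈ F \ A := by rw [ha]; simp
    rw [Finset.mem_sdiff] at haF
    rcases hrest a haF.1 haF.2 with h | h
    · linarith
    · linarith

/-! ### Radii crossed by few tiles -/

/-- The closed annulus of width two about the circle of radius `R`. -/
def shell (R : ℝ) : Set Plane := {x | ‖x‖ ∈ Set.Icc (R - 1) (R + 1)}

lemma measurableSet_shell (R : ℝ) : MeasurableSet (shell R) :=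
  (isClosed_Icc.preimage continuous_norm).measurableSet

lemma le_length_frontier_inter_shell {T : Set Plane} (hT : IsUnitConvexPolygonLeFive T) {R : ℝ}
    (h1 : (T ∩ Metric.closedBall 0 R).Nonempty) (h2 : ¬ T ⊆ Metric.closedBall 0 R) :
    ENNReal.ofReal (2 / 5) ≤ length (frontier T ∩ shell R) := by
  obtain ⟨x, hxT, hx⟩ := h1
  obtain ⟨y, hyT, hy⟩ := Set.not_subset.1 h2
  rw [mem_closedBall_zero_iff] at hx hy
  obtain ⟨z, hzT, hz⟩ := hT.convex.isPreconnected.intermediate_value hxT hyT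
    continuous_norm.continuousOn (show R ∈ Set.Icc _ _ from ⟨hx, (not_le.1 hy).le⟩)
  refine (le_length_frontier_inter_ball hT hzT).trans (measure_mono ?_)
  refine Set.inter_subset_inter_right _ fun w hw => ?_
  rw [mem_closedBall_iff_norm] at hw
  have a := norm_sub_norm_le w z
  have b := norm_sub_norm_le z w
  rw [norm_sub_rev] at b
  have hz : ‖z‖ = R := hz
  exact ⟨by linarith, by linarith⟩

/-- Shells of width two around radii spaced by three are disjoint, and the last one ends before `6 *
m`. -/
lemma sum_length_shell_le {T : Set Plane} (m : ℕ) :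
    ∑ j ∈ Finset.range m, length (frontier T ∩ shell (3 * m + 3 * j))
      ≤ length (frontier T ∩ Metric.closedBall 0 (6 * m)) := by
  unfold length
  rw [← measure_biUnion_finset]
  · refine measure_mono ?_
    intro x hx
    simp only [Set.mem_iUnion, Finset.mem_range, exists_prop] at hx
    obtain ⟨j, hj, hxf, -, hx2⟩ := hx
    refine ⟨hxf, ?_⟩
    rw [mem_closedBall_zero_iff]
    have : (j : ℝ) + 1 ≤ m := by exact_mod_cast hj
    linarith
  · intro i _ j _ hij
    rw [Function.onFun, Set.disjoint_left]
    rintro x ⟨-, hx1, hx2⟩ ⟨-, hx3, hx4⟩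
    rcases Nat.lt_or_gt_of_ne hij with h | h
    · have : (i : ℝ) + 1 ≤ j := by exact_mod_cast h
      linarith
    · have : (j : ℝ) + 1 ≤ i := by exact_mod_cast h
      linarith
  · exact fun j _ => isClosed_frontier.measurableSet.inter (measurableSet_shell _)

lemma ofReal_sum_le {ι : Type*} (s : Finset ι) (f : ι → ℝ) :
    ENNReal.ofReal (∑ i ∈ s, f i) ≤ ∑ i ∈ s, ENNReal.ofReal (f i) :=
  Finset.le_sum_of_subadditive _ (by simp) (fun _ _ => ENNReal.ofReal_add_le) _ _

namespace IsAdmissible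

variable {𝒯 : Set (Set Plane)} (h𝒯 : IsAdmissible 𝒯)
include h𝒯

/-- Pigeonhole over `m` disjoint shells inside the disc of radius `6 * m`: the total length is at
most `36 * q * m ^ 2`, so some shell carries `O(m)`. A tile crossing its middle circle uses at least
`2 / 5` of that. -/
lemma exists_few_crossing {q R₀ : ℝ} (hq : 0 ≤ q)
    (hM : ∀ R, R₀ ≤ R → tileLength 𝒯 R ≤ ENNReal.ofReal (q * R ^ 2)) (R₁ : ℝ) :
    ∃ R, R₁ ≤ R ∧ 1 ≤ R ∧ ∀ F : Finset 𝒯,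
      (∀ T ∈ F, ((T : Set Plane) ∩ Metric.closedBall 0 R).Nonempty ∧
        ¬ (T : Set Plane) ⊆ Metric.closedBall 0 R) →
      (F.card : ℝ) ≤ (30 * q + 1) * R := by
  obtain ⟨m, hm⟩ := exists_nat_ge (max (max R₀ R₁) 1)
  have hm0 : R₀ ≤ m := (le_max_left _ _).trans ((le_max_left _ _).trans hm)
  have hm1 : R₁ ≤ m := (le_max_right _ _).trans ((le_max_left _ _).trans hm)
  have hm2 : (1 : ℝ) ≤ m := (le_max_right _ _).trans hm
  set X : ℕ → ℝ≥0∞ := fun j => ∑' T : 𝒯, length (frontier (T : Set Plane) ∩ shell (3 * m + 3 * j)) with hX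
  have hsum : ∑ j ∈ Finset.range m, X j ≤ ENNReal.ofReal (q * (6 * m) ^ 2) := by
    refine le_trans ?_ (hM (6 * m) (by linarith))
    simp only [hX]
    rw [← Summable.tsum_finsetSum (fun _ _ => ENNReal.summable)]
    exact ENNReal.tsum_le_tsum fun T => sum_length_shell_le m
  -- The summand `1` makes the average strictly exceed the total, also when `q = 0`.
  obtain ⟨j, hj, hXj⟩ : ∃ j ∈ Finset.range m, X j ≤ ENNReal.ofReal (36 * q * m + 1) := by
    by_contra h
    push Not at h
    have h1 : ∑ j ∈ Finset.range m, ENNReal.ofReal (36 * q * m + 1) ≤ ∑ j ∈ Finset.range m, X j :=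
      Finset.sum_le_sum fun j hj => (h j hj).le
    have h2 := h1.trans hsum
    rw [← ENNReal.ofReal_sum_of_nonneg (fun _ _ => by positivity),
      ENNReal.ofReal_le_ofReal_iff (by positivity)] at h2
    simp only [Finset.sum_const, Finset.card_range, nsmul_eq_mul] at h2
    nlinarith
  refine ⟨3 * m + 3 * j, ?_, ?_, ?_⟩
  · have : (0 : ℝ) ≤ j := Nat.cast_nonneg j
    linarith
  · have : (0 : ℝ) ≤ j := Nat.cast_nonneg j
    linarith
  · intro F hF
    have h1 : ∑ T ∈ F, ENNReal.ofReal (2 / 5) ≤ X j :=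
      (Finset.sum_le_sum fun T hT => le_length_frontier_inter_shell (h𝒯.tile T) (hF T hT).1
        (hF T hT).2).trans (ENNReal.sum_le_tsum F)
    have h2 := h1.trans hXj
    rw [← ENNReal.ofReal_sum_of_nonneg (fun _ _ => by norm_num),
      ENNReal.ofReal_le_ofReal_iff (by positivity)] at h2
    simp only [Finset.sum_const, nsmul_eq_mul] at h2
    have : (0 : ℝ) ≤ j := Nat.cast_nonneg j
    nlinarith

/-- Regroup the charges by vertex. At a point that is no vertex of a tile in `D`, all vertex angles
belong to `C` and their charges sum to a nonnegative number. The other points number at most five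
per tile in `D` and get the crude bound. -/
lemma sum_charge_ge {V : 𝒯 → Finset Plane} {θ : 𝒯 → Plane → ℝ}
    (hfin : ∀ R, tileLength 𝒯 R ≠ ∞)
    (hV5 : ∀ T, (V T).card ≤ 5) (hVf : ∀ T : 𝒯, (V T : Set Plane) ⊆ frontier (T : Set Plane))
    (hang : ∀ (T : 𝒯), ∀ p ∈ (T : Set Plane), HasAngle T p (θ T p))
    (hVθ : ∀ T, ∀ p ∈ V T, 0 < θ T p ∧ θ T p < Real.pi)
    (hside : ∀ (T : 𝒯), ∀ p ∈ frontier (T : Set Plane), p ∉ V T → θ T p = Real.pi)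
    (hinner : ∀ (T : 𝒯), ∀ p ∈ interior (T : Set Plane), θ T p = 2 * Real.pi)
    {R : ℝ} {C D : Finset 𝒯} (hC : ∀ T ∈ C, (T : Set Plane) ⊆ Metric.closedBall 0 R)
    (hCD : ∀ T : 𝒯, ((T : Set Plane) ∩ Metric.closedBall 0 R).Nonempty → T ∈ C ∨ T ∈ D) :
    5 * D.card * (slopeFour * (2 * Real.pi)) ≤ ∑ T ∈ C, ∑ p ∈ V T, charge (θ T p) := by
  classical
  have hpi := Real.pi_pos
  have h4 := slopeFour_nonpos
  have hVT : ∀ T : 𝒯, ∀ p ∈ V T, p ∈ (T : Set Plane) := fun T p hp =>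
    (h𝒯.tile T).isCompact.isClosed.frontier_subset (hVf T hp)
  have hcases : ∀ (T : 𝒯), ∀ p ∈ (T : Set Plane), p ∉ V T → θ T p = Real.pi ∨ θ T p = 2 * Real.pi := by
    intro T p hp hpV
    by_cases hpi : p ∈ interior (T : Set Plane)
    · exact Or.inr (hinner T p hpi)
    · exact Or.inl (hside T p ⟨subset_closure hp, hpi⟩ hpV)
  have hθ0 : ∀ (T : 𝒯), ∀ p ∈ (T : Set Plane), 0 ≤ θ T p := by
    intro T p hp
    by_cases hpV : p ∈ V T
    · exact (hVθ T p hpV).1.le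
    · rcases hcases T p hp hpV with h | h <;> rw [h] <;> positivity
  set W := C.biUnion V with hW
  set B := D.biUnion V with hB
  have hswap : ∑ T ∈ C, ∑ p ∈ V T, charge (θ T p)
      = ∑ p ∈ W, ∑ T ∈ C.filter (fun T => p ∈ V T), charge (θ T p) := by
    refine Finset.sum_comm' ?_
    intro T p
    simp only [hW, Finset.mem_filter, Finset.mem_biUnion]
    constructor
    · rintro ⟨h1, h2⟩; exact ⟨⟨h1, h2⟩, T, h1, h2⟩
    · rintro ⟨⟨h1, h2⟩, -⟩; exact ⟨h1, h2⟩
  have hpt : ∀ p ∈ W, (if p ∈ B then slopeFour * (2 * Real.pi) else 0)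
      ≤ ∑ T ∈ C.filter (fun T => p ∈ V T), charge (θ T p) := by
    intro p hp
    have hpR : p ∈ Metric.closedBall (0 : Plane) R := by
      obtain ⟨T, hTC, hpT⟩ := Finset.mem_biUnion.1 hp
      exact hC T hTC (hVT T p hpT)
    set A := C.filter (fun T => p ∈ V T) with hA
    split_ifs with hpB
    · refine PentagonalTiling.sum_charge_ge A (h𝒯.sum_angle_le (p := p) A fun T hT => ?_)
      have hpT := hVT T p (Finset.mem_filter.1 hT).2
      exact ⟨hθ0 T p hpT, hang T p hpT⟩
    · set F := (C ∪ D).filter (fun T : 𝒯 => p ∈ (T : Set Plane)) with hF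
      have hFall : ∀ T : 𝒯, p ∈ (T : Set Plane) → T ∈ F := by
        intro T hT
        rw [hF, Finset.mem_filter, Finset.mem_union]
        exact ⟨hCD T ⟨p, hT, hpR⟩, hT⟩
      refine sum_charge_nonneg_of_sum_eq (F := F) (A := A) ?_ ?_ ?_ ?_ ?_
      · intro T hT
        exact hFall T (hVT T p (Finset.mem_filter.1 hT).2)
      · intro T hT; exact hVθ T p (Finset.mem_filter.1 hT).2
      · obtain ⟨T, hTC, hpT⟩ := Finset.mem_biUnion.1 hp
        exact ⟨T, Finset.mem_filter.2 ⟨hTC, hpT⟩⟩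
      · intro T hT hTA
        rw [hF, Finset.mem_filter, Finset.mem_union] at hT
        refine hcases T p hT.2 fun hpV => ?_
        rcases hT.1 with h | h
        · exact hTA (Finset.mem_filter.2 ⟨h, hpV⟩)
        · exact hpB (Finset.mem_biUnion.2 ⟨T, h, hpV⟩)
      · refine h𝒯.sum_angle_eq hfin (θ := fun T => θ T p) F hFall fun T hT => ?_
        have hpT := (Finset.mem_filter.1 hT).2
        exact ⟨hθ0 T p hpT, hang T p hpT⟩
  rw [hswap]
  refine le_trans ?_ (Finset.sum_le_sum hpt)
  rw [← Finset.sum_filter, Finset.sum_const, nsmul_eq_mul]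
  have hcard : ((W.filter (fun p => p ∈ B)).card : ℝ) ≤ 5 * D.card := by
    have h1 : (W.filter (fun p => p ∈ B)).card ≤ B.card :=
      Finset.card_le_card fun p hp => (Finset.mem_filter.1 hp).2
    have h2 : B.card ≤ D.card * 5 := Finset.card_biUnion_le_card_mul D V 5 fun T _ => hV5 T
    have h3 := h1.trans h2
    have : ((W.filter (fun p => p ∈ B)).card : ℝ) ≤ ((D.card * 5 : ℕ) : ℝ) := by exact_mod_cast h3
    push_cast at this
    linarith
  exact mul_le_mul_of_nonpos_right hcard (mul_nonpos_of_nonpos_of_nonneg h4 (by positivity))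

/-- Lower bound for the tile by tile length in a disc crossed by the tiles in `D`. -/
lemma le_tileLength (hfin : ∀ R, tileLength 𝒯 R ≠ ∞) {R : ℝ} (hR : 0 ≤ R) {C D : Finset 𝒯}
    (hC : ∀ T ∈ C, (T : Set Plane) ⊆ Metric.closedBall 0 R)
    (hCD : ∀ T : 𝒯, ((T : Set Plane) ∩ Metric.closedBall 0 R).Nonempty → T ∈ C ∨ T ∈ D) :
    ENNReal.ofReal (2 * cc * (Real.pi * R ^ 2)
      - (2 * cc + 5 * (-slopeFour * (2 * Real.pi))) * D.card) ≤ tileLength 𝒯 R := by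
  classical
  choose V θ hV5 hVf hang hVθ hside hinner hper using fun T : 𝒯 => exists_tile_data (h𝒯.tile T)
  have hcharge := h𝒯.sum_charge_ge hfin hV5 hVf hang hVθ hside hinner hC hCD
  have harea : Real.pi * R ^ 2 ≤ C.card + D.card := by
    have h1 : Metric.closedBall (0 : Plane) R ⊆ ⋃ T ∈ C ∪ D, (T : Set Plane) := by
      intro x hx
      obtain ⟨T, hT⟩ := h𝒯.exists_mem x
      simp only [Set.mem_iUnion, exists_prop, Finset.mem_union]
      exact ⟨T, hCD T ⟨x, hT, hx⟩, hT⟩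
    have h2 := (measure_mono (μ := volume) h1).trans (measure_biUnion_finset_le _ _)
    rw [volume_closedBall' 0 hR, Finset.sum_congr rfl fun T _ => (h𝒯.tile T).2] at h2
    simp only [Finset.sum_const, nsmul_eq_mul, mul_one] at h2
    have h3 : ((C ∪ D).card : ℝ≥0∞) ≤ ((C.card + D.card : ℕ) : ℝ≥0∞) := by
      exact_mod_cast Finset.card_union_le C D
    have h4 := h2.trans h3
    rw [← ENNReal.ofReal_natCast, ENNReal.ofReal_le_ofReal_iff (by positivity)] at h4
    exact_mod_cast h4
  have hcc := one_le_cc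
  calc ENNReal.ofReal (2 * cc * (Real.pi * R ^ 2)
        - (2 * cc + 5 * (-slopeFour * (2 * Real.pi))) * D.card)
      ≤ ENNReal.ofReal (∑ T ∈ C, (2 * cc + ∑ p ∈ V T, charge (θ T p))) := by
        apply ENNReal.ofReal_le_ofReal
        rw [Finset.sum_add_distrib, Finset.sum_const, nsmul_eq_mul]
        nlinarith
    _ ≤ ∑ T ∈ C, ENNReal.ofReal (2 * cc + ∑ p ∈ V T, charge (θ T p)) := ofReal_sum_le _ _
    _ ≤ ∑ T ∈ C, length (frontier (T : Set Plane) ∩ Metric.closedBall 0 R) := by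
        refine Finset.sum_le_sum fun T hT => (hper T).trans (le_of_eq ?_)
        rw [perimeter, Set.inter_eq_self_of_subset_left
          ((h𝒯.tile T).isCompact.isClosed.frontier_subset.trans (hC T hT))]
    _ ≤ tileLength 𝒯 R := ENNReal.sum_le_tsum C

/-- A smaller upper limit gives length at most `q * π * R ^ 2` with `q < 2 * cc` for all large `R`.
At a radius crossed by `O(R)` tiles, the linear error cannot absorb the quadratic gap. -/
theorem le_tilePerimeterRatio : ENNReal.ofReal (2 * cc) ≤ tilePerimeterRatio 𝒯 := by
  classical
  by_contra hlt
  push Not at hlt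
  have hcc := one_le_cc
  have hpi := Real.pi_pos
  obtain ⟨q, hq0, hq1, hq2⟩ := ENNReal.lt_iff_exists_real_btwn.1 hlt
  have hq2 : q < 2 * cc := (ENNReal.ofReal_lt_ofReal_iff (by linarith)).1 hq2
  have hev := eventually_lt_of_limsup_lt hq1
  obtain ⟨R₀, hR₀⟩ := Filter.eventually_atTop.1 hev
  have hM : ∀ R, max R₀ 1 ≤ R → tileLength 𝒯 R ≤ ENNReal.ofReal (q * Real.pi * R ^ 2) := by
    intro R hR
    have hR1 : 1 ≤ R := (le_max_right _ _).trans hR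
    have h1 := (hR₀ R ((le_max_left _ _).trans hR)).le
    have hpos : 0 < Real.pi * R ^ 2 := by positivity
    rw [ENNReal.div_le_iff (by simpa using hpos) ENNReal.ofReal_ne_top,
      ← ENNReal.ofReal_mul hq0, ← mul_assoc] at h1
    exact h1
  have hfin : ∀ R, tileLength 𝒯 R ≠ ∞ := by
    intro R
    refine ne_top_of_le_ne_top ?_ (tileLength_mono 𝒯 (le_max_left R (max R₀ 1)))
    exact ne_top_of_le_ne_top ENNReal.ofReal_ne_top (hM _ (le_max_right _ _))
  set K := (2 * cc + 5 * (-slopeFour * (2 * Real.pi))) with hK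
  have hK0 : 0 ≤ K := by
    have := slopeFour_nonpos
    have : 0 ≤ -slopeFour * (2 * Real.pi) := mul_nonneg (by linarith) (by linarith)
    linarith
  set E := 30 * (q * Real.pi) + 1 with hE
  -- The threshold is where the quadratic gap `(2 * cc - q) * π * R ^ 2` overtakes the crossing
  -- error `K * E * R`.
  obtain ⟨R, hR1, hR2, hcross⟩ := h𝒯.exists_few_crossing (q := q * Real.pi) (by positivity) hM
    (max (max R₀ 1) (K * E / ((2 * cc - q) * Real.pi) + 1))
  have hmeet := h𝒯.finite_meeting (hfin (R + 1))
  set C := hmeet.toFinset.filter (fun T : 𝒯 => (T : Set Plane) ⊆ Metric.closedBall 0 R) with hCd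
  set D := hmeet.toFinset.filter (fun T : 𝒯 => ¬ (T : Set Plane) ⊆ Metric.closedBall 0 R) with hDd
  have h1 := h𝒯.le_tileLength hfin (R := R) (by linarith) (C := C) (D := D)
    (fun T hT => (Finset.mem_filter.1 hT).2) (fun T hT => by
      have : T ∈ hmeet.toFinset := by rw [Set.Finite.mem_toFinset]; exact hT
      by_cases h : (T : Set Plane) ⊆ Metric.closedBall 0 R
      · exact Or.inl (Finset.mem_filter.2 ⟨this, h⟩)
      · exact Or.inr (Finset.mem_filter.2 ⟨this, h⟩))
  have h2 := h1.trans (hM R ((le_max_left _ _).trans hR1))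
  rw [ENNReal.ofReal_le_ofReal_iff (by positivity), ← hK] at h2
  have h3 := hcross D (fun T hT => by
    rw [hDd, Finset.mem_filter, Set.Finite.mem_toFinset] at hT
    exact hT)
  have h4 : K * E / ((2 * cc - q) * Real.pi) + 1 ≤ R := (le_max_right _ _).trans hR1
  have h5 : 0 < (2 * cc - q) * Real.pi := mul_pos (by linarith) hpi
  have h6 : K * E < (2 * cc - q) * Real.pi * R := by
    have : K * E / ((2 * cc - q) * Real.pi) < R := by linarith
    rw [div_lt_iff₀ h5] at this
    linarith
  have h7 : K * D.card ≤ K * (E * R) := mul_le_mul_of_nonneg_left h3 hK0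
  nlinarith

end IsAdmissible

/-! ### Multiplicity of the boundary -/

/-- Length of the union of the tile boundaries in the disc of radius `R`. -/
def unionLength (𝒯 : Set (Set Plane)) (R : ℝ) : ℝ≥0∞ :=
  length ((⋃ T ∈ 𝒯, frontier T) ∩ Metric.closedBall 0 R)

lemma ofReal_two_mul_cc : ENNReal.ofReal (2 * cc) = 2 * ENNReal.ofReal cc := by
  rw [ENNReal.ofReal_mul zero_le_two]; simp

namespace IsAdmissible

variable {𝒯 : Set (Set Plane)} (h𝒯 : IsAdmissible 𝒯)
include h𝒯

lemma tileLength_eq_lintegral (R : ℝ) : tileLength 𝒯 R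
    = ∫⁻ x in Metric.closedBall 0 R, ∑' T : 𝒯, (frontier (T : Set Plane)).indicator 1 x
      ∂(Measure.hausdorffMeasure (1 : ℝ)) := by
  have := h𝒯.countable
  rw [lintegral_tsum fun T => (measurable_one.indicator isClosed_frontier.measurableSet).aemeasurable]
  refine tsum_congr fun T => ?_
  rw [lintegral_indicator_one isClosed_frontier.measurableSet,
    Measure.restrict_apply isClosed_frontier.measurableSet]
  rfl

lemma measurableSet_union : MeasurableSet (⋃ T ∈ 𝒯, frontier T) := by
  have := h𝒯.countable
  exact MeasurableSet.biUnion (Set.countable_coe_iff.1 this) fun T _ => isClosed_frontier.measurableSet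

lemma two_mul_unionLength_eq_lintegral (R : ℝ) : 2 * unionLength 𝒯 R
    = ∫⁻ x in Metric.closedBall 0 R, 2 * (⋃ T ∈ 𝒯, frontier T).indicator 1 x
      ∂(Measure.hausdorffMeasure (1 : ℝ)) := by
  rw [lintegral_const_mul _ (measurable_one.indicator h𝒯.measurableSet_union),
    lintegral_indicator_one h𝒯.measurableSet_union, Measure.restrict_apply h𝒯.measurableSet_union]
  rfl

/-- The vertices of all tiles form a countable set, hence one of length zero. At any other boundary
point each tile with the point on its boundary has angle `π`, so there are at most two. -/
lemma tileLength_le (R : ℝ) : tileLength 𝒯 R ≤ 2 * unionLength 𝒯 R := by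
  classical
  have hcount := h𝒯.countable
  choose V θ hV5 hVf hang hVθ hside hinner hper using fun T : 𝒯 => exists_tile_data (h𝒯.tile T)
  rw [h𝒯.tileLength_eq_lintegral, h𝒯.two_mul_unionLength_eq_lintegral]
  have hnull : Measure.hausdorffMeasure (1 : ℝ) (⋃ T : 𝒯, (V T : Set Plane)) = 0 := by
    have := Measure.nullSingletonClass_hausdorff Plane (d := 1) one_pos
    exact (Set.countable_iUnion fun T => (V T).countable_toSet).measure_zero _
  refine lintegral_mono_ae (ae_restrict_of_ae ?_)
  filter_upwards [measure_eq_zero_iff_ae_notMem.1 hnull] with x hx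
  have hxV : ∀ T : 𝒯, x ∉ V T := fun T h => hx (Set.mem_iUnion.2 ⟨T, h⟩)
  by_cases hU : x ∈ ⋃ T ∈ 𝒯, frontier T
  · rw [Set.indicator_of_mem hU, ENNReal.tsum_eq_iSup_sum]
    refine iSup_le fun F => ?_
    have e : ∑ T ∈ F, (frontier (T : Set Plane)).indicator (1 : Plane → ℝ≥0∞) x
        = (F.filter fun T : 𝒯 => x ∈ frontier (T : Set Plane)).card := by
      rw [Finset.card_filter]
      push_cast
      exact Finset.sum_congr rfl fun T _ => by simp [Set.indicator_apply]
    rw [e]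
    have h1 := h𝒯.sum_angle_le (θ := fun _ => Real.pi) (p := x)
      (F.filter fun T : 𝒯 => x ∈ frontier (T : Set Plane)) (fun T hT => by
        have hxf := (Finset.mem_filter.1 hT).2
        refine ⟨Real.pi_pos.le, ?_⟩
        rw [← hside T x hxf (hxV T)]
        exact hang T x ((h𝒯.tile T).isCompact.isClosed.frontier_subset hxf))
    simp only [Finset.sum_const, nsmul_eq_mul] at h1
    have h2 := le_of_mul_le_mul_right h1 Real.pi_pos
    have h3 : (F.filter fun T : 𝒯 => x ∈ frontier (T : Set Plane)).card ≤ 2 := by exact_mod_cast h2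
    simp only [Pi.one_apply, mul_one]
    exact_mod_cast h3
  · rw [Set.indicator_of_notMem hU, mul_zero]
    refine le_of_eq (ENNReal.tsum_eq_zero.2 fun T => Set.indicator_of_notMem (fun h => hU ?_) _)
    exact Set.mem_biUnion T.2 h

/-- A boundary point lies in a second tile, for otherwise local finiteness would make it interior to
the first. Two tiles meet only along their boundaries, so the point is counted at least twice. -/
lemma two_mul_unionLength_le (hfin : ∀ R, tileLength 𝒯 R ≠ ∞) (R : ℝ) :
    2 * unionLength 𝒯 R ≤ tileLength 𝒯 R := by
  classical
  rw [h𝒯.tileLength_eq_lintegral, h𝒯.two_mul_unionLength_eq_lintegral]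
  refine lintegral_mono fun x => ?_
  by_cases hU : x ∈ ⋃ T ∈ 𝒯, frontier T
  · rw [Set.indicator_of_mem hU]
    simp only [Set.mem_iUnion, exists_prop] at hU
    obtain ⟨T, hT, hxT⟩ := hU
    obtain ⟨S, hST, hxS⟩ : ∃ S : 𝒯, S ≠ ⟨T, hT⟩ ∧ x ∈ (S : Set Plane) := by
      by_contra hcon
      push Not at hcon
      have h1 := h𝒯.eventually_subset_biUnion hfin x {⟨T, hT⟩} (fun S hS => by
        rw [Finset.mem_singleton]
        by_contra hne
        exact hcon S hne hS)
      refine hxT.2 (mem_interior_iff_mem_nhds.2 ?_)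
      filter_upwards [h1] with y hy
      simpa using hy
    have hx2 := h𝒯.inter_subset hST ⟨hxS, (h𝒯.2 T hT).isCompact.isClosed.frontier_subset hxT⟩
    refine le_trans ?_ (ENNReal.sum_le_tsum {S, ⟨T, hT⟩})
    rw [Finset.sum_pair hST, Set.indicator_of_mem hx2.1, Set.indicator_of_mem hx2.2]
    simp only [Pi.one_apply]
    norm_num
  · rw [Set.indicator_of_notMem hU, mul_zero]
    exact zero_le

lemma tilePerimeterRatio_le : tilePerimeterRatio 𝒯 ≤ 2 * perimeterRatio 𝒯 := by
  rw [tilePerimeterRatio, perimeterRatio, ← ENNReal.limsup_const_mul_of_ne_top ENNReal.ofNat_ne_top]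
  refine limsup_le_limsup (Eventually.of_forall fun R => ?_)
  beta_reduce
  rw [← mul_div_assoc]
  exact ENNReal.div_le_div_right (h𝒯.tileLength_le R) _

lemma two_mul_perimeterRatio_le (hfin : ∀ R, tileLength 𝒯 R ≠ ∞) :
    2 * perimeterRatio 𝒯 ≤ tilePerimeterRatio 𝒯 := by
  rw [tilePerimeterRatio, perimeterRatio, ← ENNReal.limsup_const_mul_of_ne_top ENNReal.ofNat_ne_top]
  refine limsup_le_limsup (Eventually.of_forall fun R => ?_)
  beta_reduce
  rw [← mul_div_assoc]
  exact ENNReal.div_le_div_right (h𝒯.two_mul_unionLength_le hfin R) _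

theorem le_perimeterRatio : ENNReal.ofReal cc ≤ perimeterRatio 𝒯 := by
  have h := h𝒯.le_tilePerimeterRatio.trans h𝒯.tilePerimeterRatio_le
  rw [ofReal_two_mul_cc] at h
  exact (ENNReal.mul_le_mul_iff_right two_ne_zero ENNReal.ofNat_ne_top).1 h

/-! ### Tilings by tiles of perimeter `2 * cc` and bounded diameter -/

/-- A tile meeting the disc lies in the disc enlarged by `d`, and unit area allows its perimeter to
be written as `2 * cc` times its area; the areas add up to at most that of the larger disc. -/
lemma tileLength_le_of_perimeter {d : ℝ}
    (hper : ∀ T ∈ 𝒯, perimeter T = ENNReal.ofReal (2 * cc))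
    (hdiam : ∀ T ∈ 𝒯, ∀ x ∈ T, ∀ y ∈ T, dist x y ≤ d) (R : ℝ) :
    tileLength 𝒯 R ≤ ENNReal.ofReal (2 * cc) * volume (Metric.closedBall (0 : Plane) (R + d)) := by
  have h1 : ∀ T : 𝒯, length (frontier (T : Set Plane) ∩ Metric.closedBall 0 R)
      ≤ ENNReal.ofReal (2 * cc) * volume ((T : Set Plane) ∩ Metric.closedBall 0 (R + d)) := by
    intro T
    by_cases hne : ((T : Set Plane) ∩ Metric.closedBall 0 R).Nonempty
    · obtain ⟨x, hxT, hx⟩ := hne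
      have hsub : (T : Set Plane) ⊆ Metric.closedBall 0 (R + d) := by
        intro y hy
        rw [Metric.mem_closedBall] at *
        linarith [dist_triangle y x 0, hdiam T T.2 y hy x hxT]
      rw [Set.inter_eq_self_of_subset_left hsub, (h𝒯.tile T).2, mul_one, ← hper T T.2]
      exact measure_mono Set.inter_subset_left
    · have : frontier (T : Set Plane) ∩ Metric.closedBall 0 R = ∅ := by
        rw [Set.not_nonempty_iff_eq_empty] at hne
        refine Set.subset_eq_empty (Set.inter_subset_inter_left _ ?_) hne
        exact (h𝒯.tile T).isCompact.isClosed.frontier_subset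
      rw [this]; simp [length]
  refine (ENNReal.tsum_le_tsum h1).trans ?_
  rw [ENNReal.tsum_mul_left]
  refine mul_le_mul_right ?_ _
  rw [ENNReal.tsum_eq_iSup_sum]
  refine iSup_le fun F => ?_
  rw [h𝒯.sum_volume_inter F _ measurableSet_closedBall]
  exact measure_mono Set.inter_subset_right

lemma tilePerimeterRatio_le_of_perimeter {d : ℝ} (hd : 0 ≤ d)
    (hper : ∀ T ∈ 𝒯, perimeter T = ENNReal.ofReal (2 * cc))
    (hdiam : ∀ T ∈ 𝒯, ∀ x ∈ T, ∀ y ∈ T, dist x y ≤ d) :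
    tilePerimeterRatio 𝒯 ≤ ENNReal.ofReal (2 * cc) := by
  have hcc := one_le_cc
  have hlim : Tendsto (fun R : ℝ => ENNReal.ofReal (2 * cc * (1 + d / R) ^ 2)) atTop
      (nhds (ENNReal.ofReal (2 * cc))) := by
    refine ENNReal.tendsto_ofReal ?_
    have h1 : Tendsto (fun R : ℝ => d / R) atTop (nhds 0) := tendsto_const_nhds.div_atTop tendsto_id
    have h2 := ((h1.const_add 1).pow 2).const_mul (2 * cc)
    simpa using h2
  rw [← hlim.limsup_eq]
  refine limsup_le_limsup ?_
  filter_upwards [eventually_gt_atTop 0] with R hR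
  have hpos : 0 < Real.pi * R ^ 2 := by have := Real.pi_pos; positivity
  rw [ENNReal.div_le_iff (by simpa using hpos) ENNReal.ofReal_ne_top,
    ← ENNReal.ofReal_mul (by positivity)]
  refine (h𝒯.tileLength_le_of_perimeter hper hdiam R).trans (le_of_eq ?_)
  rw [volume_closedBall' _ (by linarith), ← ENNReal.ofReal_mul (by linarith)]
  congr 1
  field_simp

end IsAdmissible

/-! ### Circumscribed polygons -/

lemma eq_zero_of_cross_eq_zero {s t z : Plane} (hst : cross s t ≠ 0) (h1 : cross z s = 0)
    (h2 : cross z t = 0) : z = 0 := by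
  have h : cross s t • z = cross z t • s - cross z s • t := by
    apply plane_ext <;>
    · simp only [PiLp.sub_apply, PiLp.smul_apply, smul_eq_mul, cross]; ring
  rw [h1, h2, zero_smul, zero_smul, sub_zero] at h
  exact (smul_eq_zero.1 h).resolve_left hst

lemma abs_cross_le (u w : Plane) : |cross u w| ≤ ‖u‖ * ‖w‖ := by
  rw [← abs_of_nonneg (mul_nonneg (norm_nonneg u) (norm_nonneg w)), ← sq_le_sq, mul_pow, norm_sq_eq,
    norm_sq_eq, cross]
  nlinarith [sq_nonneg (u 0 * w 0 + u 1 * w 1)]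

namespace CcwPolygon

variable {n : ℕ} {v : ℕ → Plane} (hP : CcwPolygon n v)
include hP

/-- The contact point shows that the centre is at distance at most `r` from the side line; the point
of the disc farthest along the outer normal shows at least `r`. -/
lemma edge_incenter {c : Plane} {r : ℝ} (hr : 0 < r)
    (hball : Metric.closedBall c r ⊆ convexHull ℝ (Set.range v))
    (htouch : ∀ i < n, (Metric.sphere c r ∩ segment ℝ (v i) (v (i + 1))).Nonempty) (i : ℕ) (hi : i < n) :
    edge v i c = r * dist (v i) (v (i + 1)) := by
  have hn := hP.norm_dir i
  apply le_antisymm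
  · obtain ⟨x, hx, hxs⟩ := htouch i hi
    have h0 := edge_eq_zero_of_mem_segment hxs
    have h1 : edge v i c = edge v i x + cross (v (i + 1) - v i) (c - x) := by
      simp only [edge, orient_def, cross, PiLp.sub_apply]; ring
    rw [h1, h0, zero_add]
    have h2 := (le_abs_self _).trans (abs_cross_le (v (i + 1) - v i) (c - x))
    rw [← dist_eq_norm, ← dist_eq_norm, dist_comm c x, Metric.mem_sphere.1 hx, dist_comm] at h2
    linarith
  · have hmem : c + r • normal (dir v i) ∈ Metric.closedBall c r := by
      rw [mem_closedBall_iff_norm, add_sub_cancel_left, norm_smul, Real.norm_of_nonneg hr.le]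
      have : ‖normal (dir v i)‖ ^ 2 = 1 := by
        rw [norm_sq_eq, normal_zero, normal_one]; linarith [unit_sq hn]
      have : ‖normal (dir v i)‖ = 1 := by
        have h0 := norm_nonneg (normal (dir v i))
        nlinarith
      rw [this, mul_one]
    have h1 := hP.edge_nonneg i (hball hmem)
    have h2 : edge v i (c + r • normal (dir v i))
        = edge v i c + r * cross (v (i + 1) - v i) (normal (dir v i)) := by
      simp only [edge, orient_def, cross, PiLp.add_apply, PiLp.smul_apply, smul_eq_mul, PiLp.sub_apply]
      ring
    rw [h2, ← hP.dist_smul_dir, cross_smul_left, cross_normal_right, real_inner_self_eq_norm_sq, hn] at h1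
    linarith

/-- Perimeter of a unit area polygon circumscribed about a circle. -/
theorem sum_dist_of_circumscribed {c : Plane} {r : ℝ} (hr : 0 < r)
    (hvol : volume (convexHull ℝ (Set.range v)) = 1)
    (hball : Metric.closedBall c r ⊆ convexHull ℝ (Set.range v))
    (htouch : ∀ i < n, (Metric.sphere c r ∩ segment ℝ (v i) (v (i + 1))).Nonempty) :
    ∑ i ∈ Finset.range n, dist (v i) (v (i + 1)) = 2 * Real.sqrt (∑ i ∈ Finset.range n,
      Real.cot (EuclideanGeometry.angle (v i) (v (i + 1)) (v (i + 2)) / 2)) := by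
  have hn3 := hP.three_le
  have harea : ∑ i ∈ Finset.range n, orient c (v i) (v (i + 1)) = 2 := by
    have := hP.volume_hull c
    rw [hvol] at this
    have := ENNReal.ofReal_eq_one.1 this.symm
    linarith
  have hedge' : ∀ i, edge v i c = r * dist (v i) (v (i + 1)) := by
    intro i
    have h := hP.edge_incenter hr hball htouch (i % n) (Nat.mod_lt _ (by omega))
    have e : v (i % n + 1) = v (i + 1) := by
      rw [← hP.map_mod (i % n + 1), Nat.mod_add_mod, hP.map_mod]
    rwa [edge, e, hP.map_mod] at h
  -- Triangles from the incentre have height `r`, so the area is half of `r` times the perimeter.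
  have hL : r * ∑ i ∈ Finset.range n, dist (v i) (v (i + 1)) = 2 := by
    rw [← harea, Finset.mul_sum]
    refine Finset.sum_congr rfl fun i _ => ?_
    rw [← hedge', edge, orient_rotate, orient_rotate]
  -- A vertex is determined by its signed distances from the directions of its two sides, and these
  -- are `r` on both.
  have hpt : ∀ i, v (i + 1) - c = r • tangentPoint v i := by
    intro i
    rw [← sub_eq_zero]
    have a : dist (v i) (v (i + 1)) * cross (v (i + 1) - c) (dir v i) = edge v i c := by
      rw [← cross_smul_right, hP.dist_smul_dir]
      simp only [edge, orient_def, cross, PiLp.sub_apply]; ring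
    have b : dist (v (i + 1)) (v (i + 1 + 1)) * cross (v (i + 1) - c) (dir v (i + 1))
        = edge v (i + 1) c := by
      rw [← cross_smul_right, hP.dist_smul_dir]
      simp only [edge, orient_def, cross, PiLp.sub_apply]; ring
    rw [hedge', mul_comm] at a b
    have a' := mul_right_cancel₀ (hP.dist_pos i).ne' a
    have b' := mul_right_cancel₀ (hP.dist_pos (i + 1)).ne' b
    refine eq_zero_of_cross_eq_zero (hP.cross_dir_succ_pos i).ne' ?_ ?_
    · rw [cross_sub_left, cross_smul_left, hP.cross_tangentPoint_left, a']; ring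
    · rw [cross_sub_left, cross_smul_left, hP.cross_tangentPoint_right, b']; ring
  set K := ∑ i ∈ Finset.range n, Real.cot (EuclideanGeometry.angle (v i) (v (i + 1)) (v (i + 2)) / 2)
  set L := ∑ i ∈ Finset.range n, dist (v i) (v (i + 1))
  have hK : r ^ 2 * K = 1 := by
    have h1 := hP.sum_cross_vertices c
    rw [harea] at h1
    have h2 : ∑ i ∈ Finset.range n, cross (v (i + 1) - c) (v (i + 2) - c)
        = r ^ 2 * (2 * K) := by
      rw [← hP.sum_cross_tangentPoint, Finset.mul_sum]
      refine Finset.sum_congr rfl fun i _ => ?_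
      rw [hpt i, hpt (i + 1), cross_smul_left, cross_smul_right]; ring
    rw [h2] at h1
    linarith
  have hsq : Real.sqrt K = 1 / r := by
    rw [Real.sqrt_eq_iff_mul_self_eq_of_pos (by positivity)]
    field_simp
    linarith
  rw [hsq]
  field_simp
  linarith

end CcwPolygon

/-! ### Convex pentagons given by cyclic lists of vertices -/

/-- A supporting functional at the midpoint of the side is constant along the side, because the
midpoint is already a maximum. It is therefore a multiple of the orientation with respect to the
side. -/
lemma orient_one_sided {P : Set Plane} (hP : Convex ℝ P) (hinner : (interior P).Nonempty) {p q : Plane}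
    (hpP : p ∈ P) (hqP : q ∈ P) (hpq : p ≠ q) (hs : segment ℝ p q ⊆ frontier P) :
    (∀ x ∈ P, 0 ≤ orient p q x) ∨ ∀ x ∈ P, orient p q x ≤ 0 := by
  have hm : (1 / 2 : ℝ) • p + (1 / 2 : ℝ) • q ∈ frontier P :=
    hs ⟨1 / 2, 1 / 2, by norm_num, by norm_num, by norm_num, rfl⟩
  obtain ⟨f, hf⟩ := geometric_hahn_banach_open_point hP.interior isOpen_interior hm.2
  set m := (1 / 2 : ℝ) • p + (1 / 2 : ℝ) • q with hmdef
  have hle : ∀ x ∈ P, f x ≤ f m := by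
    intro x hx
    have h1 : x ∈ closure (interior P) := by
      rw [hP.closure_interior_eq_closure_of_nonempty_interior hinner]
      exact subset_closure hx
    exact closure_minimal (fun y hy => (hf y hy).le) (isClosed_le f.continuous continuous_const) h1
  have hfm : f m = (1 / 2) * f p + (1 / 2) * f q := by simp [hmdef]
  have hp := hle p hpP
  have hq := hle q hqP
  have hd : f (q - p) = 0 := by rw [map_sub]; linarith
  have hmp : f m = f p := by rw [map_sub] at hd; linarith
  have hcoord : ∀ x : Plane, f x = x 0 * f (EuclideanSpace.single 0 1)
      + x 1 * f (EuclideanSpace.single 1 1) := by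
    intro x
    have : x = x 0 • EuclideanSpace.single 0 1 + x 1 • EuclideanSpace.single 1 1 := by
      apply plane_ext <;> simp
    conv_lhs => rw [this]
    simp
  set a := f (EuclideanSpace.single 0 1)
  set b := f (EuclideanSpace.single 1 1)
  have hkey : ∀ x, ‖q - p‖ ^ 2 * (f x - f m) = (b * (q - p) 0 - a * (q - p) 1) * orient p q x := by
    intro x
    rw [hmp, ← map_sub, norm_sq_eq]
    rw [hcoord] at hd ⊢
    simp only [orient, cross, PiLp.sub_apply] at hd ⊢
    linear_combination ((x 0 - p 0) * (q 0 - p 0) + (x 1 - p 1) * (q 1 - p 1)) * hd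
  have hpos : 0 < ‖q - p‖ ^ 2 := by
    have := norm_pos_iff.2 (sub_ne_zero.2 hpq.symm)
    positivity
  rcases lt_trichotomy (b * (q - p) 0 - a * (q - p) 1) 0 with h | h | h
  · left
    intro x hx
    by_contra! hneg
    have h1 := hkey x
    have h2 := hle x hx
    nlinarith [mul_pos_of_neg_of_neg h hneg]
  · exfalso
    obtain ⟨y, hy⟩ := hinner
    have h1 := hkey y
    have h2 := hf y hy
    rw [h, zero_mul] at h1
    nlinarith
  · right
    intro x hx
    by_contra! hneg
    have h1 := hkey x
    have h2 := hle x hx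
    nlinarith [mul_pos h hneg]

lemma mem_segment_of_orient_eq_zero {p q x : Plane} (hpq : p ≠ q) (h : orient p q x = 0) :
    x ∈ segment ℝ p q ∨ p ∈ segment ℝ q x ∨ q ∈ segment ℝ x p := by
  have hpos : 0 < ‖q - p‖ ^ 2 := by
    have := norm_pos_iff.2 (sub_ne_zero.2 hpq.symm)
    positivity
  have hcol : Collinear ℝ {p, q, x} := by
    rw [collinear_iff_of_mem (p₀ := p) (by simp)]
    refine ⟨q - p, ?_⟩
    rintro y (rfl | rfl | rfl)
    · exact ⟨0, by simp⟩
    · exact ⟨1, by simp⟩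
    · refine ⟨((q 0 - p 0) * (y 0 - p 0) + (q 1 - p 1) * (y 1 - p 1)) / ‖q - p‖ ^ 2, ?_⟩
      rw [orient_def] at h
      have e : ‖q - p‖ ^ 2 = (q 0 - p 0) ^ 2 + (q 1 - p 1) ^ 2 := by
        rw [norm_sq_eq]; simp only [PiLp.sub_apply]
      rw [e] at hpos ⊢
      apply plane_ext <;>
      · simp only [vadd_eq_add, PiLp.add_apply, PiLp.smul_apply, PiLp.sub_apply, smul_eq_mul]
        rw [div_mul_eq_mul_div, ← sub_eq_iff_eq_add, eq_div_iff hpos.ne']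
        first
          | linear_combination (q 1 - p 1) * h
          | linear_combination -(q 1 - p 1) * h
          | linear_combination (q 0 - p 0) * h
  rcases hcol.wbtw_or_wbtw_or_wbtw with h | h | h
  · exact Or.inr (Or.inr ((segment_symm ℝ x p) ▸ mem_segment_iff_wbtw.2 h))
  · exact Or.inl (mem_segment_iff_wbtw.2 h.symm)
  · exact Or.inr (Or.inl ((segment_symm ℝ q x) ▸ mem_segment_iff_wbtw.2 h))

lemma _root_.ConvexIndependent.orient_ne_zero {ι : Type*} {v : ι → Plane} (hv : ConvexIndependent ℝ v)
    {i j k : ι} (hij : i ≠ j) (hik : i ≠ k) (hjk : j ≠ k) : orient (v i) (v j) (v k) ≠ 0 := by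
  have key : ∀ {a b c : ι}, a ≠ b → a ≠ c → v a ∉ segment ℝ (v b) (v c) := by
    intro a b c hab hac h
    have := hv {b, c} a (by rwa [Set.image_pair, convexHull_pair])
    simp_all
  intro h
  rcases mem_segment_of_orient_eq_zero (fun e => hij (hv.injective e)) h with h | h | h
  · exact key hik.symm hjk.symm h
  · exact key hij hik h
  · exact key hjk hij.symm h

section

open Fin.NatCast Fin.CommRing

/-- Any three of five cyclic indices include two that are adjacent, so every orientation is that of
a side and a vertex. The only increasing triple without consecutive entries is `0, 2, 4`, where `4`
and `0` are adjacent. -/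
lemma ccwPolygon_of_edges {v : Fin 5 → Plane}
    (h : ∀ i j, j ≠ i → j ≠ i + 1 → 0 < orient (v i) (v (i + 1)) (v j)) :
    CcwPolygon 5 fun j : ℕ => v (j : Fin 5) := by
  have hr : ∀ i j, j ≠ i → j ≠ i + 1 → 0 < orient (v j) (v i) (v (i + 1)) := by
    intro i j h1 h2
    rw [orient_rotate]
    exact h i j h1 h2
  refine CcwPolygon.of_lt (by norm_num) (fun i => by simp) ?_
  intro i j k hij hjk hk
  have hcase : j = i + 1 ∨ k = j + 1 ∨ (i = 0 ∧ j = 2 ∧ k = 4) := by omega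
  have hval : ∀ a : ℕ, a < 5 → ((a : Fin 5) : ℕ) = a := fun a ha => Fin.val_cast_of_lt ha
  rcases hcase with rfl | rfl | ⟨rfl, rfl, rfl⟩
  · have := h i k (fun e => by have := congrArg Fin.val e; rw [hval _ hk, hval _ (by omega)] at this; omega)
      (fun e => by
        have := congrArg Fin.val e
        rw [← Nat.cast_succ, hval _ hk, hval _ (by omega)] at this; omega)
    simpa using this
  · have := hr j i (fun e => by
        have := congrArg Fin.val e; rw [hval _ (by omega), hval _ (by omega)] at this; omega)
      (fun e => by
        have := congrArg Fin.val e
        rw [← Nat.cast_succ, hval _ (by omega), hval _ (by omega)] at this; omega)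
    simpa using this
  · have := h 4 2 (by decide) (by decide)
    rw [orient_rotate] at this
    exact this

/-- Each side has the pentagon on one side of it, and the triangle shared by consecutive sides
carries the sign from one to the next. A clockwise list is reversed by negating the index in `Fin
5`. -/
lemma IsConvexPentagon.exists_ccwPolygon {v : Fin 5 → Plane} {P : Set Plane} (h : IsConvexPentagon v P)
    (hinner : (interior P).Nonempty) :
    CcwPolygon 5 (fun j : ℕ => v j) ∨ CcwPolygon 5 (fun j : ℕ => v (-j)) := by
  obtain ⟨hv, hP, hs⟩ := h
  have hvP : ∀ i, v i ∈ P := fun i => hP ▸ subset_convexHull ℝ _ ⟨i, rfl⟩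
  have hconv : Convex ℝ P := hP ▸ convex_convexHull ℝ _
  have hsucc : ∀ i : Fin 5, i ≠ i + 1 := by decide
  have hside := fun i => orient_one_sided hconv hinner (hvP i) (hvP (i + 1))
    (fun e => hsucc i (hv.injective e)) (hs i)
  have hne : ∀ i j, j ≠ i → j ≠ i + 1 → orient (v i) (v (i + 1)) (v j) ≠ 0 := fun i j h1 h2 =>
    hv.orient_ne_zero (hsucc i) h1.symm h2.symm
  have hstep : ∀ i, orient (v i) (v (i + 1)) (v (i + 1 + 1)) = orient (v (i + 1)) (v (i + 1 + 1)) (v i) :=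
    fun i => orient_rotate _ _ _
  have d1 : ∀ i : Fin 5, i + 1 + 1 ≠ i := by decide
  have hall : ∀ i : Fin 5, i = 0 ∨ i = 0 + 1 ∨ i = 0 + 1 + 1 ∨ i = 0 + 1 + 1 + 1 ∨ i = 0 + 1 + 1 + 1 + 1 := by
    decide
  rcases hside 0 with h0 | h0
  · left
    have prop : ∀ i, (∀ x ∈ P, 0 ≤ orient (v i) (v (i + 1)) x) →
        ∀ x ∈ P, 0 ≤ orient (v (i + 1)) (v (i + 1 + 1)) x := by
      intro i hi
      refine (hside (i + 1)).resolve_right fun hcon => ?_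
      have h1 := hi _ (hvP (i + 1 + 1))
      have h2 := hcon _ (hvP i)
      rw [← hstep] at h2
      exact hne i (i + 1 + 1) (d1 i) (hsucc (i + 1)).symm (le_antisymm h2 h1)
    have hpos : ∀ i, ∀ x ∈ P, 0 ≤ orient (v i) (v (i + 1)) x := by
      intro i
      have h1 := prop _ h0
      have h2 := prop _ h1
      have h3 := prop _ h2
      have h4 := prop _ h3
      rcases hall i with rfl | rfl | rfl | rfl | rfl <;> assumption
    exact ccwPolygon_of_edges fun i j h1 h2 => lt_of_le_of_ne (hpos i _ (hvP j)) (hne i j h1 h2).symm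
  · right
    have prop : ∀ i, (∀ x ∈ P, orient (v i) (v (i + 1)) x ≤ 0) →
        ∀ x ∈ P, orient (v (i + 1)) (v (i + 1 + 1)) x ≤ 0 := by
      intro i hi
      refine (hside (i + 1)).resolve_left fun hcon => ?_
      have h1 := hi _ (hvP (i + 1 + 1))
      have h2 := hcon _ (hvP i)
      rw [← hstep] at h2
      exact hne i (i + 1 + 1) (d1 i) (hsucc (i + 1)).symm (le_antisymm h1 h2)
    have hneg : ∀ i, ∀ x ∈ P, orient (v i) (v (i + 1)) x ≤ 0 := by
      intro i
      have h1 := prop _ h0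
      have h2 := prop _ h1
      have h3 := prop _ h2
      have h4 := prop _ h3
      rcases hall i with rfl | rfl | rfl | rfl | rfl <;> assumption
    refine ccwPolygon_of_edges (v := fun i => v (-i)) fun i j h1 h2 => ?_
    have e : -(i + 1) + 1 = -i := by abel
    have h3 := hneg (-(i + 1)) _ (hvP (-j))
    have h4 := hne (-(i + 1)) (-j) (fun e => h2 (neg_injective e)) (by rw [e]; simpa using h1)
    rw [e] at h3 h4
    rw [orient_swap]
    exact neg_pos.2 (lt_of_le_of_ne h3 h4)

theorem IsCircumscribedPentagon.exists_ccwPolygon {α : Fin 5 → ℝ} {P : Set Plane}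
    (h : IsCircumscribedPentagon α P) : ∃ w : ℕ → Plane, CcwPolygon 5 w ∧
      P = convexHull ℝ (Set.range w) ∧ ∑ i ∈ Finset.range 5, dist (w i) (w (i + 1))
        = 2 * Real.sqrt (∑ i, Real.cot (α i / 2)) := by
  obtain ⟨hvol, v, hv, hα, c, r, hr, hball, htouch⟩ := h
  have hinner : (interior P).Nonempty := ⟨c, interior_mono hball (by
    rw [interior_closedBall _ hr.ne']; exact Metric.mem_ball_self hr)⟩
  have hcast : ∀ i : Fin 5, ((i : ℕ) : Fin 5) = i := fun i => Fin.cast_val_eq_self i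
  rcases hv.exists_ccwPolygon hinner with hw | hw
  · have hrange : Set.range (fun j : ℕ => v j) = Set.range v := by
      ext x; constructor
      · rintro ⟨j, rfl⟩; exact ⟨_, rfl⟩
      · rintro ⟨j, rfl⟩; exact ⟨j, by simp [hcast]⟩
    have hP : P = convexHull ℝ (Set.range fun j : ℕ => v j) := by rw [hrange]; exact hv.2.1
    refine ⟨_, hw, hP, ?_⟩
    rw [hw.sum_dist_of_circumscribed hr (hP ▸ hvol) (hP ▸ hball) (fun i _ => by simpa using htouch i)]
    have hang : ∀ i : ℕ, EuclideanGeometry.angle (v (i : Fin 5)) (v ((i + 1 : ℕ) : Fin 5))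
        (v ((i + 2 : ℕ) : Fin 5)) = α ((i + 1 : ℕ) : Fin 5) := by
      intro i
      rw [← hα]
      congr 2 <;> push_cast <;> ring
    simp only [hang]
    congr 2
    simp only [Finset.sum_range_succ, Finset.sum_range_zero, Fin.sum_univ_five]
    have e0 : ((0 + 1 : ℕ) : Fin 5) = 1 := rfl
    have e1 : ((1 + 1 : ℕ) : Fin 5) = 2 := rfl
    have e2 : ((2 + 1 : ℕ) : Fin 5) = 3 := rfl
    have e3 : ((3 + 1 : ℕ) : Fin 5) = 4 := rfl
    have e4 : ((4 + 1 : ℕ) : Fin 5) = 0 := rfl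
    rw [e0, e1, e2, e3, e4]
    ring
  · have hrange : Set.range (fun j : ℕ => v (-j)) = Set.range v := by
      ext x; constructor
      · rintro ⟨j, rfl⟩; exact ⟨_, rfl⟩
      · rintro ⟨j, rfl⟩; exact ⟨((-j : Fin 5) : ℕ), by simp [hcast]⟩
    have hP : P = convexHull ℝ (Set.range fun j : ℕ => v (-j)) := by rw [hrange]; exact hv.2.1
    refine ⟨_, hw, hP, ?_⟩
    rw [hw.sum_dist_of_circumscribed hr (hP ▸ hvol) (hP ▸ hball) (fun i _ => by
      have := htouch (-((i + 1 : ℕ) : Fin 5))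
      rw [segment_symm] at this
      convert this using 4
      push_cast; ring)]
    have hang : ∀ i : ℕ, EuclideanGeometry.angle (v (-(i : Fin 5))) (v (-((i + 1 : ℕ) : Fin 5)))
        (v (-((i + 2 : ℕ) : Fin 5))) = α (-((i + 1 : ℕ) : Fin 5)) := by
      intro i
      rw [← hα, EuclideanGeometry.angle_comm]
      congr 2 <;> push_cast <;> ring
    simp only [hang]
    congr 2
    simp only [Finset.sum_range_succ, Finset.sum_range_zero, Fin.sum_univ_five]
    have e0 : -((0 + 1 : ℕ) : Fin 5) = 4 := rfl
    have e1 : -((1 + 1 : ℕ) : Fin 5) = 3 := rfl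
    have e2 : -((2 + 1 : ℕ) : Fin 5) = 2 := rfl
    have e3 : -((3 + 1 : ℕ) : Fin 5) = 1 := rfl
    have e4 : -((4 + 1 : ℕ) : Fin 5) = 0 := rfl
    rw [e0, e1, e2, e3, e4]
    ring

end

/-! ### Cairo and Prismatic pentagons -/

/-- The order of the angles does not matter: three angles `2π / 3` and two right angles give a
cotangent sum of `3 * (√3 / 3) + 2`, which is `cc ^ 2`. -/
theorem exists_ccwPolygon_of_isCairo_or_isPrismatic {P : Set Plane} (h : IsCairo P ∨ IsPrismatic P) :
    volume P = 1 ∧ ∃ w : ℕ → Plane, CcwPolygon 5 w ∧ P = convexHull ℝ (Set.range w) ∧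
      ∑ i ∈ Finset.range 5, dist (w i) (w (i + 1)) = 2 * cc := by
  have h3 : Real.cot (2 * Real.pi / 3 / 2) = Real.sqrt 3 / 3 := by
    rw [← cot_pi_div_three]; congr 1; ring
  have h2 : Real.cot (Real.pi / 2 / 2) = 1 := by
    rw [← cot_pi_div_four]; congr 1; ring
  rcases h with h | h
  · refine ⟨h.1, ?_⟩
    obtain ⟨w, hw, hP, hd⟩ := h.exists_ccwPolygon
    refine ⟨w, hw, hP, ?_⟩
    rw [hd, cc]
    congr 2
    rw [Fin.sum_univ_five]
    change Real.cot (2 * Real.pi / 3 / 2) + Real.cot (2 * Real.pi / 3 / 2) + Real.cot (Real.pi / 2 / 2)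
      + Real.cot (2 * Real.pi / 3 / 2) + Real.cot (Real.pi / 2 / 2) = _
    rw [h3, h2]; ring
  · refine ⟨h.1, ?_⟩
    obtain ⟨w, hw, hP, hd⟩ := h.exists_ccwPolygon
    refine ⟨w, hw, hP, ?_⟩
    rw [hd, cc]
    congr 2
    rw [Fin.sum_univ_five]
    change Real.cot (Real.pi / 2 / 2) + Real.cot (Real.pi / 2 / 2) + Real.cot (2 * Real.pi / 3 / 2)
      + Real.cot (2 * Real.pi / 3 / 2) + Real.cot (2 * Real.pi / 3 / 2) = _
    rw [h3, h2]; ring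

theorem perimeter_of_isCairo_or_isPrismatic {P : Set Plane} (h : IsCairo P ∨ IsPrismatic P) :
    perimeter P = ENNReal.ofReal (2 * cc) := by
  obtain ⟨-, w, hw, rfl, hd⟩ := exists_ccwPolygon_of_isCairo_or_isPrismatic h
  rw [hw.perimeter_eq, hd]

lemma isUnitConvexPolygonLeFive_of_isCairo_or_isPrismatic {P : Set Plane} (h : IsCairo P ∨ IsPrismatic P) :
    IsUnitConvexPolygonLeFive P := by
  classical
  obtain ⟨hvol, w, hw, rfl, -⟩ := exists_ccwPolygon_of_isCairo_or_isPrismatic h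
  refine ⟨⟨(Finset.range 5).image w, Finset.card_image_le, ?_⟩, hvol⟩
  rw [hw.range_eq]
  simp

lemma dist_le_of_isCairo_or_isPrismatic {P : Set Plane} (h : IsCairo P ∨ IsPrismatic P) :
    ∀ x ∈ P, ∀ y ∈ P, dist x y ≤ 4 * cc := by
  obtain ⟨-, w, hw, rfl, hd⟩ := exists_ccwPolygon_of_isCairo_or_isPrismatic h
  have hsub : convexHull ℝ (Set.range w) ⊆ Metric.closedBall (w 0) (2 * cc) := by
    refine convexHull_min ?_ (convex_closedBall _ _)
    rintro _ ⟨i, rfl⟩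
    obtain ⟨j, hj, e⟩ : ∃ j < 5, w j = w i := ⟨i % 5, Nat.mod_lt _ (by norm_num), hw.map_mod i⟩
    rw [← e, Metric.mem_closedBall, dist_comm, ← hd]
    refine (dist_le_range_sum_dist w j).trans ?_
    exact Finset.sum_le_sum_of_subset_of_nonneg (Finset.range_mono hj.le) fun _ _ _ => dist_nonneg
  intro x hx y hy
  have h1 := Metric.mem_closedBall.1 (hsub hx)
  have h2 := Metric.mem_closedBall.1 (hsub hy)
  linarith [dist_triangle_right x y (w 0)]

namespace IsCairoPrismaticTiling

variable {𝒯 : Set (Set Plane)} (h𝒯 : IsCairoPrismaticTiling 𝒯)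
include h𝒯

lemma isAdmissible : IsAdmissible 𝒯 :=
  ⟨h𝒯.1, fun T hT => isUnitConvexPolygonLeFive_of_isCairo_or_isPrismatic (h𝒯.2 T hT)⟩

theorem tilePerimeterRatio_eq : tilePerimeterRatio 𝒯 = ENNReal.ofReal (2 * cc) := by
  have hcc := one_le_cc
  refine le_antisymm ?_ h𝒯.isAdmissible.le_tilePerimeterRatio
  exact h𝒯.isAdmissible.tilePerimeterRatio_le_of_perimeter (d := 4 * cc) (by linarith)
    (fun T hT => perimeter_of_isCairo_or_isPrismatic (h𝒯.2 T hT))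
    (fun T hT => dist_le_of_isCairo_or_isPrismatic (h𝒯.2 T hT))

theorem perimeterRatio_eq : perimeterRatio 𝒯 = ENNReal.ofReal cc := by
  refine le_antisymm ?_ h𝒯.isAdmissible.le_perimeterRatio
  have hfin : ∀ R, tileLength 𝒯 R ≠ ∞ := fun R =>
    ((h𝒯.isAdmissible.tileLength_le_of_perimeter (d := 4 * cc)
      (fun T hT => perimeter_of_isCairo_or_isPrismatic (h𝒯.2 T hT))
      (fun T hT => dist_le_of_isCairo_or_isPrismatic (h𝒯.2 T hT)) R).trans_lt
      (ENNReal.mul_lt_top ENNReal.ofReal_lt_top measure_closedBall_lt_top)).ne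
  have h := h𝒯.isAdmissible.two_mul_perimeterRatio_le hfin
  rw [h𝒯.tilePerimeterRatio_eq, ofReal_two_mul_cc] at h
  exact (ENNReal.mul_le_mul_iff_right two_ne_zero ENNReal.ofNat_ne_top).1 h

theorem isPerimeterMinimizing : IsPerimeterMinimizing 𝒯 := by
  refine ⟨h𝒯.isAdmissible, fun 𝒮 h𝒮 => ?_⟩
  rw [h𝒯.perimeterRatio_eq, h𝒯.tilePerimeterRatio_eq]
  exact ⟨h𝒮.le_perimeterRatio, h𝒮.le_tilePerimeterRatio⟩

end IsCairoPrismaticTiling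

/-! ### Pentagons in a moving frame -/

/-- The point with coordinates `a`, `b` in the frame with origin `p`, first axis `u` and second axis
`u` turned by a right angle. -/
def place (p u : Plane) (a b : ℝ) : Plane :=
  !₂[p 0 + a * u 0 - b * u 1, p 1 + a * u 1 + b * u 0]

@[simp] lemma place_zero (p u : Plane) (a b : ℝ) : place p u a b 0 = p 0 + a * u 0 - b * u 1 := rfl

@[simp] lemma place_one (p u : Plane) (a b : ℝ) : place p u a b 1 = p 1 + a * u 1 + b * u 0 := rfl

/-- First coordinate in the frame `p`, `u`. -/
def locX (p u x : Plane) : ℝ := ((x 0 - p 0) * u 0 + (x 1 - p 1) * u 1) / (u 0 ^ 2 + u 1 ^ 2)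

/-- Second coordinate in the frame `p`, `u`. -/
def locY (p u x : Plane) : ℝ := ((x 1 - p 1) * u 0 - (x 0 - p 0) * u 1) / (u 0 ^ 2 + u 1 ^ 2)

lemma place_loc {p u : Plane} (hu : 0 < u 0 ^ 2 + u 1 ^ 2) (x : Plane) :
    place p u (locX p u x) (locY p u x) = x := by
  apply plane_ext <;>
  · simp only [place_zero, place_one, locX, locY]
    field_simp
    ring

lemma orient_place (p u : Plane) (a b a' b' a'' b'' : ℝ) :
    orient (place p u a b) (place p u a' b') (place p u a'' b'')
      = (u 0 ^ 2 + u 1 ^ 2) * ((a' - a) * (b'' - b) - (b' - b) * (a'' - a)) := by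
  simp only [orient_def, place_zero, place_one]; ring

lemma dist_place_sq (p u : Plane) (a b a' b' : ℝ) :
    dist (place p u a b) (place p u a' b') ^ 2
      = (u 0 ^ 2 + u 1 ^ 2) * ((a' - a) ^ 2 + (b' - b) ^ 2) := by
  rw [dist_eq_norm, norm_sq_eq]
  simp only [PiLp.sub_apply, place_zero, place_one]; ring

/-- The pentagon with vertices `(A i, B i)` is circumscribed about the unit circle; its sides have
outer unit normals `(N i, M i)` and lengths `ℓ i`, its angles are `α i`, and its perimeter is
`4 + 2 √3`. -/
structure IsModel (A B N M ℓ α : Fin 5 → ℝ) : Prop where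
  len_pos : ∀ i, 0 < ℓ i
  unit : ∀ i, N i ^ 2 + M i ^ 2 = 1
  stepX : ∀ i, A (i + 1) = A i - ℓ i * M i
  stepY : ∀ i, B (i + 1) = B i + ℓ i * N i
  side : ∀ i, A i * N i + B i * M i = 1
  lt_one : ∀ i j, j ≠ i → j ≠ i + 1 → A j * N i + B j * M i < 1
  foot : ∀ i, 0 ≤ A i * M i - B i * N i ∧ A i * M i - B i * N i ≤ ℓ i
  angle : ∀ i, 0 ≤ α i ∧ α i ≤ Real.pi ∧
    Real.cos (α i) = -(N (i - 1) * N i + M (i - 1) * M i)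
  sum_len : ∑ i, ℓ i = 4 + 2 * Real.sqrt 3

namespace IsModel

variable {A B N M ℓ α : Fin 5 → ℝ} (h : IsModel A B N M ℓ α) {p u : Plane}
  (hu : u 0 ^ 2 + u 1 ^ 2 = 2 - Real.sqrt 3)

lemma frame_pos : 0 < 2 - Real.sqrt 3 := by linarith [sqrt_three_bounds.2]

include h in
-- In the frame, the condition of a side becomes the support inequality `N i * a + M i * b ≤ 1` up
-- to a positive factor.
lemma orient_side (p u : Plane) (i : Fin 5) (a b : ℝ) :
    orient (place p u (A i) (B i)) (place p u (A (i + 1)) (B (i + 1))) (place p u a b)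
      = (u 0 ^ 2 + u 1 ^ 2) * ℓ i * (1 - (N i * a + M i * b)) := by
  rw [orient_place, h.stepX, h.stepY]
  linear_combination (u 0 ^ 2 + u 1 ^ 2) * ℓ i * h.side i

section

open Fin.NatCast Fin.CommRing

include h hu

lemma ccwPolygon : CcwPolygon 5 fun j : ℕ => place p u (A (j : Fin 5)) (B (j : Fin 5)) := by
  refine ccwPolygon_of_edges (v := fun i => place p u (A i) (B i)) fun i j h1 h2 => ?_
  rw [h.orient_side, hu]
  have := h.lt_one i j h1 h2
  have := h.len_pos i
  have := frame_pos
  have : 0 < 1 - (N i * A j + M i * B j) := by linarith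
  positivity

omit h hu in
lemma range_place : Set.range (fun j : ℕ => place p u (A (j : Fin 5)) (B (j : Fin 5)))
    = Set.range fun i => place p u (A i) (B i) := by
  ext x; constructor
  · rintro ⟨j, rfl⟩; exact ⟨_, rfl⟩
  · rintro ⟨j, rfl⟩; exact ⟨j, by simp [Fin.cast_val_eq_self]⟩

lemma edge_eq (i : ℕ) (x : Plane) :
    edge (fun j : ℕ => place p u (A (j : Fin 5)) (B (j : Fin 5))) i x
      = (2 - Real.sqrt 3) * ℓ (i : Fin 5)
        * (1 - (N (i : Fin 5) * locX p u x + M (i : Fin 5) * locY p u x)) := by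
  have h1 := h.orient_side p u (i : Fin 5) (locX p u x) (locY p u x)
  rw [place_loc (by rw [hu]; exact frame_pos), hu] at h1
  rw [← h1, edge]
  simp

lemma mem_iff {x : Plane} : x ∈ convexHull ℝ (Set.range fun i => place p u (A i) (B i))
    ↔ ∀ i, N i * locX p u x + M i * locY p u x ≤ 1 := by
  have hpos := frame_pos
  rw [← range_place, (h.ccwPolygon hu).mem_hull_iff]
  constructor
  · intro hx i
    have := hx i i.2
    rw [h.edge_eq hu, Fin.cast_val_eq_self] at this
    have h2 := h.len_pos i
    by_contra! hcon
    nlinarith [mul_pos (mul_pos hpos h2) (sub_pos.2 hcon)]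
  · intro hx i _
    rw [h.edge_eq hu]
    have := h.len_pos i
    have := sub_nonneg.2 (hx i)
    positivity

lemma mem_interior_iff {x : Plane} :
    x ∈ interior (convexHull ℝ (Set.range fun i => place p u (A i) (B i)))
    ↔ ∀ i, N i * locX p u x + M i * locY p u x < 1 := by
  have hpos := frame_pos
  rw [← range_place, (h.ccwPolygon hu).mem_interior_iff]
  constructor
  · intro hx i
    have := hx i i.2
    rw [h.edge_eq hu, Fin.cast_val_eq_self] at this
    have h2 := h.len_pos i
    by_contra! hcon
    nlinarith [mul_nonneg (mul_pos hpos h2).le (sub_nonneg.2 hcon)]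
  · intro hx i _
    rw [h.edge_eq hu]
    have := h.len_pos i
    have := sub_pos.2 (hx i)
    positivity

lemma isConvexPentagon : IsConvexPentagon (fun i => place p u (A i) (B i))
    (convexHull ℝ (Set.range fun i => place p u (A i) (B i))) := by
  have hw := h.ccwPolygon hu (p := p)
  have hinj : Function.Injective fun i => place p u (A i) (B i) := by
    intro i j hij
    refine Fin.ext (hw.injOn i.2 j.2 ?_)
    simpa [Fin.cast_val_eq_self] using hij
  refine ⟨?_, rfl, fun i => ?_⟩
  · rw [convexIndependent_iff_notMem_convexHull_sdiff]
    intro i s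
    -- Adding five brings vertex `i` into the successor form used by `notMem_convexHull_others`.
    have e : ((((i : ℕ) + 4 + 1 : ℕ)) : Fin 5) = i := by
      rw [add_assoc, Nat.cast_add, Fin.cast_val_eq_self]; simp
    have key := hw.notMem_convexHull_others ((i : ℕ) + 4)
      ((fun i => place p u (A i) (B i)) '' (s \ {i})) ?_
    · rwa [e] at key
    · rintro _ ⟨j, hj, rfl⟩
      rw [e, range_place]
      exact ⟨⟨j, rfl⟩, fun hji => hj.2 (hinj hji)⟩
  · rw [← range_place, hw.frontier_eq]
    refine Set.subset_iUnion₂_of_subset (i : ℕ) (Finset.mem_range.2 i.2) ?_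
    simp [Fin.cast_val_eq_self]

/-- Half the perimeter `4 + 2√3` of the model of inradius one, scaled by the squared inradius `2 -
√3`, equals one. -/
lemma volume_eq_one : volume (convexHull ℝ (Set.range fun i => place p u (A i) (B i))) = 1 := by
  rw [← range_place, (h.ccwPolygon hu).volume_hull p, ENNReal.ofReal_eq_one]
  have h0 : locX p u p = 0 ∧ locY p u p = 0 := by simp [locX, locY]
  have h1 : ∀ i : ℕ, orient p (place p u (A (i : Fin 5)) (B (i : Fin 5)))
      (place p u (A ((i + 1 : ℕ) : Fin 5)) (B ((i + 1 : ℕ) : Fin 5)))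
      = (2 - Real.sqrt 3) * ℓ (i : Fin 5) := by
    intro i
    have := h.edge_eq hu i p (p := p)
    rw [h0.1, h0.2, edge, ← orient_rotate] at this
    simpa using this
  have h3 : Real.sqrt 3 ^ 2 = 3 := Real.sq_sqrt (by norm_num)
  have h2 := h.sum_len
  rw [Fin.sum_univ_five] at h2
  simp only [h1, Finset.sum_range_succ, Finset.sum_range_zero]
  simp only [Nat.cast_zero, Nat.cast_one, Nat.cast_ofNat]
  linear_combination (2 - Real.sqrt 3) / 2 * h2 - h3

lemma angle_eq (i : Fin 5) : EuclideanGeometry.angle (place p u (A (i - 1)) (B (i - 1)))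
    (place p u (A i) (B i)) (place p u (A (i + 1)) (B (i + 1))) = α i := by
  have hpos := frame_pos
  have hr : 0 < Real.sqrt (2 - Real.sqrt 3) := Real.sqrt_pos.2 hpos
  have hr2 : Real.sqrt (2 - Real.sqrt 3) ^ 2 = 2 - Real.sqrt 3 := Real.sq_sqrt hpos.le
  obtain ⟨a1, a2, a3⟩ := h.angle i
  have sx := h.stepX (i - 1)
  have sy := h.stepY (i - 1)
  rw [sub_add_cancel] at sx sy
  have hd : ∀ a b a' b' t n m : ℝ, 0 < t → n ^ 2 + m ^ 2 = 1 → a' = a - t * m → b' = b + t * n →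
      dist (place p u a b) (place p u a' b') = Real.sqrt (2 - Real.sqrt 3) * t := by
    intro a b a' b' t n m ht hn ha hb
    rw [← sq_eq_sq₀ dist_nonneg (by positivity), dist_place_sq, hu, mul_pow, hr2, ha, hb]
    linear_combination (2 - Real.sqrt 3) * t ^ 2 * hn
  have d1 := hd _ _ _ _ _ _ _ (h.len_pos (i - 1)) (h.unit (i - 1)) sx sy
  have d2 := hd _ _ _ _ _ _ _ (h.len_pos i) (h.unit i) (h.stepX i) (h.stepY i)
  rw [EuclideanGeometry.angle, InnerProductGeometry.angle, vsub_eq_sub, vsub_eq_sub,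
    ← dist_eq_norm, ← dist_eq_norm, d1, dist_comm, d2, inner_eq, ← Real.arccos_cos a1 a2, a3]
  congr 1
  have l1 := h.len_pos (i - 1)
  have l2 := h.len_pos i
  rw [div_eq_iff (by positivity)]
  simp only [PiLp.sub_apply, place_zero, place_one, h.stepX i, h.stepY i, sx, sy]
  linear_combination (ℓ (i - 1) * ℓ i * (N (i - 1) * N i + M (i - 1) * M i)) * (hr2 - hu)

theorem isCircumscribedPentagon : IsCircumscribedPentagon α
    (convexHull ℝ (Set.range fun i => place p u (A i) (B i))) := by
  have hpos := frame_pos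
  have hr : 0 < Real.sqrt (2 - Real.sqrt 3) := Real.sqrt_pos.2 hpos
  have hr2 : Real.sqrt (2 - Real.sqrt 3) ^ 2 = 2 - Real.sqrt 3 := Real.sq_sqrt hpos.le
  have hp : p = place p u 0 0 := by apply plane_ext <;> simp
  refine ⟨h.volume_eq_one hu, _, h.isConvexPentagon hu, h.angle_eq hu, p, _, hr, ?_, fun i => ?_⟩
  · intro x hx
    rw [h.mem_iff hu]
    intro i
    have hx2 := pow_le_pow_left₀ dist_nonneg (Metric.mem_closedBall.1 hx) 2
    have e := dist_place_sq p u (locX p u x) (locY p u x) 0 0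
    rw [place_loc (by rw [hu]; exact hpos), ← hp, hu] at e
    rw [e, hr2] at hx2
    have h1 : locX p u x ^ 2 + locY p u x ^ 2 ≤ 1 := by
      refine le_of_mul_le_mul_left ?_ hpos
      linarith
    have h2 := h.unit i
    nlinarith [sq_nonneg (N i - locX p u x), sq_nonneg (M i - locY p u x)]
  · have h1 := h.unit i
    have h2 := h.side i
    obtain ⟨h3, h4⟩ := h.foot i
    have hl := h.len_pos i
    -- The contact point is the foot of the perpendicular from the centre, and `foot` places it
    -- between the two vertices.
    refine ⟨place p u (N i) (M i), ?_, ?_⟩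
    · rw [Metric.mem_sphere, ← sq_eq_sq₀ dist_nonneg hr.le, hr2]
      nth_rewrite 2 [hp]
      rw [dist_place_sq, hu]
      linear_combination (2 - Real.sqrt 3) * h1
    · set t := A i * M i - B i * N i with ht
      refine ⟨1 - t / ℓ i, t / ℓ i, by rw [sub_nonneg, div_le_one hl]; exact h4, by positivity,
        by ring, ?_⟩
      have e : t / ℓ i * ℓ i = t := by field_simp
      have eN : N i = A i - t * M i := by rw [ht]; linear_combination A i * h1 - N i * h2
      have eM : M i = B i + t * N i := by rw [ht]; linear_combination B i * h1 - M i * h2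
      apply plane_ext <;>
      · simp only [PiLp.add_apply, PiLp.smul_apply, smul_eq_mul, place_zero, place_one, h.stepX i,
          h.stepY i]
        first
          | linear_combination (-(M i * u 0) - N i * u 1) * e - u 0 * eN + u 1 * eM
          | linear_combination (-(M i * u 1) + N i * u 0) * e - u 1 * eN - u 0 * eM

end

end IsModel

/-! ### The Cairo and Prismatic pentagons -/

lemma sqrt_three_sq : Real.sqrt 3 ^ 2 = 3 := Real.sq_sqrt (by norm_num)

/-- Abscissae of the vertices of the Prismatic pentagon of inradius one. -/
def prismX : Fin 5 → ℝ := ![-1, 1, 1, 0, -1]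

/-- Ordinates of the vertices of the Prismatic pentagon of inradius one. -/
def prismY : Fin 5 → ℝ := ![-1, -1, Real.sqrt 3 / 3, 2 * Real.sqrt 3 / 3, Real.sqrt 3 / 3]

/-- Abscissae of the normals of the Prismatic pentagon. -/
def prismN : Fin 5 → ℝ := ![0, 1, 1 / 2, -(1 / 2), -1]

/-- Ordinates of the normals of the Prismatic pentagon. -/
def prismM : Fin 5 → ℝ := ![-1, 0, Real.sqrt 3 / 2, Real.sqrt 3 / 2, 0]

/-- Abscissae of the vertices of the Cairo pentagon of inradius one. -/
def cairoX : Fin 5 → ℝ :=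
  ![-(Real.sqrt 3 / 3), Real.sqrt 3 / 3, (1 + Real.sqrt 3) / 2, 0, -((1 + Real.sqrt 3) / 2)]

/-- Ordinates of the vertices of the Cairo pentagon of inradius one. -/
def cairoY : Fin 5 → ℝ :=
  ![-1, -1, (Real.sqrt 3 - 1) / 2, 2 * Real.sqrt 3 / 3, (Real.sqrt 3 - 1) / 2]

/-- Abscissae of the normals of the Cairo pentagon. -/
def cairoN : Fin 5 → ℝ := ![0, Real.sqrt 3 / 2, 1 / 2, -(1 / 2), -(Real.sqrt 3 / 2)]

/-- Ordinates of the normals of the Cairo pentagon. -/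
def cairoM : Fin 5 → ℝ := ![-1, -(1 / 2), Real.sqrt 3 / 2, Real.sqrt 3 / 2, -(1 / 2)]

lemma forall_fin_five {Q : Fin 5 → Prop} : (∀ i, Q i) ↔ Q 0 ∧ Q 1 ∧ Q 2 ∧ Q 3 ∧ Q 4 := by
  simp [Fin.forall_fin_succ]

lemma cos_two_pi_div_three : Real.cos (2 * Real.pi / 3) = -(1 / 2) := by
  rw [show 2 * Real.pi / 3 = Real.pi - Real.pi / 3 by ring, Real.cos_pi_sub, Real.cos_pi_div_three]

lemma isModel_prism : IsModel prismX prismY prismN prismM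
    ![2, 1 + Real.sqrt 3 / 3, 2 * Real.sqrt 3 / 3, 2 * Real.sqrt 3 / 3, 1 + Real.sqrt 3 / 3]
    ![Real.pi / 2, Real.pi / 2, 2 * Real.pi / 3, 2 * Real.pi / 3, 2 * Real.pi / 3] := by
  obtain ⟨s1, s2⟩ := sqrt_three_bounds
  have hs := sqrt_three_sq
  have hpi := Real.pi_pos
  have hc := cos_two_pi_div_three
  have hc2 := Real.cos_pi_div_two
  unfold prismX prismY prismN prismM
  constructor
  · intro i; fin_cases i <;> simp <;> linarith
  · intro i; fin_cases i <;> simp <;> linarith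
  · intro i; fin_cases i <;> simp <;> linarith
  · intro i; fin_cases i <;> simp <;> linarith
  · intro i; fin_cases i <;> simp <;> linarith
  · intro i j; fin_cases i <;> fin_cases j <;> simp <;> nlinarith
  · intro i; fin_cases i <;> simp <;> (try constructor) <;> nlinarith
  · rw [forall_fin_five, show (0 - 1 : Fin 5) = 4 from rfl, show (1 - 1 : Fin 5) = 0 from rfl,
      show (2 - 1 : Fin 5) = 1 from rfl, show (3 - 1 : Fin 5) = 2 from rfl,
      show (4 - 1 : Fin 5) = 3 from rfl]
    refine ⟨?_, ?_, ?_, ?_, ?_⟩ <;> simp [hc, hc2] <;> (try refine ⟨?_, ?_, ?_⟩) <;>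
      (try refine ⟨?_, ?_⟩) <;> nlinarith
  · simp [Fin.sum_univ_five]; linarith

lemma isModel_cairo : IsModel cairoX cairoY cairoN cairoM
    ![2 * Real.sqrt 3 / 3, 1 + Real.sqrt 3 / 3, 1 + Real.sqrt 3 / 3, 1 + Real.sqrt 3 / 3,
      1 + Real.sqrt 3 / 3]
    ![2 * Real.pi / 3, 2 * Real.pi / 3, Real.pi / 2, 2 * Real.pi / 3, Real.pi / 2] := by
  obtain ⟨s1, s2⟩ := sqrt_three_bounds
  have hs := sqrt_three_sq
  have hpi := Real.pi_pos
  have hc := cos_two_pi_div_three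
  have hc2 := Real.cos_pi_div_two
  unfold cairoX cairoY cairoN cairoM
  constructor
  · intro i; fin_cases i <;> simp <;> linarith
  · intro i; fin_cases i <;> simp <;> linarith
  · intro i; fin_cases i <;> simp <;> linarith
  · intro i; fin_cases i <;> simp <;> linarith
  · intro i; fin_cases i <;> simp <;> linarith
  · intro i j; fin_cases i <;> fin_cases j <;> simp <;> nlinarith
  · intro i; fin_cases i <;> simp <;> (try constructor) <;> nlinarith
  · rw [forall_fin_five, show (0 - 1 : Fin 5) = 4 from rfl, show (1 - 1 : Fin 5) = 0 from rfl,
      show (2 - 1 : Fin 5) = 1 from rfl, show (3 - 1 : Fin 5) = 2 from rfl,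
      show (4 - 1 : Fin 5) = 3 from rfl]
    refine ⟨?_, ?_, ?_, ?_, ?_⟩ <;> simp [hc, hc2] <;> (try refine ⟨?_, ?_, ?_⟩) <;>
      (try refine ⟨?_, ?_⟩) <;> nlinarith
  · simp [Fin.sum_univ_five]; linarith

/-! ### Oblique coordinates -/

/-- The inradius of the unit area Cairo and Prismatic pentagons. -/
def inradius : ℝ := Real.sqrt (2 - Real.sqrt 3)

lemma inradius_pos : 0 < inradius := Real.sqrt_pos.2 IsModel.frame_pos

lemma inradius_sq : inradius ^ 2 = 2 - Real.sqrt 3 := Real.sq_sqrt IsModel.frame_pos.le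

/-- Oblique coordinate along the direction at angle `π / 3`, in units of the inradius. -/
def obl (x : Plane) : ℝ := 2 * x 1 / (Real.sqrt 3 * inradius)

/-- Oblique coordinate along the horizontal direction, in units of the inradius. -/
def hor (x : Plane) : ℝ := (x 0 - x 1 / Real.sqrt 3) / inradius

/-- The point with given oblique coordinates. -/
def obliquePoint (a b : ℝ) : Plane := !₂[inradius * (b + a / 2), inradius * (a * Real.sqrt 3 / 2)]

/-- The vector of length `inradius` with direction cosines `c`, `d`. -/
def frameVector (c d : ℝ) : Plane := !₂[inradius * c, inradius * d]

lemma frameVector_sq {c d : ℝ} (h : c ^ 2 + d ^ 2 = 1) :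
    frameVector c d 0 ^ 2 + frameVector c d 1 ^ 2 = 2 - Real.sqrt 3 := by
  rw [← inradius_sq]
  change (inradius * c) ^ 2 + (inradius * d) ^ 2 = _
  linear_combination inradius ^ 2 * h

/-- The oblique axes follow two side directions of the hexagons, so that hexagon sides become level
lines of the two coordinates and of their sum. -/
lemma obliquePoint_obl_hor (x : Plane) : obliquePoint (obl x) (hor x) = x := by
  have h1 := inradius_pos.ne'
  have h2 : Real.sqrt 3 ≠ 0 := by positivity
  apply plane_ext
  · change inradius * (hor x + obl x / 2) = _
    rw [hor, obl]; field_simp; ring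
  · change inradius * (obl x * Real.sqrt 3 / 2) = _
    rw [obl]; field_simp

lemma locX_frame {c d : ℝ} (h : c ^ 2 + d ^ 2 = 1) (a b : ℝ) (x : Plane) :
    locX (obliquePoint a b) (frameVector c d) x
      = c * (hor x - b + (obl x - a) / 2) + d * ((obl x - a) * Real.sqrt 3 / 2) := by
  have h1 := inradius_pos
  conv_lhs => rw [← obliquePoint_obl_hor x]
  rw [locX, frameVector_sq h, ← inradius_sq]
  change ((inradius * (hor x + obl x / 2) - inradius * (b + a / 2)) * (inradius * c)
    + (inradius * (obl x * Real.sqrt 3 / 2) - inradius * (a * Real.sqrt 3 / 2)) * (inradius * d))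
    / inradius ^ 2 = _
  field_simp
  ring

lemma locY_frame {c d : ℝ} (h : c ^ 2 + d ^ 2 = 1) (a b : ℝ) (x : Plane) :
    locY (obliquePoint a b) (frameVector c d) x
      = c * ((obl x - a) * Real.sqrt 3 / 2) - d * (hor x - b + (obl x - a) / 2) := by
  have h1 := inradius_pos
  conv_lhs => rw [← obliquePoint_obl_hor x]
  rw [locY, frameVector_sq h, ← inradius_sq]
  change ((inradius * (obl x * Real.sqrt 3 / 2) - inradius * (a * Real.sqrt 3 / 2)) * (inradius * c)
    - (inradius * (hor x + obl x / 2) - inradius * (b + a / 2)) * (inradius * d))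
    / inradius ^ 2 = _
  field_simp
  ring

/-- The Prismatic pentagon with incenter of oblique coordinates `a`, `b` whose base has direction
cosines `c`, `d`. -/
def prismTile (c d a b : ℝ) : Set Plane :=
  convexHull ℝ (Set.range fun i => place (obliquePoint a b) (frameVector c d) (prismX i) (prismY i))

/-- The Cairo pentagon with incenter of oblique coordinates `a`, `b` whose base has direction
cosines `c`, `d`. -/
def cairoTile (c d a b : ℝ) : Set Plane :=
  convexHull ℝ (Set.range fun i => place (obliquePoint a b) (frameVector c d) (cairoX i) (cairoY i))

lemma isPrismatic_prismTile {c d : ℝ} (h : c ^ 2 + d ^ 2 = 1) (a b : ℝ) :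
    IsPrismatic (prismTile c d a b) := isModel_prism.isCircumscribedPentagon (frameVector_sq h)

lemma isCairo_cairoTile {c d : ℝ} (h : c ^ 2 + d ^ 2 = 1) (a b : ℝ) :
    IsCairo (cairoTile c d a b) := isModel_cairo.isCircumscribedPentagon (frameVector_sq h)

/-! ### Pentagons cut out by five affine inequalities -/

/-- Membership in a convex set and in its interior, described by five affine functions. -/
def CutOut (T : Set Plane) (x : Plane) (G : Fin 5 → ℝ) : Prop :=
  (x ∈ T ↔ ∀ i, G i ≤ 0) ∧ (x ∈ interior T ↔ ∀ i, G i < 0)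

/-- The positive factors `C i` pass from unit normals to the simplest affine forms in oblique
coordinates. -/
lemma IsModel.cutOut {A B N M ℓ α : Fin 5 → ℝ} (h : IsModel A B N M ℓ α) {p u : Plane}
    (hu : u 0 ^ 2 + u 1 ^ 2 = 2 - Real.sqrt 3) {x : Plane} {C G : Fin 5 → ℝ} (hC : ∀ i, 0 < C i)
    (hG : ∀ i, N i * locX p u x + M i * locY p u x - 1 = C i * G i) :
    CutOut (convexHull ℝ (Set.range fun i => place p u (A i) (B i))) x G := by
  constructor
  · rw [h.mem_iff hu]
    refine forall_congr' fun i => ?_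
    rw [← sub_nonpos, hG, mul_nonpos_iff_pos_imp_nonpos]
    have := hC i
    constructor
    · intro h; exact h.1 this
    · intro h; exact ⟨fun _ => h, fun h => by linarith⟩
  · rw [h.mem_interior_iff hu]
    refine forall_congr' fun i => ?_
    rw [← sub_neg, hG, mul_neg_iff]
    have := hC i
    constructor
    · rintro (h | h) <;> linarith
    · intro h; exact Or.inl ⟨this, h⟩

/-- Length of the long sides of the hexagons, in units of the inradius. -/
def longSide : ℝ := 2 + 2 * Real.sqrt 3 / 3

/-- Length of the short sides of the hexagons, in units of the inradius. -/
def shortSide : ℝ := 2 * Real.sqrt 3 / 3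

/-- The first inequality, for the base, is the cut bisecting the hexagon with `l = shortSide`; the
other four are sides of that hexagon. -/
lemma cutOut_prism_up (a b : ℝ) (x : Plane) :
    CutOut (prismTile (Real.sqrt 3 / 2) (-(1 / 2)) (a + (longSide + shortSide) / 2 + 1) b) x
      ![(longSide + shortSide) / 2 - (obl x - a) - (hor x - b) / 2,
        (hor x - b) - shortSide,
        (obl x - a) + (hor x - b) - (longSide + shortSide),
        (obl x - a) - (longSide + shortSide),
        -shortSide - (hor x - b)] := by
  have hs := sqrt_three_sq
  have hcd : ((Real.sqrt 3 / 2) : ℝ) ^ 2 + (-(1 / 2)) ^ 2 = 1 := by linarith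
  have hp : 0 < Real.sqrt 3 := by positivity
  refine isModel_prism.cutOut (frameVector_sq hcd)
    (C := ![1, Real.sqrt 3 / 2, Real.sqrt 3 / 2, Real.sqrt 3 / 2, Real.sqrt 3 / 2]) ?_ ?_
  · rw [forall_fin_five]; simp
  · rw [locX_frame hcd, locY_frame hcd, forall_fin_five]
    simp only [prismN, prismM, longSide, shortSide]
    refine ⟨?_, ?_, ?_, ?_, ?_⟩ <;> simp <;> grind

lemma cutOut_prism_down (a b : ℝ) (x : Plane) :
    CutOut (prismTile (-(Real.sqrt 3 / 2)) (1 / 2) (a + (longSide + shortSide) / 2 - 1) b) x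
      ![(obl x - a) + (hor x - b) / 2 - (longSide + shortSide) / 2,
        -shortSide - (hor x - b),
        -(obl x - a) - (hor x - b),
        -(obl x - a),
        (hor x - b) - shortSide] := by
  have hs := sqrt_three_sq
  have hcd : ((-(Real.sqrt 3 / 2)) : ℝ) ^ 2 + (1 / 2) ^ 2 = 1 := by linarith
  have hp : 0 < Real.sqrt 3 := by positivity
  refine isModel_prism.cutOut (frameVector_sq hcd)
    (C := ![1, Real.sqrt 3 / 2, Real.sqrt 3 / 2, Real.sqrt 3 / 2, Real.sqrt 3 / 2]) ?_ ?_
  · rw [forall_fin_five]; simp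
  · rw [locX_frame hcd, locY_frame hcd, forall_fin_five]
    simp only [prismN, prismM, longSide, shortSide]
    refine ⟨?_, ?_, ?_, ?_, ?_⟩ <;> simp <;> grind

/-- Each of the four Cairo tiles uses three sides of the hexagon with `l = longSide` and two
interior cuts; the central tiles, right and left, have a third cut in place of no outer side lost,
the line between them being `Y + X / 2 = shortSide / 2`. -/
lemma cutOut_cairo_bottom (a b : ℝ) (x : Plane) :
    CutOut (cairoTile 1 0 (a + shortSide) b) x
      ![-(obl x - a),
        (hor x - b) - shortSide,
        (obl x - a) + (hor x - b) / 2 - (longSide + shortSide) / 2,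
        (obl x - a) - (hor x - b) - longSide,
        -(obl x - a) - (hor x - b)] := by
  have hs := sqrt_three_sq
  have hcd : (1 : ℝ) ^ 2 + 0 ^ 2 = 1 := by norm_num
  have hp : 0 < Real.sqrt 3 := by positivity
  refine isModel_cairo.cutOut (frameVector_sq hcd)
    (C := ![Real.sqrt 3 / 2, Real.sqrt 3 / 2, 1, 1 / 2, Real.sqrt 3 / 2]) ?_ ?_
  · rw [forall_fin_five]; simp
  · rw [locX_frame hcd, locY_frame hcd, forall_fin_five]
    simp only [cairoN, cairoM, longSide, shortSide]
    refine ⟨?_, ?_, ?_, ?_, ?_⟩ <;> simp <;> grind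

lemma cutOut_cairo_top (a b : ℝ) (x : Plane) :
    CutOut (cairoTile (-1) 0 (a + 2 * longSide - shortSide) (b + shortSide - longSide)) x
      ![(obl x - a) - 2 * longSide,
        -longSide - (hor x - b),
        longSide - (obl x - a) - (hor x - b) / 2,
        2 * longSide - shortSide - (obl x - a) + (hor x - b),
        (obl x - a) + (hor x - b) - longSide - shortSide] := by
  have hs := sqrt_three_sq
  have hcd : ((-1) : ℝ) ^ 2 + 0 ^ 2 = 1 := by norm_num
  have hp : 0 < Real.sqrt 3 := by positivity
  refine isModel_cairo.cutOut (frameVector_sq hcd)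
    (C := ![Real.sqrt 3 / 2, Real.sqrt 3 / 2, 1, 1 / 2, Real.sqrt 3 / 2]) ?_ ?_
  · rw [forall_fin_five]; simp
  · rw [locX_frame hcd, locY_frame hcd, forall_fin_five]
    simp only [cairoN, cairoM, longSide, shortSide]
    refine ⟨?_, ?_, ?_, ?_, ?_⟩ <;> simp <;> grind

lemma cutOut_cairo_right (a b : ℝ) (x : Plane) :
    CutOut (cairoTile 0 (-1) (a + longSide) (b + (shortSide - longSide) / 2 + 1)) x
      ![shortSide / 2 - (hor x - b) - (obl x - a) / 2,
        (longSide + shortSide) / 2 - (obl x - a) - (hor x - b) / 2,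
        (hor x - b) - shortSide,
        (obl x - a) + (hor x - b) - (longSide + shortSide),
        (obl x - a) - (hor x - b) - 2 * longSide + shortSide] := by
  have hs := sqrt_three_sq
  have hcd : (0 : ℝ) ^ 2 + (-1) ^ 2 = 1 := by norm_num
  have hp : 0 < Real.sqrt 3 := by positivity
  refine isModel_cairo.cutOut (frameVector_sq hcd)
    (C := ![1, 1, Real.sqrt 3 / 2, Real.sqrt 3 / 2, 1 / 2]) ?_ ?_
  · rw [forall_fin_five]; simp
  · rw [locX_frame hcd, locY_frame hcd, forall_fin_five]
    simp only [cairoN, cairoM, longSide, shortSide]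
    refine ⟨?_, ?_, ?_, ?_, ?_⟩ <;> simp <;> grind

lemma cutOut_cairo_left (a b : ℝ) (x : Plane) :
    CutOut (cairoTile 0 1 (a + longSide) (b + (shortSide - longSide) / 2 - 1)) x
      ![(hor x - b) + (obl x - a) / 2 - shortSide / 2,
        (obl x - a) + (hor x - b) / 2 - longSide,
        -longSide - (hor x - b),
        -(obl x - a) - (hor x - b),
        longSide - (obl x - a) + (hor x - b)] := by
  have hs := sqrt_three_sq
  have hcd : (0 : ℝ) ^ 2 + 1 ^ 2 = 1 := by norm_num
  have hp : 0 < Real.sqrt 3 := by positivity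
  refine isModel_cairo.cutOut (frameVector_sq hcd)
    (C := ![1, 1, Real.sqrt 3 / 2, Real.sqrt 3 / 2, 1 / 2]) ?_ ?_
  · rw [forall_fin_five]; simp
  · rw [locX_frame hcd, locY_frame hcd, forall_fin_five]
    simp only [cairoN, cairoM, longSide, shortSide]
    refine ⟨?_, ?_, ?_, ?_, ?_⟩ <;> simp <;> grind

/-! ### Dissections of hexagons -/

/-- The closed equiangular hexagon with sides `longSide`, `shortSide` and `l`, in oblique coordinates
from one of its vertices. -/
def HexClosed (l X Y : ℝ) : Prop :=
  0 ≤ X ∧ X ≤ longSide + l ∧ -l ≤ Y ∧ Y ≤ shortSide ∧ 0 ≤ X + Y ∧ X + Y ≤ longSide + shortSide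

/-- The interior of the hexagon `HexClosed`. -/
def HexOpen (l X Y : ℝ) : Prop :=
  0 < X ∧ X < longSide + l ∧ -l < Y ∧ Y < shortSide ∧ 0 < X + Y ∧ X + Y < longSide + shortSide

/-- `F` dissects the hexagon with parameter `l` based at the point with oblique coordinates
`a`, `b`. -/
structure Dissects (F : Set (Set Plane)) (l a b : ℝ) : Prop where
  cover : ∀ x, HexClosed l (obl x - a) (hor x - b) → ∃ T ∈ F, x ∈ T
  sub : ∀ T ∈ F, ∀ x ∈ T, HexClosed l (obl x - a) (hor x - b)
  interior_sub : ∀ T ∈ F, ∀ x ∈ interior T, HexOpen l (obl x - a) (hor x - b)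
  unique : ∀ S ∈ F, ∀ T ∈ F, ∀ x ∈ interior S, x ∈ interior T → S = T

/-- Two Prismatic pentagons forming a hexagon. -/
def prismPair (a b : ℝ) : Set (Set Plane) :=
  {prismTile (Real.sqrt 3 / 2) (-(1 / 2)) (a + (longSide + shortSide) / 2 + 1) b,
    prismTile (-(Real.sqrt 3 / 2)) (1 / 2) (a + (longSide + shortSide) / 2 - 1) b}

/-- Four Cairo pentagons forming a hexagon. -/
def cairoQuad (a b : ℝ) : Set (Set Plane) :=
  {cairoTile 1 0 (a + shortSide) b,
    cairoTile (-1) 0 (a + 2 * longSide - shortSide) (b + shortSide - longSide),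
    cairoTile 0 (-1) (a + longSide) (b + (shortSide - longSide) / 2 + 1),
    cairoTile 0 1 (a + longSide) (b + (shortSide - longSide) / 2 - 1)}

lemma shortSide_pos : 0 < shortSide := by unfold shortSide; positivity

lemma longSide_eq : longSide = 2 + shortSide := rfl

lemma isPrismatic_of_mem {a b : ℝ} {T : Set Plane} (hT : T ∈ prismPair a b) : IsPrismatic T := by
  have hs := sqrt_three_sq
  rcases hT with rfl | rfl <;> exact isPrismatic_prismTile (by linarith) _ _

lemma isCairo_of_mem {a b : ℝ} {T : Set Plane} (hT : T ∈ cairoQuad a b) : IsCairo T := by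
  rcases hT with rfl | rfl | rfl | rfl <;> exact isCairo_cairoTile (by norm_num) _ _

lemma dissects_prismPair (a b : ℝ) : Dissects (prismPair a b) shortSide a b := by
  have hb := shortSide_pos
  have hm := longSide_eq
  have hup := fun x => cutOut_prism_up a b x
  have hdown := fun x => cutOut_prism_down a b x
  simp only [CutOut, forall_fin_five] at hup hdown
  constructor
  · intro x hx
    obtain ⟨h1, h2, h3, h4, h5, h6⟩ := hx
    rcases le_total ((longSide + shortSide) / 2) ((obl x - a) + (hor x - b) / 2) with h | h
    · exact ⟨_, Or.inl rfl, (hup x).1.2 (by simp; grind)⟩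
    · exact ⟨_, Or.inr rfl, (hdown x).1.2 (by simp; grind)⟩
  · rintro T (rfl | rfl) x hx
    · have := (hup x).1.1 hx
      simp at this
      unfold HexClosed; grind
    · have := (hdown x).1.1 hx
      simp at this
      unfold HexClosed; grind
  · rintro T (rfl | rfl) x hx
    · have := (hup x).2.1 hx
      simp at this
      unfold HexOpen; grind
    · have := (hdown x).2.1 hx
      simp at this
      unfold HexOpen; grind
  · rintro S (rfl | rfl) T (rfl | rfl) x hS hT
    · rfl
    · have h1 := (hup x).2.1 hS
      have h2 := (hdown x).2.1 hT
      simp at h1 h2; grind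
    · have h1 := (hdown x).2.1 hS
      have h2 := (hup x).2.1 hT
      simp at h1 h2; grind
    · rfl

/-- Any two of the four tiles are separated by one of the five cut lines. -/
lemma eq_of_mem_cairoQuad {a b : ℝ} {S T : Set Plane} (hS : S ∈ cairoQuad a b) (hT : T ∈ cairoQuad a b)
    {x : Plane} (hxS : x ∈ interior S) (hxT : x ∈ interior T) : S = T := by
  have hb := shortSide_pos
  have hm := longSide_eq
  have h1 := (cutOut_cairo_bottom a b x).2
  have h2 := (cutOut_cairo_top a b x).2
  have h3 := (cutOut_cairo_right a b x).2
  have h4 := (cutOut_cairo_left a b x).2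
  simp only [forall_fin_five] at h1 h2 h3 h4
  simp at h1 h2 h3 h4
  rcases hS with rfl | rfl | rfl | rfl <;> rcases hT with rfl | rfl | rfl | rfl <;>
    first
      | rfl
      | (exfalso
         simp only [h1, h2, h3, h4] at hxS hxT
         clear h1 h2 h3 h4
         obtain ⟨_, _, _, _, _⟩ := hxS
         obtain ⟨_, _, _, _, _⟩ := hxT
         linarith)

lemma dissects_cairoQuad (a b : ℝ) : Dissects (cairoQuad a b) longSide a b := by
  have hb := shortSide_pos
  have hm := longSide_eq
  have h1 := fun x => cutOut_cairo_bottom a b x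
  have h2 := fun x => cutOut_cairo_top a b x
  have h3 := fun x => cutOut_cairo_right a b x
  have h4 := fun x => cutOut_cairo_left a b x
  simp only [CutOut, forall_fin_five] at h1 h2 h3 h4
  constructor
  · intro x hx
    obtain ⟨e1, e2, e3, e4, e5, e6⟩ := hx
    -- The cuts of the bottom and top tiles remove these two; the line `Y + X / 2 = shortSide / 2`
    -- divides the remainder.
    by_cases c1 : ((obl x - a) + (hor x - b) / 2 ≤ (longSide + shortSide) / 2 ∧
      (obl x - a) - (hor x - b) ≤ longSide)
    · exact ⟨_, Or.inl rfl, (h1 x).1.2 (by simp; grind)⟩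
    by_cases c2 : (longSide ≤ (obl x - a) + (hor x - b) / 2 ∧
      2 * longSide - shortSide ≤ (obl x - a) - (hor x - b))
    · exact ⟨_, Or.inr (Or.inl rfl), (h2 x).1.2 (by simp; grind)⟩
    rcases le_total (shortSide / 2) ((hor x - b) + (obl x - a) / 2) with h | h
    · exact ⟨_, Or.inr (Or.inr (Or.inl rfl)), (h3 x).1.2 (by simp; grind)⟩
    · exact ⟨_, Or.inr (Or.inr (Or.inr rfl)), (h4 x).1.2 (by simp; grind)⟩
  · rintro T (rfl | rfl | rfl | rfl) x hx
    · have := (h1 x).1.1 hx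
      simp at this
      clear h1 h2 h3 h4
      unfold HexClosed; grind
    · have := (h2 x).1.1 hx
      simp at this
      clear h1 h2 h3 h4
      unfold HexClosed; grind
    · have := (h3 x).1.1 hx
      simp at this
      clear h1 h2 h3 h4
      unfold HexClosed; grind
    · have := (h4 x).1.1 hx
      simp at this
      clear h1 h2 h3 h4
      unfold HexClosed; grind
  · rintro T (rfl | rfl | rfl | rfl) x hx
    · have := (h1 x).2.1 hx
      simp at this
      clear h1 h2 h3 h4
      unfold HexOpen; grind
    · have := (h2 x).2.1 hx
      simp at this
      clear h1 h2 h3 h4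
      unfold HexOpen; grind
    · have := (h3 x).2.1 hx
      simp at this
      clear h1 h2 h3 h4
      unfold HexOpen; grind
    · have := (h4 x).2.1 hx
      simp at this
      clear h1 h2 h3 h4
      unfold HexOpen; grind
  · exact fun S hS T hT x hxS hxT => eq_of_mem_cairoQuad hS hT hxS hxT

/-! ### Columns of hexagons -/

lemma longSide_pos : 0 < longSide := by have := shortSide_pos; rw [longSide_eq]; linarith

/-- The horizontal coordinate of the base of the `j`-th column, when its oblique coordinate is `p j`. -/
def columnBase (p : ℤ → ℝ) (j : ℤ) : ℝ := -(j * shortSide) - p j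

/-- Tiles dissecting columns of hexagons: the `k`-th hexagon of the `j`-th column is dissected
by `F j`. -/
def columnTiling (p : ℤ → ℝ) (F : ℤ → ℝ → ℝ → Set (Set Plane)) : Set (Set Plane) :=
  {T | ∃ j k : ℤ, T ∈ F j (p j + k * longSide) (columnBase p j + k * shortSide)}

/-- The position of a point with respect to the left boundary of the `j`-th column: nonnegative
exactly on that boundary and to its right. -/
def level (p : ℤ → ℝ) (x : Plane) (j : ℤ) : ℤ :=
  ⌊(obl x - p j) / longSide⌋ - ⌊(hor x - columnBase p j) / shortSide⌋

section

variable {p : ℤ → ℝ} (hp : ∀ j, 0 < p (j + 1) - p j)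
include hp

/-- Passing to the next column raises the first offset and lowers the second base by more than
`shortSide`. The level thus strictly decreases, changes sign exactly once, and so singles out the
column of `x`. -/
lemma level_succ_le (x : Plane) (j : ℤ) : level p x (j + 1) ≤ level p x j - 1 := by
  have hm := longSide_pos
  have hb := shortSide_pos
  have hl := hp j
  have h1 : ⌊(obl x - p (j + 1)) / longSide⌋ ≤ ⌊(obl x - p j) / longSide⌋ := by
    apply Int.floor_mono
    gcongr
    linarith
  have h2 : ⌊(hor x - columnBase p j) / shortSide⌋ + 1
      ≤ ⌊(hor x - columnBase p (j + 1)) / shortSide⌋ := by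
    rw [← Int.floor_add_one]
    apply Int.floor_mono
    rw [div_add_one hb.ne']
    gcongr
    unfold columnBase
    push_cast
    linarith
  unfold level
  omega

lemma level_add_le (x : Plane) (j : ℤ) (n : ℕ) : level p x (j + n) ≤ level p x j - n := by
  induction n with
  | zero => simp
  | succ n ih =>
    have := level_succ_le hp x (j + n)
    push_cast
    rw [← add_assoc]
    omega

lemma exists_column (x : Plane) : ∃ j, 0 ≤ level p x j ∧ level p x (j + 1) < 0 := by
  obtain ⟨j, hj, hmax⟩ := Int.exists_greatest_of_bdd (P := fun j => 0 ≤ level p x j)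
    ⟨(level p x 0).natAbs, fun z hz => by
      by_contra! hcon
      have := level_add_le hp x 0 z.toNat
      rw [zero_add, Int.toNat_of_nonneg (by omega)] at this
      omega⟩
    ⟨-((level p x 0).natAbs : ℤ), by
      have := level_add_le hp x (-((level p x 0).natAbs : ℤ)) (level p x 0).natAbs
      rw [neg_add_cancel] at this
      omega⟩
  refine ⟨j, hj, ?_⟩
  by_contra! hcon
  have := hmax _ hcon
  omega

lemma column_unique {x : Plane} {j j' : ℤ} (h1 : 0 ≤ level p x j) (h2 : level p x (j + 1) < 0)
    (h1' : 0 ≤ level p x j') (h2' : level p x (j' + 1) < 0) : j = j' := by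
  have key : ∀ i i' : ℤ, 0 ≤ level p x i' → level p x (i + 1) < 0 → i' ≤ i := by
    intro i i' h h'
    by_contra! hcon
    have := level_add_le hp x (i + 1) (i' - (i + 1)).toNat
    rw [Int.toNat_of_nonneg (by omega), add_sub_cancel] at this
    omega
  exact le_antisymm (key _ _ h1 h2') (key _ _ h1' h2)

omit hp in
-- Since `p j + columnBase p j` equals `-j * shortSide`, the sum of the coordinates does not involve
-- `p`, and its floor in units of `longSide + shortSide` recovers the position `k` within the
-- column.
lemma level_of_hexOpen {x : Plane} {j k : ℤ} (h : HexOpen (p (j + 1) - p j)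
    (obl x - (p j + k * longSide)) (hor x - (columnBase p j + k * shortSide))) :
    0 ≤ level p x j ∧ level p x (j + 1) < 0 ∧
      k = ⌊(obl x + hor x + j * shortSide) / (longSide + shortSide)⌋ := by
  have hm := longSide_pos
  have hb := shortSide_pos
  obtain ⟨h1, h2, h3, h4, h5, h6⟩ := h
  have e : columnBase p (j + 1) = columnBase p j - shortSide - (p (j + 1) - p j) := by
    unfold columnBase; push_cast; ring
  refine ⟨?_, ?_, ?_⟩
  · have a : k ≤ ⌊(obl x - p j) / longSide⌋ := by
      rw [Int.le_floor, le_div_iff₀ hm]; linarith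
    have b : ⌊(hor x - columnBase p j) / shortSide⌋ < k + 1 := by
      rw [Int.floor_lt, div_lt_iff₀ hb]; push_cast; linarith
    unfold level; omega
  · have a : ⌊(obl x - p (j + 1)) / longSide⌋ < k + 1 := by
      rw [Int.floor_lt, div_lt_iff₀ hm]; push_cast; linarith
    have b : k + 1 ≤ ⌊(hor x - columnBase p (j + 1)) / shortSide⌋ := by
      rw [Int.le_floor, le_div_iff₀ hb, e]; push_cast; linarith
    unfold level; omega
  · symm
    unfold columnBase at *
    rw [Int.floor_eq_iff, le_div_iff₀ (by linarith), div_lt_iff₀ (by linarith)]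
    constructor <;> linarith

omit hp in
-- Take `k` from the sum of the coordinates. If one of the four other inequalities failed, the level
-- condition would push the second coordinate off in the same direction, and the sum would leave its
-- interval.
lemma hexClosed_of_level {x : Plane} {j : ℤ} (h1 : 0 ≤ level p x j) (h2 : level p x (j + 1) < 0) :
    ∃ k : ℤ, HexClosed (p (j + 1) - p j)
      (obl x - (p j + k * longSide)) (hor x - (columnBase p j + k * shortSide)) := by
  have hm := longSide_pos
  have hb := shortSide_pos
  have e : columnBase p (j + 1) = columnBase p j - shortSide - (p (j + 1) - p j) := by
    unfold columnBase; push_cast; ring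
  unfold level at h1 h2
  rw [e] at h2
  set X := obl x - p j with hX
  set Y := hor x - columnBase p j with hY
  set l := p (j + 1) - p j with hl
  have e1 : obl x - p (j + 1) = X - l := by rw [hX, hl]; ring
  have e2 : hor x - (columnBase p j - shortSide - l) = Y + l + shortSide := by rw [hY]; ring
  rw [e1, e2] at h2
  obtain ⟨f1, f2⟩ := Int.floor_eq_iff.1 (rfl : ⌊X / longSide⌋ = _)
  obtain ⟨f3, f4⟩ := Int.floor_eq_iff.1 (rfl : ⌊Y / shortSide⌋ = _)
  obtain ⟨f5, f6⟩ := Int.floor_eq_iff.1 (rfl : ⌊(X - l) / longSide⌋ = _)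
  obtain ⟨f7, f8⟩ := Int.floor_eq_iff.1 (rfl : ⌊(Y + l + shortSide) / shortSide⌋ = _)
  obtain ⟨f9, f10⟩ := Int.floor_eq_iff.1 (rfl : ⌊(X + Y) / (longSide + shortSide)⌋ = _)
  generalize ⌊X / longSide⌋ = n1 at *
  generalize ⌊Y / shortSide⌋ = n2 at *
  generalize ⌊(X - l) / longSide⌋ = n3 at *
  generalize ⌊(Y + l + shortSide) / shortSide⌋ = n4 at *
  generalize ⌊(X + Y) / (longSide + shortSide)⌋ = k at *
  rw [le_div_iff₀ (by linarith)] at f1 f3 f5 f7 f9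
  rw [div_lt_iff₀ (by linarith)] at f2 f4 f6 f8 f10
  have cast_le : ∀ {i i' : ℤ} {c : ℝ}, 0 < c → i ≤ i' → (i : ℝ) * c ≤ i' * c := by
    intro i i' c hc h
    have : (i : ℝ) ≤ i' := by exact_mod_cast h
    exact mul_le_mul_of_nonneg_right this hc.le
  refine ⟨k, ?_, ?_, ?_, ?_, ?_, ?_⟩
  -- If the first floor is below `k`, a nonnegative level puts the second below `k` as well, and the
  -- sum is too small. The next three cases are alike.
  · by_contra! hcon
    have a : n1 < k := by
      by_contra! h
      have := cast_le hm h
      linarith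
    have b := cast_le hb (show n2 + 1 ≤ k by omega)
    push_cast at b
    linarith
  · by_contra! hcon
    have a : k + 1 ≤ n3 := by
      by_contra! h
      have := cast_le hm (show n3 + 1 ≤ k + 1 by omega)
      push_cast at this
      linarith
    have b := cast_le hb (show k + 2 ≤ n4 by omega)
    push_cast at b
    linarith
  · by_contra! hcon
    have a : n4 ≤ k := by
      by_contra! h
      have := cast_le hb (show k + 1 ≤ n4 by omega)
      push_cast at this
      linarith
    have b := cast_le hm (show n3 + 1 ≤ k by omega)
    push_cast at b
    linarith
  · by_contra! hcon
    have a : k + 1 ≤ n2 := by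
      by_contra! h
      have := cast_le hb (show n2 + 1 ≤ k + 1 by omega)
      push_cast at this
      linarith
    have b := cast_le hm (show k + 1 ≤ n1 by omega)
    push_cast at b
    linarith
  · linarith
  · linarith

variable {F : ℤ → ℝ → ℝ → Set (Set Plane)} (hF : ∀ j a b, Dissects (F j a b) (p (j + 1) - p j) a b)
include hF

lemma exists_mem_columnTiling (x : Plane) :
    ∃ j k : ℤ, ∃ T ∈ F j (p j + k * longSide) (columnBase p j + k * shortSide), x ∈ T := by
  obtain ⟨j, h1, h2⟩ := exists_column hp x
  obtain ⟨k, hk⟩ := hexClosed_of_level h1 h2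
  exact ⟨j, k, (hF j _ _).cover x hk⟩

lemma columnTiling_unique {S T : Set Plane} (hS : S ∈ columnTiling p F) (hT : T ∈ columnTiling p F)
    {x : Plane} (hxS : x ∈ interior S) (hxT : x ∈ interior T) : S = T := by
  obtain ⟨j, k, hS⟩ := hS
  obtain ⟨j', k', hT⟩ := hT
  obtain ⟨a1, a2, a3⟩ := level_of_hexOpen ((hF _ _ _).interior_sub S hS x hxS)
  obtain ⟨b1, b2, b3⟩ := level_of_hexOpen ((hF _ _ _).interior_sub T hT x hxT)
  obtain rfl := column_unique hp a1 a2 b1 b2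
  rw [← a3] at b3
  subst b3
  exact (hF _ _ _).unique S hS T hT x hxS hxT

/-- Disjoint interiors suffice: a convex tile is the closure of its interior, so a point interior to
one tile and lying in another would give a common interior point. -/
theorem isTiling_columnTiling (hU : ∀ T ∈ columnTiling p F, IsUnitConvexPolygonLeFive T) :
    IsTiling (columnTiling p F) := by
  refine ⟨Set.eq_univ_of_forall fun x => ?_, ?_⟩
  · obtain ⟨j, k, T, hT, hx⟩ := exists_mem_columnTiling hp hF x
    exact ⟨T, ⟨j, k, hT⟩, hx⟩
  have key : ∀ S ∈ columnTiling p F, ∀ T ∈ columnTiling p F, S ≠ T → ∀ x ∈ S, x ∈ T →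
      x ∈ frontier S := by
    intro S hS T hT hST x hxS hxT
    refine ⟨subset_closure hxS, fun hx => hST ?_⟩
    have h1 : x ∈ closure (interior T) := by
      rw [(hU T hT).convex.closure_interior_eq_closure_of_nonempty_interior (hU T hT).interior_nonempty]
      exact subset_closure hxT
    obtain ⟨y, hy1, hy2⟩ := mem_closure_iff.1 h1 _ isOpen_interior hx
    exact columnTiling_unique hp hF hS hT hy1 hy2
  exact fun S hS T hT hST x hx => ⟨key S hS T hT hST x hx.1 hx.2, key T hT S hS hST.symm x hx.2 hx.1⟩

end

/-! ### Tilings by Prismatic pentagons and by both kinds of pentagons -/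

theorem exists_prismatic_tiling : ∃ 𝒯 : Set (Set Plane), IsTiling 𝒯 ∧ ∀ T ∈ 𝒯, IsPrismatic T := by
  have hT : ∀ T ∈ columnTiling (fun j => j * shortSide) (fun _ => prismPair), IsPrismatic T := by
    rintro T ⟨j, k, hT⟩
    exact isPrismatic_of_mem hT
  have e : ∀ j : ℤ, ((j + 1 : ℤ) : ℝ) * shortSide - j * shortSide = shortSide := by
    intro j; push_cast; ring
  refine ⟨_, isTiling_columnTiling (fun j => ?_) (fun j a b => ?_) fun T hT' =>
    isUnitConvexPolygonLeFive_of_isCairo_or_isPrismatic (Or.inr (hT T hT')), hT⟩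
  · rw [e]; exact shortSide_pos
  · rw [e]; exact dissects_prismPair a b

/-- Oblique coordinates of the columns when columns `0, …, n - 1` are Prismatic and the others
are Cairo. -/
def mixedOffset (n : ℕ) (j : ℤ) : ℝ :=
  (j - (max 0 (min j n) : ℤ)) * longSide + (max 0 (min j n) : ℤ) * shortSide

open Classical in
/-- Dissections of the hexagons when columns `0, …, n - 1` are Prismatic and the others are Cairo. -/
def mixedDissection (n : ℕ) (j : ℤ) : ℝ → ℝ → Set (Set Plane) :=
  if 0 ≤ j ∧ j < n then prismPair else cairoQuad

/-- The tiling with `n` Prismatic columns among Cairo columns. -/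
def mixedTiling (n : ℕ) : Set (Set Plane) := columnTiling (mixedOffset n) (mixedDissection n)

/-- The clamp `max 0 (min j n)` counts the Prismatic columns passed between `0` and `j`; it moves
only while `j` is in their range. -/
lemma mixedOffset_succ_of_mem {n : ℕ} {j : ℤ} (h : 0 ≤ j ∧ j < n) :
    mixedOffset n (j + 1) - mixedOffset n j = shortSide := by
  unfold mixedOffset
  rw [show max 0 (min (j + 1) (n : ℤ)) = j + 1 by omega, show max 0 (min j (n : ℤ)) = j by omega]
  push_cast
  ring

lemma mixedOffset_succ_of_notMem {n : ℕ} {j : ℤ} (h : ¬ (0 ≤ j ∧ j < n)) :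
    mixedOffset n (j + 1) - mixedOffset n j = longSide := by
  unfold mixedOffset
  rw [show max 0 (min (j + 1) (n : ℤ)) = max 0 (min j (n : ℤ)) by omega]
  push_cast
  ring

lemma mixedOffset_succ_pos (n : ℕ) (j : ℤ) : 0 < mixedOffset n (j + 1) - mixedOffset n j := by
  by_cases h : 0 ≤ j ∧ j < n
  · rw [mixedOffset_succ_of_mem h]; exact shortSide_pos
  · rw [mixedOffset_succ_of_notMem h]; exact longSide_pos

lemma dissects_mixed (n : ℕ) (j : ℤ) (a b : ℝ) :
    Dissects (mixedDissection n j a b) (mixedOffset n (j + 1) - mixedOffset n j) a b := by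
  unfold mixedDissection
  by_cases h : 0 ≤ j ∧ j < n
  · rw [mixedOffset_succ_of_mem h, if_pos h]; exact dissects_prismPair a b
  · rw [mixedOffset_succ_of_notMem h, if_neg h]; exact dissects_cairoQuad a b

lemma isCairo_or_isPrismatic_of_mem_mixedTiling {n : ℕ} {T : Set Plane} (hT : T ∈ mixedTiling n) :
    IsCairo T ∨ IsPrismatic T := by
  obtain ⟨j, k, hT⟩ := hT
  unfold mixedDissection at hT
  split_ifs at hT
  · exact Or.inr (isPrismatic_of_mem hT)
  · exact Or.inl (isCairo_of_mem hT)

lemma isCairoPrismaticTiling_mixedTiling (n : ℕ) : IsCairoPrismaticTiling (mixedTiling n) :=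
  ⟨isTiling_columnTiling (mixedOffset_succ_pos n) (dissects_mixed n) fun _ hT =>
    isUnitConvexPolygonLeFive_of_isCairo_or_isPrismatic
      (isCairo_or_isPrismatic_of_mem_mixedTiling hT),
    fun _ => isCairo_or_isPrismatic_of_mem_mixedTiling⟩

theorem exists_cairo_tiling : ∃ 𝒯 : Set (Set Plane), IsTiling 𝒯 ∧ ∀ T ∈ 𝒯, IsCairo T := by
  refine ⟨mixedTiling 0, (isCairoPrismaticTiling_mixedTiling 0).1, ?_⟩
  rintro T ⟨j, k, hT⟩
  unfold mixedDissection at hT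
  rw [if_neg (by push_cast; omega)] at hT
  exact isCairo_of_mem hT

lemma exists_isCairo_mem_mixedTiling (n : ℕ) : ∃ T ∈ mixedTiling n, IsCairo T := by
  have h : ∃ T, T ∈ mixedDissection n (-1) (mixedOffset n (-1) + (0 : ℤ) * longSide)
      (columnBase (mixedOffset n) (-1) + (0 : ℤ) * shortSide) ∧ IsCairo T := by
    unfold mixedDissection
    rw [if_neg (by omega)]
    exact ⟨_, Or.inl rfl, isCairo_of_mem (Or.inl rfl)⟩
  obtain ⟨T, hT, hC⟩ := h
  exact ⟨T, ⟨-1, 0, hT⟩, hC⟩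

lemma exists_isPrismatic_mem_mixedTiling {n : ℕ} (hn : 0 < n) : ∃ T ∈ mixedTiling n, IsPrismatic T := by
  have h : ∃ T, T ∈ mixedDissection n 0 (mixedOffset n 0 + (0 : ℤ) * longSide)
      (columnBase (mixedOffset n) 0 + (0 : ℤ) * shortSide) ∧ IsPrismatic T := by
    unfold mixedDissection
    rw [if_pos (by omega)]
    exact ⟨_, Or.inl rfl, isPrismatic_of_mem (Or.inl rfl)⟩
  obtain ⟨T, hT, hC⟩ := h
  exact ⟨T, ⟨0, 0, hT⟩, hC⟩

/-! ### Non-congruent tilings -/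

/-- `T` has two points at distance at least `√2`. -/
def IsWide (T : Set Plane) : Prop := ∃ y ∈ T, ∃ z ∈ T, Real.sqrt 2 ≤ dist y z

/-- The two right-angled vertices are at squared distance `(1 + √3) ^ 2 * (2 - √3) = 2`. Width thus
gives an isometry-invariant test separating Cairo from Prismatic tiles. -/
lemma isWide_cairoTile {c d : ℝ} (h : c ^ 2 + d ^ 2 = 1) (a b : ℝ) : IsWide (cairoTile c d a b) := by
  refine ⟨_, subset_convexHull ℝ _ ⟨2, rfl⟩, _, subset_convexHull ℝ _ ⟨4, rfl⟩, ?_⟩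
  refine Real.sqrt_le_iff.2 ⟨dist_nonneg, le_of_eq ?_⟩
  rw [dist_place_sq, frameVector_sq h]
  have hs := sqrt_three_sq
  simp [cairoX, cairoY]
  grind

lemma not_isWide_prismTile {c d : ℝ} (h : c ^ 2 + d ^ 2 = 1) (a b : ℝ) :
    ¬ IsWide (prismTile c d a b) := by
  obtain ⟨s1, s2⟩ := sqrt_three_bounds
  have hs := sqrt_three_sq
  have hpos := IsModel.frame_pos
  set r := Real.sqrt (7 / 4 * (2 - Real.sqrt 3)) with hr
  have hr2 : r ^ 2 = 7 / 4 * (2 - Real.sqrt 3) := Real.sq_sqrt (by linarith)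
  have hr0 : 0 ≤ r := Real.sqrt_nonneg _
  have hsub : prismTile c d a b
      -- The centre is shifted towards the base so that all five vertices fit in a disc whose
      -- squared diameter, `7 * (2 - √3)`, is less than `2`.
      ⊆ Metric.closedBall (place (obliquePoint a b) (frameVector c d) 0 (-(3 / 20))) r := by
    refine convexHull_min ?_ (convex_closedBall _ _)
    rintro _ ⟨i, rfl⟩
    rw [Metric.mem_closedBall, ← pow_le_pow_iff_left₀ dist_nonneg hr0 two_ne_zero, dist_place_sq,
      frameVector_sq h, hr2, mul_comm]
    refine mul_le_mul_of_nonneg_right ?_ hpos.le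
    fin_cases i <;> simp [prismX, prismY] <;> nlinarith
  rintro ⟨y, hy, z, hz, hyz⟩
  have h1 := Metric.mem_closedBall.1 (hsub hy)
  have h2 := Metric.mem_closedBall.1 (hsub hz)
  have h3 := dist_triangle_right y z (place (obliquePoint a b) (frameVector c d) 0 (-(3 / 20)))
  have h4 : Real.sqrt 2 ≤ 2 * r := by linarith
  have h5 := pow_le_pow_left₀ (Real.sqrt_nonneg 2) h4 2
  rw [Real.sq_sqrt zero_le_two, mul_pow, hr2] at h5
  linarith

lemma isWide_iff_of_mem_mixedDissection {n : ℕ} {j : ℤ} {a b : ℝ} {T : Set Plane}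
    (hT : T ∈ mixedDissection n j a b) : IsWide T ↔ ¬ (0 ≤ j ∧ j < n) := by
  have hs := sqrt_three_sq
  unfold mixedDissection at hT
  split_ifs at hT with h
  · refine iff_of_false ?_ (not_not.2 h)
    rcases hT with rfl | rfl <;> exact not_isWide_prismTile (by linarith) _ _
  · refine iff_of_true ?_ h
    rcases hT with rfl | rfl | rfl | rfl <;> exact isWide_cairoTile (by norm_num) _ _

/-- The radii of discs that avoid the wide tiles. -/
def gapRadii (𝒯 : Set (Set Plane)) : Set ℝ :=
  {ρ | ∃ x, ∀ T ∈ 𝒯, IsWide T → Disjoint T (Metric.ball x ρ)}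

lemma TilingCongruent.symm {𝒮 𝒯 : Set (Set Plane)} (h : TilingCongruent 𝒮 𝒯) :
    TilingCongruent 𝒯 𝒮 := by
  obtain ⟨φ, rfl⟩ := h
  refine ⟨φ.symm, ?_⟩
  simp [Set.image_image]

lemma TilingCongruent.gapRadii_subset {𝒮 𝒯 : Set (Set Plane)} (h : TilingCongruent 𝒮 𝒯) :
    gapRadii 𝒮 ⊆ gapRadii 𝒯 := by
  obtain ⟨φ, rfl⟩ := h
  rintro ρ ⟨x, hx⟩
  refine ⟨φ x, ?_⟩
  rintro _ ⟨S, hS, rfl⟩ ⟨_, ⟨y, hy, rfl⟩, _, ⟨z, hz, rfl⟩, hyz⟩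
  rw [φ.dist_eq] at hyz
  rw [← φ.image_ball]
  exact (Set.disjoint_image_iff φ.injective).2 (hx S hS ⟨y, hy, z, hz, hyz⟩)

/-- The linear functional that is constant along the columns. -/
def transverse (x : Plane) : ℝ := shortSide * obl x - longSide * hor x

/-- The value of `transverse` at the base of a column. -/
def columnValue (p : ℤ → ℝ) (j : ℤ) : ℝ := (shortSide + longSide) * p j + longSide * shortSide * j

/-- A bound for the variation of `transverse` on a hexagon. -/
def columnWidth : ℝ := 2 * longSide * shortSide + longSide ^ 2

lemma exists_transverse_eq_inner : ∃ g : Plane, g ≠ 0 ∧ ∀ x, transverse x = inner ℝ g x := by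
  have h1 := inradius_pos.ne'
  have h2 : Real.sqrt 3 ≠ 0 := by positivity
  refine ⟨!₂[-longSide / inradius, (2 * shortSide + longSide) / (Real.sqrt 3 * inradius)], ?_, ?_⟩
  · intro h
    have := congrArg (fun x : Plane => x 0) h
    have hm := longSide_pos
    simp at this
    rcases this with h | h
    · exact hm.ne' h
    · exact h1 h
  · intro x
    rw [inner_eq, transverse, obl, hor]
    simp
    field_simp
    ring

/-- Successive hexagons of a column differ by the oblique vector `(longSide, shortSide)`, on which
`transverse` vanishes. The whole column therefore lies in one strip, whatever `k` is. -/
lemma abs_transverse_sub_le {n : ℕ} {j k : ℤ} {T : Set Plane}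
    (hT : T ∈ mixedDissection n j (mixedOffset n j + k * longSide)
      (columnBase (mixedOffset n) j + k * shortSide)) {x : Plane} (hx : x ∈ T) :
    columnValue (mixedOffset n) j - columnWidth ≤ transverse x ∧
      transverse x ≤ columnValue (mixedOffset n) j + columnWidth := by
  have hm := longSide_pos
  have hb := shortSide_pos
  have hl : mixedOffset n (j + 1) - mixedOffset n j ≤ longSide := by
    by_cases h : 0 ≤ j ∧ j < n
    · rw [mixedOffset_succ_of_mem h, longSide_eq]; linarith
    · rw [mixedOffset_succ_of_notMem h]
  obtain ⟨h1, h2, h3, h4, -, -⟩ := (dissects_mixed n j _ _).sub T hT x hx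
  have e : transverse x = columnValue (mixedOffset n) j
      + (shortSide * (obl x - (mixedOffset n j + k * longSide))
        - longSide * (hor x - (columnBase (mixedOffset n) j + k * shortSide))) := by
    unfold transverse columnValue columnBase; ring
  set X := obl x - (mixedOffset n j + k * longSide)
  set Y := hor x - (columnBase (mixedOffset n) j + k * shortSide)
  rw [e, columnWidth]
  have a1 := mul_nonneg hb.le h1
  have a2 : shortSide * X ≤ shortSide * (2 * longSide) :=
    mul_le_mul_of_nonneg_left (by linarith) hb.le
  have a3 := mul_le_mul_of_nonneg_left h4 hm.le
  have a4 : longSide * (-longSide) ≤ longSide * Y := mul_le_mul_of_nonneg_left (by linarith) hm.le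
  constructor <;> nlinarith [mul_pos hm hb]

lemma columnValue_mono (n : ℕ) : Monotone (columnValue (mixedOffset n)) := by
  have hm := longSide_pos
  have hb := shortSide_pos
  refine monotone_int_of_le_succ fun j => ?_
  have := mixedOffset_succ_pos n j
  have e : columnValue (mixedOffset n) (j + 1) - columnValue (mixedOffset n) j
      = (shortSide + longSide) * (mixedOffset n (j + 1) - mixedOffset n j) + longSide * shortSide := by
    unfold columnValue; push_cast; ring
  have : 0 ≤ columnValue (mixedOffset n) (j + 1) - columnValue (mixedOffset n) j := by
    rw [e]; positivity
  linarith

lemma columnValue_zero (n : ℕ) : columnValue (mixedOffset n) 0 = 0 := by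
  simp [columnValue, mixedOffset]

lemma columnValue_natCast (n : ℕ) :
    columnValue (mixedOffset n) n = (shortSide + 2 * longSide) * shortSide * n := by
  unfold columnValue mixedOffset
  rw [show max 0 (min (n : ℤ) (n : ℤ)) = n by omega]
  push_cast
  ring

/-- A disc centred midway across the Prismatic block stays clear of the strips of all Cairo columns.
For small `n` the radius may be negative, and then the ball is empty. -/
lemma exists_mem_gapRadii {g : Plane} (hg : g ≠ 0) (hin : ∀ x, transverse x = inner ℝ g x) (n : ℕ) :
    (columnValue (mixedOffset n) n / 2 - columnWidth) / ‖g‖ ∈ gapRadii (mixedTiling n) := by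
  have hg0 := norm_pos_iff.2 hg
  set V := columnValue (mixedOffset n) n
  refine ⟨(V / 2 / ‖g‖ ^ 2) • g, ?_⟩
  rintro T ⟨j, k, hT⟩ hwide
  rw [Set.disjoint_left]
  intro y hyT hy
  have hj := (isWide_iff_of_mem_mixedDissection hT).1 hwide
  obtain ⟨h1, h2⟩ := abs_transverse_sub_le hT hyT
  have h3 : |transverse y - V / 2| < V / 2 - columnWidth := by
    have e : transverse y - V / 2 = inner ℝ g (y - (V / 2 / ‖g‖ ^ 2) • g) := by
      rw [inner_sub_right, inner_smul_right, real_inner_self_eq_norm_sq, hin]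
      field_simp
    rw [e]
    refine (abs_real_inner_le_norm _ _).trans_lt ?_
    rw [Metric.mem_ball, dist_eq_norm, lt_div_iff₀ hg0] at hy
    linarith
  rw [abs_lt] at h3
  rcases lt_or_ge j 0 with hneg | hnn
  · have := columnValue_mono n hneg.le
    rw [columnValue_zero] at this
    linarith [h3.1]
  · have := columnValue_mono n (show (n : ℤ) ≤ j by omega)
    linarith [h3.2]

/-- A disc avoiding the wide tiles is covered by Prismatic columns, so `transverse` is confined on
it to the strip of the block; moving from the centre along `g` would leave that strip if the radius
were larger. -/
lemma le_of_mem_gapRadii {g : Plane} (hg : g ≠ 0) (hin : ∀ x, transverse x = inner ℝ g x) (n : ℕ)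
    {ρ : ℝ} (hρ : ρ ∈ gapRadii (mixedTiling n)) :
    ρ ≤ (columnValue (mixedOffset n) n + 2 * columnWidth + 1) / ‖g‖ := by
  have hg0 := norm_pos_iff.2 hg
  have hm := longSide_pos
  have hb := shortSide_pos
  have hW : 0 < columnWidth := by unfold columnWidth; positivity
  set V := columnValue (mixedOffset n) n with hVdef
  have hV : 0 ≤ V := by rw [hVdef, columnValue_natCast]; positivity
  obtain ⟨x, hx⟩ := hρ
  by_contra! hcon
  have key : ∀ y ∈ Metric.ball x ρ, -columnWidth ≤ transverse y ∧ transverse y ≤ V + columnWidth := by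
    intro y hy
    obtain ⟨j, k, T, hT, hyT⟩ := exists_mem_columnTiling (mixedOffset_succ_pos n) (dissects_mixed n) y
    have hnw : ¬ IsWide T := fun hw => Set.disjoint_left.1 (hx T ⟨j, k, hT⟩ hw) hyT hy
    rw [isWide_iff_of_mem_mixedDissection hT, not_not] at hnw
    obtain ⟨h1, h2⟩ := abs_transverse_sub_le hT hyT
    have h3 := columnValue_mono n hnw.1
    have h4 := columnValue_mono n hnw.2.le
    rw [columnValue_zero] at h3
    constructor <;> linarith
  have hmem : ∀ t : ℝ, |t| ≤ V + 2 * columnWidth + 1 → x + (t / ‖g‖ ^ 2) • g ∈ Metric.ball x ρ := by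
    intro t ht
    rw [mem_ball_iff_norm, add_sub_cancel_left, norm_smul, Real.norm_eq_abs, abs_div,
      abs_of_pos (show 0 < ‖g‖ ^ 2 by positivity)]
    refine lt_of_le_of_lt ?_ hcon
    rw [show |t| / ‖g‖ ^ 2 * ‖g‖ = |t| / ‖g‖ by field_simp]
    gcongr
  have hval : ∀ t : ℝ, transverse (x + (t / ‖g‖ ^ 2) • g) = transverse x + t := by
    intro t
    rw [hin, hin, inner_add_right, inner_smul_right, real_inner_self_eq_norm_sq]
    field_simp
  have h1 := key _ (hmem (V + 2 * columnWidth + 1) (abs_of_nonneg (by linarith)).le)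
  have h2 := key _ (hmem 0 (by rw [abs_zero]; linarith))
  rw [hval] at h1 h2
  linarith [h1.2, h2.1]

theorem exists_mixed_tilings : ∃ 𝒯 : ℕ → Set (Set Plane),
    (∀ n, IsCairoPrismaticTiling (𝒯 n) ∧ (∃ T ∈ 𝒯 n, IsCairo T) ∧ ∃ T ∈ 𝒯 n, IsPrismatic T) ∧
      ∀ m n, m ≠ n → ¬ TilingCongruent (𝒯 m) (𝒯 n) := by
  obtain ⟨g, hg, hin⟩ := exists_transverse_eq_inner
  have hg0 := norm_pos_iff.2 hg
  have hm := longSide_pos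
  have hb := shortSide_pos
  set κ := (shortSide + 2 * longSide) * shortSide with hκ
  have hκ0 : 0 < κ := by positivity
  -- With `D * 4 ^ i` Prismatic columns the block values grow at least fourfold, so half the larger
  -- exceeds the smaller by at least `κ * D`, more than the `3 * columnWidth + 1` by which the two
  -- radius bounds are blurred.
  obtain ⟨D, hD⟩ := exists_nat_gt ((6 * columnWidth + 2) / κ)
  rw [div_lt_iff₀ hκ0] at hD
  have hW : 0 < columnWidth := by unfold columnWidth; positivity
  have hD0 : 0 < D := by
    rcases Nat.eq_zero_or_pos D with rfl | h
    · simp at hD; linarith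
    · exact h
  have key : ∀ i j : ℕ, i < j → ¬ TilingCongruent (mixedTiling (D * 4 ^ j)) (mixedTiling (D * 4 ^ i)) := by
    intro i j hij hcong
    have h1 := le_of_mem_gapRadii hg hin _
      (hcong.gapRadii_subset (exists_mem_gapRadii hg hin (D * 4 ^ j)))
    rw [div_le_div_iff_of_pos_right hg0, columnValue_natCast, columnValue_natCast, ← hκ] at h1
    have h2 : D * 4 ^ i * 4 ≤ D * 4 ^ j := by
      rw [mul_assoc, ← pow_succ]
      exact Nat.mul_le_mul_left _ (Nat.pow_le_pow_right (by norm_num) hij)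
    have h3 : D ≤ D * 4 ^ i := Nat.le_mul_of_pos_right _ (by positivity)
    have h2' : ((D * 4 ^ i : ℕ) : ℝ) * 4 ≤ ((D * 4 ^ j : ℕ) : ℝ) := by exact_mod_cast h2
    have h3' : (D : ℝ) ≤ ((D * 4 ^ i : ℕ) : ℝ) := by exact_mod_cast h3
    have a1 := mul_le_mul_of_nonneg_left h2' hκ0.le
    have a2 := mul_le_mul_of_nonneg_left h3' hκ0.le
    linarith
  refine ⟨fun n => mixedTiling (D * 4 ^ n), fun n => ⟨isCairoPrismaticTiling_mixedTiling _,
    exists_isCairo_mem_mixedTiling _, exists_isPrismatic_mem_mixedTiling (by positivity)⟩, ?_⟩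
  intro i j hij hcong
  rcases lt_or_gt_of_ne hij with h | h
  · exact key i j h hcong.symm
  · exact key j i h hcong

end PentagonalTiling

end

/-! ### Assembly of the theorem -/

theorem theorem3p5 :
    -- lower bounds for all tilings by unit-area convex polygons with at most five sides
    (∀ 𝒯 : Set (Set PentagonalTiling.Plane), PentagonalTiling.IsAdmissible 𝒯 →
      ENNReal.ofReal (Real.sqrt (2 + Real.sqrt 3)) ≤ PentagonalTiling.perimeterRatio 𝒯 ∧
      ENNReal.ofReal (2 * Real.sqrt (2 + Real.sqrt 3)) ≤
        PentagonalTiling.tilePerimeterRatio 𝒯) ∧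
    -- every tiling by Cairo and Prismatic tiles, mixed or not, is perimeter minimizing
    (∀ 𝒯 : Set (Set PentagonalTiling.Plane), PentagonalTiling.IsCairoPrismaticTiling 𝒯 →
      PentagonalTiling.IsPerimeterMinimizing 𝒯 ∧
      PentagonalTiling.perimeterRatio 𝒯 = ENNReal.ofReal (Real.sqrt (2 + Real.sqrt 3)) ∧
      PentagonalTiling.tilePerimeterRatio 𝒯 =
        ENNReal.ofReal (2 * Real.sqrt (2 + Real.sqrt 3))) ∧
    -- the perimeter of the Cairo and Prismatic tiles
    (∀ P : Set PentagonalTiling.Plane,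
      PentagonalTiling.IsCairo P ∨ PentagonalTiling.IsPrismatic P →
      PentagonalTiling.perimeter P = ENNReal.ofReal (2 * Real.sqrt (2 + Real.sqrt 3))) ∧
    -- there are tilings by Cairo tiles, by Prismatic tiles, and infinitely many mixed ones
    (∃ 𝒯 : Set (Set PentagonalTiling.Plane),
      PentagonalTiling.IsTiling 𝒯 ∧ ∀ T ∈ 𝒯, PentagonalTiling.IsCairo T) ∧
    (∃ 𝒯 : Set (Set PentagonalTiling.Plane),
      PentagonalTiling.IsTiling 𝒯 ∧ ∀ T ∈ 𝒯, PentagonalTiling.IsPrismatic T) ∧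
    (∃ 𝒯 : ℕ → Set (Set PentagonalTiling.Plane),
      (∀ n, PentagonalTiling.IsCairoPrismaticTiling (𝒯 n) ∧
        (∃ T ∈ 𝒯 n, PentagonalTiling.IsCairo T) ∧
        (∃ T ∈ 𝒯 n, PentagonalTiling.IsPrismatic T)) ∧
      ∀ m n, m ≠ n → ¬ PentagonalTiling.TilingCongruent (𝒯 m) (𝒯 n)) := by
  exact ⟨fun 𝒯 h => ⟨h.le_perimeterRatio, h.le_tilePerimeterRatio⟩,
    fun 𝒯 h => ⟨h.isPerimeterMinimizing, h.perimeterRatio_eq, h.tilePerimeterRatio_eq⟩,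
    fun P h => PentagonalTiling.perimeter_of_isCairo_or_isPrismatic h,
    PentagonalTiling.exists_cairo_tiling, PentagonalTiling.exists_prismatic_tiling,
    PentagonalTiling.exists_mixed_tilings⟩
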